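/- **Diagrams.** Fix $m\ge 1$, $K\ge 2$ and the variable order $x_1,\dots,x_m$. An ordered multi-terminal binary decision diagram (OMTBDD) is a finite rooted directed acyclic graph in which every node is reachable from the root, there is at most one sink for each value in $\{0,\dots,K-1\}$, every internal node is labelled by a variable and has a $0$-edge and a $1$-edge, and the variable indices increase along every path. It represents a function $\{0,1\}^m\to\{0,\dots,K-1\}$ by following, at a node labelled $x_i$, the edge labelled by the $i$-th bit. It is reduced if no internal node has both edges ending in the same node and no two distinct nodes have the same label and the same successors. We write $D(\boldsymbol a)$ for the value of $D$ at $\boldsymbol a$, $\mathrm{pre}(\boldsymbol a,j)$ and $\mathrm{suf}(\boldsymbol a,j)$ for the prefix and suffix of length $j$, $\mathrm{cro}(\boldsymbol a,\boldsymbol b,j)=\mathrm{pre}(\boldsymbol a,|\boldsymbol a|-j)\,\mathrm{suf}(\boldsymbol b,j)$, $\lambda$ for the empty string, and $\dot{\boldsymbol t}$ for $\boldsymbol t$ with its first bit flipped. **Queries.** For an unknown reduced OMTBDD $D$, a membership query for $\boldsymbol a\in\{0,1\}^m$ returns $D(\boldsymbol a)$. An equivalence query for an ordered diagram $H$ returns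 YES if $H$ and $D$ represent the same function, and otherwise NO with an arbitrary counterexample $\boldsymbol e\in\{0,1\}^m$, $H(\boldsymbol e)\ne D(\boldsymbol e)$. (A hypothesis may contain nodes that cannot be reached from its root; they do not affect its function.) Queries are counted with repetitions. **Data of the algorithm QLearn-OMTBDD.** It keeps a hypothesis $S$ and trees $T_1,\dots,T_m$. The nodes of $S$ are strings: sinks have length $m$ and carry a value, an internal node $\boldsymbol v$ is labelled $x_{|\boldsymbol v|+1}$. An edge from $\boldsymbol u$ to $\boldsymbol v$ carries a string $l(\boldsymbol u,\boldsymbol v)$ of length $|\boldsymbol v|-|\boldsymbol u|$; the edges leaving a node have different first bits. The root is $\lambda$, which is a dummy if it has only one outgoing edge. The diagram $\mathcal D(S)$ is obtained from $S$ by removing a dummy root and keeping only the first bit of each edge label. The tree $T_i$ classifies strings $\boldsymbol a\in\{0,1\}^i$ into node ids or $\mu$. At a single-test node labelled $\boldsymbol r$ one follows the edge labelled $D(\boldsymbol a\boldsymbol r)$. At a twin-test node labelled $\boldsymbol r$ one follows the labelled edge if its label is $(D(\boldsymbol a\boldsymbol r),D(\boldsymbol a\dot{\boldsymbol r}))$,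 and the unlabelled edge otherwise. Leaves are labelled by node ids or $\mu$. If a single-test node has no edge with the required label, the classification is stuck there. **The algorithm.** 1. Ask an equivalence query for the constant $0$; on YES output it. On NO with $\boldsymbol e'$, put $\ell'=D(\boldsymbol e')$ and ask an equivalence query for the constant $\ell'$; on YES output it. On NO with $\boldsymbol e$, put $\ell=D(\boldsymbol e)$. 2. (Initial hypothesis.) By binary search find $i$ with $D(\mathrm{cro}(\boldsymbol e',\boldsymbol e,i-1))=\ell'\ne D(\mathrm{cro}(\boldsymbol e',\boldsymbol e,i))=:y$. Put $\boldsymbol v=\mathrm{pre}(\boldsymbol e',m-i)$ and $\boldsymbol w=\mathrm{cro}(\boldsymbol e',\boldsymbol e,i)$. $S$ has the root $\lambda$, the node $\boldsymbol v$, sinks $\boldsymbol e'$ (value $\ell'$) and $\boldsymbol w$ (value $y$), edges from $\boldsymbol v$ to them, and, if $\boldsymbol v\ne\lambda$, an edge $(\lambda,\boldsymbol v)$ labelled $\boldsymbol v$. $T_m$ is a single-test node $\lambda$ with leaves $\boldsymbol e'$, $\boldsymbol w$ on edges $\ell'$, $y$; $T_{m-i}$ (if $i<m$) is a twin-test node $\mathrm{suf}(\boldsymbol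 e,i)$ with leaf $\boldsymbol v$ on edge $(y,\ell')$ and leaf $\mu$; all other trees are a leaf $\mu$. 3. Repeat: if $S(\boldsymbol e)=\ell$, ask an equivalence query for $\mathcal D(S)$, output $\mathcal D(S)$ on YES, and on NO take the new counterexample $\boldsymbol e$ and $\ell=D(\boldsymbol e)$. Then perform the update in 4. 4. (Update.) Let $\boldsymbol p_1,\dots,\boldsymbol p_k$ be the nodes of $S$ passed by $\boldsymbol e$, let $\boldsymbol e_i=\mathrm{suf}(\boldsymbol e,m-|\boldsymbol p_i|)$ and let $c=D(\boldsymbol p_k)$ be the value of the sink reached. By binary search find $i$ with $D(\boldsymbol p_i\boldsymbol e_i)\ne D(\boldsymbol p_{i+1}\boldsymbol e_{i+1})=c$. Put $\boldsymbol q=l(\boldsymbol p_i,\boldsymbol p_{i+1})$ and $x=D(\boldsymbol p_i\boldsymbol q\boldsymbol e_{i+1})$. Apply 5 if $x\ne c$ and 6 if $x=c$. 5. (NodeSplit.) Put $\boldsymbol v=\boldsymbol p_i\boldsymbol q$, add it to $S$ and redirect the edge $(\boldsymbol p_i,\boldsymbol p_{i+1})$ to $\boldsymbol v$. Let $T'$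 be a single-test node $\boldsymbol e_{i+1}$ with leaves $\boldsymbol p_{i+1}$, $\boldsymbol v$ on edges $c$, $x$. Let $\boldsymbol t$ be the label of the last twin-test node above the leaf $\boldsymbol p_{i+1}$ of $T_{|\boldsymbol v|}$. Execute AddEdge$(\boldsymbol v,\boldsymbol t)$ and AddEdge$(\boldsymbol v,\dot{\boldsymbol t})$. For every remaining edge $(\boldsymbol v_1,\boldsymbol p_{i+1})$, labelled $\boldsymbol q'$, classify $\boldsymbol v_1\boldsymbol q'$ by $T'$; if a leaf is reached, redirect the edge to that node; if stuck, add a node $\boldsymbol v'=\boldsymbol v_1\boldsymbol q'$ to $S$ and a leaf $\boldsymbol v'$ to $T'$, redirect the edge to $\boldsymbol v'$, and execute AddEdge$(\boldsymbol v',\boldsymbol t)$ and AddEdge$(\boldsymbol v',\dot{\boldsymbol t})$. Finally replace the leaf $\boldsymbol p_{i+1}$ of $T_{|\boldsymbol v|}$ by $T'$. 6. (NewBranchingNode.) Let $\boldsymbol f=\mathrm{pre}(\boldsymbol e_i,|\boldsymbol q|)$. By binary search find $j\in\{1,\dots,|\boldsymbol q|\}$ with $z:=D(\boldsymbol p_i\,\mathrm{cro}(\boldsymbol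 q,\boldsymbol f,j)\,\boldsymbol e_{i+1})\ne D(\boldsymbol p_i\,\mathrm{cro}(\boldsymbol q,\boldsymbol f,j-1)\,\boldsymbol e_{i+1})=c$. Put $\boldsymbol v=\boldsymbol p_i\,\mathrm{pre}(\boldsymbol q,|\boldsymbol q|-j)$ and $\boldsymbol r=\mathrm{suf}(\boldsymbol e,m-|\boldsymbol v|)$. If $j\ne|\boldsymbol q|$: insert the node $\boldsymbol v$ into the edge $(\boldsymbol p_i,\boldsymbol p_{i+1})$, splitting its label; let $T'$ be a twin-test node $\boldsymbol r$ with leaf $\boldsymbol v$ on edge $(z,c)$ and leaf $\mu$; replace every edge $(\boldsymbol v_1,\boldsymbol v_2)$ with $|\boldsymbol v_1|<|\boldsymbol v|<|\boldsymbol v_2|$ for which $\boldsymbol g=\mathrm{pre}(l(\boldsymbol v_1,\boldsymbol v_2),|\boldsymbol v|-|\boldsymbol v_1|)$ satisfies $T'(\boldsymbol v_1\boldsymbol g)=\boldsymbol v$ by an edge $(\boldsymbol v_1,\boldsymbol v)$ labelled $\boldsymbol g$; replace the leaf $\mu$ of $T_{|\boldsymbol v|}$ by $T'$. In any case execute AddEdge$(\boldsymbol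 v,\boldsymbol r)$. 7. (AddEdge$(\boldsymbol v,\boldsymbol t)$.) For $j=1,2,\dots$ classify $\boldsymbol u'=\boldsymbol v\,\mathrm{pre}(\boldsymbol t,j)$ by $T_{|\boldsymbol v|+j}$ until the result is not $\mu$. If it is a leaf $\boldsymbol u$, add an edge $(\boldsymbol v,\boldsymbol u)$ labelled $\mathrm{pre}(\boldsymbol t,j)$. If the classification is stuck, add a leaf $\boldsymbol u'$ below the single-test node where it is stuck, with the edge label just observed, add $\boldsymbol u'$ to $S$ (as a sink with value $D(\boldsymbol u')$ if $|\boldsymbol u'|=m$) and an edge $(\boldsymbol v,\boldsymbol u')$ labelled $\mathrm{pre}(\boldsymbol t,j)$, and, if $|\boldsymbol u'|<m$, execute AddEdge$(\boldsymbol u',\boldsymbol t)$ and AddEdge$(\boldsymbol u',\dot{\boldsymbol t})$. **Theorem.** Let $D$ be any reduced OMTBDD over $m\ge1$ variables with $n$ nodes. Whatever counterexamples are returned, QLearn-OMTBDD terminates and outputs exactly $D$ (up to the names of the nodes). It asks at most $2n(\lceil\log_2 m\rceil+3n)$ membership queries. It asks at most $n$ equivalence queries, except that it asks exactly $2$ if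 $D$ consists of a single sink with a non-zero label. -/

import Mathlib

/-! ### Ordered multi-terminal binary decision diagrams -/

namespace OMTBDD

/-- Binary strings; assignments to `x₁, …, xₘ` are strings of length `m`. -/
abbrev Str := List Bool

/-- The content of a node: a sink with its value, or an internal node labelled by the variable
that is preceded by `i` variables in the order (that is, by `x_{i+1}`), with the end points of its
`0`-labelled and `1`-labelled edges. -/
inductive Cell (V L : Type*) where
  | sink (value : L)
  | branch (i : ℕ) (lo hi : V)

/-- Renaming the nodes in the content of a node. -/
def Cell.map {V W L : Type*} (f : V → W) : Cell V L → Cell W L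
  | .sink l => .sink l
  | .branch i lo hi => .branch i (f lo) (f hi)

/-- A decision diagram with nodes taken from `V` and function values in `L`. -/
structure Diagram (V L : Type*) where
  root : V
  nodes : Finset V
  cell : V → Cell V L

namespace Diagram

variable {V W L : Type*}

/-- Follow the path of the assignment `a` from node `v`, through at most `fuel` edges. -/
def evalFrom (D : Diagram V L) (a : Str) : (fuel : ℕ) → (v : V) → Option L
  | 0, v =>
    match D.cell v with
    | .sink l => some l
    | .branch _ _ _ => none
  | fuel + 1, v =>
    match D.cell v with
    | .sink l => some l
    | .branch i lo hi => D.evalFrom a fuel (if a.getD i false then hi else lo)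

/-- The value of the represented function at `a`. In a diagram over `m = |a|` variables that is
ordered, every path has at most `m` edges, so that the value is always defined. -/
def eval (D : Diagram V L) (a : Str) : Option L := D.evalFrom a a.length D.root

/-- There is an edge from `v` to `w`. -/
def Child (D : Diagram V L) (v w : V) : Prop :=
  ∃ i lo hi, D.cell v = .branch i lo hi ∧ (w = lo ∨ w = hi)

/-- `D` is a multi-terminal diagram over `m` variables that respects the variable order and has
at most one sink for each value. (Nodes that cannot be reached from the root are not excluded
here.) -/
structure IsOrdered (D : Diagram V L) (m : ℕ) : Prop where
  root_mem : D.root ∈ D.nodes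
  child_mem : ∀ v ∈ D.nodes, ∀ w, D.Child v w → w ∈ D.nodes
  var_lt : ∀ v ∈ D.nodes, ∀ i lo hi, D.cell v = .branch i lo hi → i < m
  ordered : ∀ v ∈ D.nodes, ∀ i lo hi, D.cell v = .branch i lo hi →
    ∀ w, D.Child v w → ∀ j lo' hi', D.cell w = .branch j lo' hi' → i < j
  sink_unique : ∀ v ∈ D.nodes, ∀ w ∈ D.nodes, ∀ l,
    D.cell v = .sink l → D.cell w = .sink l → v = w

/-- `D` is a reduced OMTBDD over `m` variables: every node can be reached from the root, no node
has its two edges ending in the same node, and no two nodes have the same label and the same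
successors. -/
structure IsReduced (D : Diagram V L) (m : ℕ) : Prop extends D.IsOrdered m where
  reachable : ∀ v ∈ D.nodes, Relation.ReflTransGen D.Child D.root v
  no_redundant : ∀ v ∈ D.nodes, ∀ i lo hi, D.cell v = .branch i lo hi → lo ≠ hi
  no_duplicate : ∀ v ∈ D.nodes, ∀ w ∈ D.nodes, D.cell v = D.cell w → v = w

/-- `D` and `E` are the same diagram, up to the names of the nodes. -/
def Iso (D : Diagram V L) (E : Diagram W L) : Prop :=
  ∃ f : V → W, Set.BijOn f (D.nodes : Set V) (E.nodes : Set W) ∧ f D.root = E.root ∧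
    ∀ v ∈ D.nodes, E.cell (f v) = (D.cell v).map f

/-- The diagram that consists of one sink. -/
def const (l : L) : Diagram Str L where
  root := []
  nodes := {[]}
  cell := fun _ => .sink l

end Diagram

/-! ### Learners with membership and equivalence queries -/

/-- Programs of a learner. The only access to the target is through the two kinds of queries:
`mem a k` asks a membership query for `a` and goes on with `k` applied to the answer; `equ H k`
asks an equivalence query for `H` and goes on with `k` applied to the answer, which is `none`
for 'YES' and `some e` for 'NO' with the counterexample `e`. -/
inductive Prog (L : Type) (α : Type) : Type where
  | ret (x : α) : Prog L α
  | mem (a : Str) (k : L → Prog L α) : Prog L α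
  | equ (H : Diagram Str L) (k : Option Str → Prog L α) : Prog L α

namespace Prog

variable {L α β : Type}

/-- Sequential composition. -/
def bind (p : Prog L α) (f : α → Prog L β) : Prog L β :=
  match p with
  | ret x => f x
  | mem a k => mem a fun l => (k l).bind f
  | equ H k => equ H fun r => (k r).bind f

instance : Monad (Prog L) where
  pure := ret
  bind := bind

/-- Run a program with membership oracle `MQ` and equivalence oracle `EQ`; the first argument of
`EQ` is the number of equivalence queries asked before, so that repeated queries may be answered
differently. The result is the output together with the numbers `nE` of equivalence queries and
`nM` of membership queries, counted with repetitions and from the given initial values. -/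
def run (MQ : Str → L) (EQ : ℕ → Diagram Str L → Option Str) :
    Prog L α → (nE nM : ℕ) → α × ℕ × ℕ
  | ret x, nE, nM => (x, nE, nM)
  | mem a k, nE, nM => (k (MQ a)).run MQ EQ nE (nM + 1)
  | equ H k, nE, nM => (k (EQ nE H)).run MQ EQ (nE + 1) nM

end Prog

/-- Ask a membership query. -/
def ask {L : Type} (a : Str) : Prog L L := .mem a .ret

/-- Ask an equivalence query. -/
def askEq {L : Type} (H : Diagram Str L) : Prog L (Option Str) := .equ H .ret

/-- `MQ` answers the membership queries for the target `D` correctly. -/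
def CorrectMQ {V L : Type*} (D : Diagram V L) (m : ℕ) (MQ : Str → L) : Prop :=
  ∀ a : Str, a.length = m → D.eval a = some (MQ a)

/-- `EQ` answers the equivalence queries for the target `D` correctly, with arbitrary
counterexamples. Nothing is demanded for hypotheses that are not ordered diagrams. -/
def CorrectEQ {V L : Type*} (D : Diagram V L) (m : ℕ)
    (EQ : ℕ → Diagram Str L → Option Str) : Prop :=
  ∀ (t : ℕ) (H : Diagram Str L), H.IsOrdered m →
    (EQ t H = none → ∀ a : Str, a.length = m → H.eval a = D.eval a) ∧
    (∀ e, EQ t H = some e → e.length = m ∧ H.eval e ≠ D.eval e)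

/-! ### Strings -/

/-- Flip the first bit. -/
def flip : Str → Str
  | [] => []
  | b :: a => (!b) :: a

/-- `cro a b j`: the first `|a| - j` bits of `a` followed by the last `j` bits of `b`. -/
def cro (a b : Str) (j : ℕ) : Str := a.take (a.length - j) ++ b.drop (b.length - j)

/-! ### Node classification trees -/

/-- Node classification trees. A leaf is labelled by a node id or by `μ`, which is `none`.
`single r dom child` is a single-test node labelled `r`; its outgoing edges are labelled by the
elements of `dom`, the edge labelled `l` leading to `child l` (`child l` is irrelevant for
`l ∉ dom`). `twin r x y hit miss` is a twin-test node labelled `r`; its edge labelled `(x, y)`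
leads to `hit` and its unlabelled edge leads to `miss`. -/
inductive CTree (L : Type) : Type where
  | leaf (v : Option Str) : CTree L
  | single (r : Str) (dom : List L) (child : L → CTree L) : CTree L
  | twin (r : Str) (x y : L) (hit miss : CTree L) : CTree L

/-- Results of a classification of `a`: the label of a leaf, or `stuck l grown` if a single-test
node labelled `r` without an edge labelled `l = D(a r)` has been reached; `grown` is then the
tree after adding a leaf labelled `a` as a child of that node, with an edge labelled `l`. -/
inductive CResult (L : Type) : Type where
  | label (v : Option Str) : CResult L
  | stuck (l : L) (grown : CTree L) : CResult L

/-- Apply `f` to the grown tree, if there is one. -/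
def CResult.mapTree {L : Type} (f : CTree L → CTree L) : CResult L → CResult L
  | .label v => .label v
  | .stuck l T => .stuck l (f T)

namespace CTree

variable {L : Type} [DecidableEq L]

/-- Classify `a` by membership queries. -/
def classify (a : Str) : CTree L → Prog L (CResult L)
  | leaf v => pure (.label v)
  | single r dom child => do
    let l ← ask (a ++ r)
    if l ∈ dom then
      let res ← (child l).classify a
      pure (res.mapTree fun T => single r dom (Function.update child l T))
    else
      pure (.stuck l (single r (l :: dom) (Function.update child l (leaf (some a)))))
  | twin r x y hit miss => do
    let l ← ask (a ++ r)
    let l' ← ask (a ++ flip r)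
    if l = x ∧ l' = y then
      let res ← hit.classify a
      pure (res.mapTree fun T => twin r x y T miss)
    else
      let res ← miss.classify a
      pure (res.mapTree fun T => twin r x y hit T)

/-- Replace the leaf labelled `v` by the tree `T'`. -/
def subst : CTree L → (v : Option Str) → (T' : CTree L) → CTree L
  | leaf w, v, T' => if w = v then T' else leaf w
  | single r dom child, v, T' => single r dom fun l => (child l).subst v T'
  | twin r x y hit miss, v, T' => twin r x y (hit.subst v T') (miss.subst v T')

/-- The label of the last twin-test node on the path from the root to the leaf labelled `v`;
`last` is the label of the last twin-test node above the given tree. -/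
def lastTwin (v : Str) : CTree L → (last : Str) → Option Str
  | leaf w, last => if w = some v then some last else none
  | single _ dom child, last => dom.findSome? fun l => (child l).lastTwin v last
  | twin r _ _ hit miss, _ => (hit.lastTwin v r).or (miss.lastTwin v r)

end CTree

/-! ### OMTBDDs with access strings -/

/-- An edge with its label string. -/
structure Edge where
  src : Str
  lab : Str
  tgt : Str
  deriving DecidableEq

/-- An OMTBDD with access strings: its internal nodes (the root `[]` included, dummy or not), its
sinks with their labels, and its edges. Nodes are given by their id strings; the node `v` that is
not a sink is labelled `x_{|v|+1}`. -/
structure OMTBDDAS (L : Type) where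
  inner : List Str
  sinks : List (Str × L)
  edges : List Edge

namespace OMTBDDAS

variable {L : Type}

/-- The edges that go out from `v`. -/
def out (S : OMTBDDAS L) (v : Str) : List Edge := S.edges.filter fun E => E.src = v

/-- The edge that goes out from `v` and begins with bit `b`. -/
def edge? (S : OMTBDDAS L) (v : Str) (b : Bool) : Option Edge :=
  (S.out v).find? fun E => E.lab.head? = some b

/-- The only outgoing edge of the root, if the root is a dummy. -/
def dummyEdge? (S : OMTBDDAS L) : Option Edge :=
  match S.out [] with
  | [E] => some E
  | _ => none

/-- The edge by which the assignment `e` leaves `v`. -/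
def next? (S : OMTBDDAS L) (e v : Str) : Option Edge :=
  match if v = [] then S.dummyEdge? else none with
  | some E => some E
  | none => S.edge? v (e.getD v.length false)

/-- The edges that `e` passes from `v` on, at most `fuel` many. -/
def pathFrom (S : OMTBDDAS L) (e : Str) : (fuel : ℕ) → (v : Str) → List Edge
  | 0, _ => []
  | fuel + 1, v =>
    match S.next? e v with
    | none => []
    | some E => E :: S.pathFrom e fuel E.tgt

/-- The edges that `e` passes. -/
def path (S : OMTBDDAS L) (e : Str) : List Edge := S.pathFrom e e.length []

/-- The ids of the nodes that `e` passes, beginning with the root. -/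
def ids (S : OMTBDDAS L) (e : Str) : List Str := [] :: (S.path e).map Edge.tgt

/-- The label of the sink `v`. -/
def sinkLabel [Zero L] (S : OMTBDDAS L) (v : Str) : L := (S.sinks.lookup v).getD 0

/-- The value `S(e)`: the label of the sink that `e` reaches. -/
def value [Zero L] (S : OMTBDDAS L) (e : Str) : L := S.sinkLabel ((S.ids e).getLastD [])

/-- Add an edge. -/
def addEdge (S : OMTBDDAS L) (E : Edge) : OMTBDDAS L := { S with edges := E :: S.edges }

/-- Remove the edge `E` and add the edge `E'`. -/
def replaceEdge (S : OMTBDDAS L) (E E' : Edge) : OMTBDDAS L :=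
  { S with edges := E' :: S.edges.erase E }

/-- Add an internal node. -/
def addInner (S : OMTBDDAS L) (v : Str) : OMTBDDAS L := { S with inner := v :: S.inner }

/-- Add a sink with label `l`. -/
def addSink (S : OMTBDDAS L) (v : Str) (l : L) : OMTBDDAS L :=
  { S with sinks := (v, l) :: S.sinks }

/-- The diagram represented by `S`: a dummy root is removed together with its edge, and only the
first bits of the label strings are kept. -/
def toDiagram (S : OMTBDDAS L) : Diagram Str L where
  root :=
    match S.dummyEdge? with
    | some E => E.tgt
    | none => []
  nodes :=
    match S.dummyEdge? with
    | some _ => (S.inner ++ S.sinks.map Prod.fst).toFinset.erase []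
    | none => (S.inner ++ S.sinks.map Prod.fst).toFinset
  cell := fun v =>
    match S.sinks.lookup v with
    | some l => .sink l
    | none => .branch v.length (((S.edge? v false).map Edge.tgt).getD [])
        (((S.edge? v true).map Edge.tgt).getD [])

end OMTBDDAS

/-- What the algorithm stores: an OMTBDDAS and the classification trees `T 1, …, T m`, where
`T i` classifies strings of length `i`. -/
structure Hyp (L : Type) where
  S : OMTBDDAS L
  T : ℕ → CTree L

/-- Replace the tree `T i`. -/
def Hyp.setTree {L : Type} (h : Hyp L) (i : ℕ) (T' : CTree L) : Hyp L :=
  { h with T := Function.update h.T i T' }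

/-- Update the OMTBDDAS. -/
def Hyp.mapS {L : Type} (h : Hyp L) (f : OMTBDDAS L → OMTBDDAS L) : Hyp L :=
  { h with S := f h.S }

/-! ### The algorithm -/

section Algorithm

variable {L : Type} [DecidableEq L]

/-- Binary search: given `phi lo = c` and `phi hi = y ≠ c`, find `i` with `lo < i ≤ hi` and
`phi (i - 1) = c ≠ phi i`, and return `i` and `phi i`. Called with `fuel = hi - lo`, which is
always enough. -/
def bsearch (phi : ℕ → Prog L L) (c : L) : (fuel lo hi : ℕ) → (y : L) → Prog L (ℕ × L)
  | 0, _, hi, y => pure (hi, y)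
  | fuel + 1, lo, hi, y =>
    if hi ≤ lo + 1 then pure (hi, y)
    else do
      let mid := (lo + hi) / 2
      let z ← phi mid
      if z = c then bsearch phi c fuel mid hi y
      else bsearch phi c fuel lo mid z

/-- Algorithm AddEdge: the `for`-loop from index `j` on. `fuel` is the number of indices that
are left, `m + 1 - (|v| + j)`, so that the loop is entered with `fuel = m - |v|` and `j = 1`. -/
def addEdgeFrom (m : ℕ) : (fuel : ℕ) → (v t : Str) → (j : ℕ) → Hyp L → Prog L (Hyp L)
  | 0, _, _, _, h => pure h
  | fuel + 1, v, t, j, h => do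
    let u' := v ++ t.take j
    let res ← (h.T (v.length + j)).classify u'
    match res with
    | .label none => addEdgeFrom m fuel v t (j + 1) h
    | .label (some u) => pure (h.mapS fun S => S.addEdge ⟨v, t.take j, u⟩)
    | .stuck l grown =>
      let h := h.setTree (v.length + j) grown
      if j = m - v.length then
        pure (h.mapS fun S => (S.addSink u' l).addEdge ⟨v, t.take j, u'⟩)
      else do
        let h := h.mapS fun S => (S.addInner u').addEdge ⟨v, t.take j, u'⟩
        let h ← addEdgeFrom m fuel u' t 1 h
        addEdgeFrom m fuel u' (flip t) 1 h

/-- Algorithm AddEdge. -/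
def addEdge (m : ℕ) (v t : Str) (h : Hyp L) : Prog L (Hyp L) :=
  addEdgeFrom m (m - v.length) v t 1 h

/-- The loop of NodeSplit over the edges that enter the node to be split; `Te` is the new part
of the classification tree. -/
def splitLoop (m : ℕ) (t : Str) : List Edge → Hyp L → CTree L → Prog L (Hyp L × CTree L)
  | [], h, Te => pure (h, Te)
  | F :: Fs, h, Te => do
    let v' := F.src ++ F.lab
    let res ← Te.classify v'
    match res with
    | .label none => splitLoop m t Fs h Te
    | .label (some u) =>
      splitLoop m t Fs (h.mapS fun S => S.replaceEdge F ⟨F.src, F.lab, u⟩) Te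
    | .stuck _ grown =>
      let h := h.mapS fun S => (S.addInner v').replaceEdge F ⟨F.src, F.lab, v'⟩
      let h ← addEdge m v' t h
      let h ← addEdge m v' (flip t) h
      splitLoop m t Fs h grown

/-- Algorithm NodeSplit for the edge `E = (pᵢ, pᵢ₊₁)`, with `c = D(p_k)` and
`x = D(pᵢ · l(pᵢ, pᵢ₊₁) · eᵢ₊₁)`. -/
def nodeSplit (m : ℕ) (h : Hyp L) (e : Str) (E : Edge) (c x : L) : Prog L (Hyp L) := do
  let e1 := e.drop E.tgt.length
  let v := E.src ++ E.lab
  let h := h.mapS fun S => (S.addInner v).replaceEdge E ⟨E.src, E.lab, v⟩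
  let Te := CTree.single e1 [c, x] fun l => if l = c then .leaf (some E.tgt) else .leaf (some v)
  let t := ((h.T v.length).lastTwin E.tgt []).getD []
  let h ← addEdge m v t h
  let h ← addEdge m v (flip t) h
  let (h, Te) ← splitLoop m t (h.S.edges.filter fun F => F.tgt = E.tgt) h Te
  pure (h.setTree v.length ((h.T v.length).subst (some E.tgt) Te))

/-- The loop of NewBranchingNode over edges that pass the level of the new node `v`; `Tr` is the
new part of the classification tree. -/
def branchLoop (v : Str) (Tr : CTree L) : List Edge → Hyp L → Prog L (Hyp L)
  | [], h => pure h
  | F :: Fs, h => do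
    let g := F.lab.take (v.length - F.src.length)
    let res ← Tr.classify (F.src ++ g)
    match res with
    | .label (some _) => branchLoop v Tr Fs (h.mapS fun S => S.replaceEdge F ⟨F.src, g, v⟩)
    | _ => branchLoop v Tr Fs h

/-- Algorithm NewBranchingNode for the edge `E = (pᵢ, pᵢ₊₁)`, with `c = D(p_k)` and
`y = D(pᵢ · eᵢ)`. -/
def newBranchingNode (m : ℕ) (h : Hyp L) (e : Str) (E : Edge) (c y : L) : Prog L (Hyp L) := do
  let e1 := e.drop E.tgt.length
  let q := E.lab
  let f := (e.drop E.src.length).take q.length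
  let (j, z) ← bsearch (fun j => ask (E.src ++ cro q f j ++ e1)) c q.length 0 q.length y
  let v := E.src ++ q.take (q.length - j)
  let r := e.drop v.length
  if j ≠ q.length then
    let h := h.mapS fun S =>
      ((S.addInner v).replaceEdge E ⟨E.src, q.take (q.length - j), v⟩).addEdge
        ⟨v, q.drop (q.length - j), E.tgt⟩
    let Tr := CTree.twin r z c (.leaf (some v)) (.leaf none)
    let h ← branchLoop v Tr
      (h.S.edges.filter fun F => F.src.length < v.length ∧ v.length < F.tgt.length) h
    let h := h.setTree v.length ((h.T v.length).subst none Tr)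
    addEdge m v r h
  else
    addEdge m v r h

/-- Algorithm Update-Hypothesis for the counterexample `e` with `l = D(e)`. The binary search
runs along the path of `e` from its end: the node at distance `s` from the sink `p_k` is
`p (k - s)`, where `k` is the number of edges of the path and the root is `p 0`. -/
def updateHypothesis [Zero L] (m : ℕ) (h : Hyp L) (e : Str) (l : L) : Prog L (Hyp L) := do
  let k := (h.S.path e).length
  let p := fun i => (h.S.ids e).getD i []
  let c := h.S.value e
  let (s, y) ← bsearch (fun s => ask (p (k - s) ++ e.drop (p (k - s)).length)) c k 0 k l
  match (h.S.path e)[k - s]? with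
  | none => pure h
  | some E =>
    let x ← ask (E.src ++ E.lab ++ e.drop E.tgt.length)
    if x ≠ c then nodeSplit m h e E c x
    else newBranchingNode m h e E c y

/-- Algorithm Initial-Hypothesis for `e'` and `e` with `D(e') = l' ≠ l = D(e)`. -/
def initialHypothesis (m : ℕ) (e' : Str) (l' : L) (e : Str) (l : L) : Prog L (Hyp L) := do
  let (i, y) ← bsearch (fun i => ask (cro e' e i)) l' m 0 m l
  let v := e'.take (m - i)
  let w := cro e' e i
  let E' : Edge := ⟨v, e'.drop (m - i), e'⟩
  let E : Edge := ⟨v, e.drop (m - i), w⟩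
  pure {
    S := {
      inner := if i = m then [[]] else [[], v]
      sinks := [(e', l'), (w, y)]
      edges := if i = m then [E', E] else [⟨[], v, v⟩, E', E] }
    T := fun d =>
      if d = m then
        .single [] [l', y] fun a => if a = l' then .leaf (some e') else .leaf (some w)
      else if d = m - i then .twin (e.drop (m - i)) y l' (.leaf (some v)) (.leaf none)
      else .leaf none }

/-- The main loop of QLearn-OMTBDD, cut off after `fuel` iterations (with result `none`). -/
def mainLoop [Zero L] (m : ℕ) :
    (fuel : ℕ) → Hyp L → (e : Str) → (l : L) → Prog L (Option (Diagram Str L))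
  | 0, _, _, _ => pure none
  | fuel + 1, h, e, l =>
    if h.S.value e = l then do
      match ← askEq h.S.toDiagram with
      | none => pure (some h.S.toDiagram)
      | some e =>
        let l ← ask e
        let h ← updateHypothesis m h e l
        mainLoop m fuel h e l
    else do
      let h ← updateHypothesis m h e l
      mainLoop m fuel h e l

/-- Algorithm QLearn-OMTBDD for `m` variables, with its main loop cut off after `fuel`
iterations. -/
def qLearn [Zero L] (m fuel : ℕ) : Prog L (Option (Diagram Str L)) := do
  match ← askEq (Diagram.const 0) with
  | none => pure (some (Diagram.const 0))
  | some e' =>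
    let l' ← ask e'
    match ← askEq (Diagram.const l') with
    | none => pure (some (Diagram.const l'))
    | some e =>
      let l ← ask e
      let h ← initialHypothesis m e' l' e l
      mainLoop m fuel h e l

end Algorithm

end OMTBDD

/-!
For the function `f` of `D`, a prefix `a` gives the residual `f (a ++ ·)`. The nodes of a reduced
diagram are exactly the residuals that are constant of length `0` or depend on their first bit, so
a reduced diagram has the fewest nodes among all ordered diagrams for `f`, and an ordered diagram
for `f` with at most as many nodes is isomorphic to it. In a hypothesis, the twin tests certify that
the residual of every node depends on its first bit, and the tests of `T i` separate the nodes of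
length `i`; hence the hypothesis never has more nodes than `D`, up to a dummy root, and equals `D`
as soon as it represents `f`.

Every update adds a node or completes a dummy root. The number of nodes, plus one if the root is not
a dummy, is at least `4` initially and never exceeds `n + 1`, so there are at most `n - 3` updates,
hence at most `n - 2` equivalence queries after the first two. An update needs two binary searches. All other membership queries are
asked by classifications. A tree `T i` asks at most two queries per node of length `i` and
classifies a given edge at most once, so that the queries for a new edge are at most twice the
number of nodes; the queries for redirected edges are at most two for each edge and new node. The
potential `2 * (number of edges) * (number of nodes)` therefore pays for all of them.
-/

namespace OMTBDD

/-! ### Programs, strings and classification trees -/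

section Programs

lemma Prog.run_bind {L α β : Type} (MQ : Str → L) (EQ : ℕ → Diagram Str L → Option Str)
    (p : Prog L α) (g : α → Prog L β) (nE nM : ℕ) :
    (p >>= g).run MQ EQ nE nM =
      (g (p.run MQ EQ nE nM).1).run MQ EQ (p.run MQ EQ nE nM).2.1 (p.run MQ EQ nE nM).2.2 := by
  change (p.bind g).run MQ EQ nE nM = _
  induction p generalizing nE nM with
  | ret x => rfl
  | mem a _ ih => exact ih _ _ _
  | equ H _ ih => exact ih _ _ _

variable {L α β : Type} {f : Str → L}

/-- The program `p` asks no equivalence queries and `c` membership queries, and returns `x`, if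
membership queries are answered by `f`. -/
def Yields (f : Str → L) (p : Prog L α) (x : α) (c : ℕ) : Prop :=
  ∀ (EQ : ℕ → Diagram Str L → Option Str) (nE nM : ℕ), p.run f EQ nE nM = (x, nE, nM + c)

namespace Yields

lemma pure (x : α) : Yields f (pure x : Prog L α) x 0 := fun _ _ _ => rfl

lemma ask (a : Str) : Yields f (ask a) (f a) 1 := fun _ _ _ => rfl

lemma bind {p : Prog L α} {g : α → Prog L β} {x : α} {y : β} {c d : ℕ}
    (hp : Yields f p x c) (hg : Yields f (g x) y d) : Yields f (p >>= g) y (c + d) := by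
  intro EQ nE nM
  rw [Prog.run_bind, hp, hg, Nat.add_assoc]

lemma bind_pure {p : Prog L α} {x : α} {c : ℕ} (hp : Yields f p x c) (g : α → β) :
    Yields f (p >>= fun x => Pure.pure (g x)) (g x) c :=
  Yields.bind (g := fun x => Pure.pure (g x)) hp (Yields.pure _)

lemma bsearch [DecidableEq L] {phi : ℕ → Prog L L} {g : ℕ → L} {c : L}
    (hphi : ∀ i, Yields f (phi i) (g i) 1) (fuel lo hi k : ℕ) (hlt : lo < hi)
    (hfuel : hi ≤ lo + fuel) (hk : hi ≤ lo + 2 ^ k) (hlo : g lo = c) (hhi : g hi ≠ c) :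
    ∃ i q, lo < i ∧ i ≤ hi ∧ g (i - 1) = c ∧ g i ≠ c ∧ q ≤ k ∧
      Yields f (OMTBDD.bsearch phi c fuel lo hi (g hi)) (i, g i) q := by
  induction fuel generalizing lo hi k with
  | zero => omega
  | succ fuel ih =>
    unfold OMTBDD.bsearch
    split_ifs with h
    · obtain rfl : hi = lo + 1 := by omega
      exact ⟨lo + 1, 0, hlt, le_rfl, hlo, hhi, k.zero_le, Yields.pure _⟩
    · obtain _ | k := k
      · exact absurd hk h
      rw [pow_succ] at hk
      by_cases hmid : g ((lo + hi) / 2) = c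
      · obtain ⟨i, q, hlo_i, hi_hi, hpred, hne, hq, hyields⟩ :=
          ih ((lo + hi) / 2) hi k (by omega) (by omega) (by omega) hmid hhi
        refine ⟨i, 1 + q, by omega, hi_hi, hpred, hne, by omega, (hphi _).bind ?_⟩
        rwa [if_pos hmid]
      · obtain ⟨i, q, hlo_i, hi_mid, hpred, hne, hq, hyields⟩ :=
          ih lo ((lo + hi) / 2) k (by omega) (by omega) (by omega) hlo hmid
        refine ⟨i, 1 + q, hlo_i, by omega, hpred, hne, by omega, (hphi _).bind ?_⟩
        rwa [if_neg hmid]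

end Yields

end Programs

section Strings

@[simp] lemma length_flip (a : Str) : (flip a).length = a.length := by
  cases a <;> simp [flip]

/-- The prefix `a` is essential for the function `f` of `m` bits if `f` depends, after `a`, on the
bit that follows `a`. Internal nodes of the hypothesis other than a dummy root are essential. -/
def Essential {L : Type} (f : Str → L) (m : ℕ) (a : Str) : Prop :=
  ∃ r : Str, r ≠ [] ∧ a.length + r.length = m ∧ f (a ++ r) ≠ f (a ++ flip r)

end Strings

namespace CTree

section TestsOfLength

variable {L : Type} {k : ℕ} {T : CTree L} {last : Str}

/-- All tests in the tree use strings of length `k`, and so does the last twin test above every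
single-test node and every leaf that carries a node id; `last` is the label of the last twin test
above the whole tree. -/
def TestsOfLength (k : ℕ) : CTree L → (last : Str) → Prop
  | leaf none, _ => True
  | leaf (some _), last => last.length = k
  | single r dom child, last =>
    r.length = k ∧ last.length = k ∧ ∀ l ∈ dom, (child l).TestsOfLength k last
  | twin r _ _ hit miss, _ => r.length = k ∧ hit.TestsOfLength k r ∧ miss.TestsOfLength k r

lemma TestsOfLength.subst {T' : CTree L} {v : Option Str} (h : T.TestsOfLength k last)
    (h' : ∀ last : Str, (v ≠ none → last.length = k) → T'.TestsOfLength k last) :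
    (T.subst v T').TestsOfLength k last := by
  induction T generalizing last with
  | leaf w =>
    by_cases hw : w = v
    · subst hw
      simp only [CTree.subst, if_true]
      refine h' _ fun hw => ?_
      cases w with
      | none => exact absurd rfl hw
      | some u => exact h
    · simpa [CTree.subst, hw] using h
  | single r dom child ih => exact ⟨h.1, h.2.1, fun l hl => ih l (h.2.2 l hl)⟩
  | twin r x y hit miss ihHit ihMiss => exact ⟨h.1, ihHit h.2.1, ihMiss h.2.2⟩

lemma TestsOfLength.length_lastTwin {p t : Str} (h : T.TestsOfLength k last)
    (ht : T.lastTwin p last = some t) : t.length = k := by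
  induction T generalizing last with
  | leaf w =>
    obtain ⟨rfl, rfl⟩ : w = some p ∧ last = t := by simpa [lastTwin] using ht
    exact h
  | single r dom child ih =>
    obtain ⟨l, hl, hl'⟩ := List.exists_of_findSome?_eq_some ht
    exact ih l (h.2.2 l hl) hl'
  | twin r x y hit miss ihHit ihMiss =>
    rcases Option.or_eq_some_iff.1 ht with hr | ⟨-, hr⟩
    · exact ihHit h.2.1 hr
    · exact ihMiss h.2.2 hr

end TestsOfLength

section Classify

variable {L : Type} [DecidableEq L] (f : Str → L) (a : Str)

/-- The label of the leaf that `a` reaches if `D(a) = f a`, or `none` if `a` gets stuck. Since the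
leaf label `μ` is itself encoded as `none`, the value is `some none` if `a` reaches `μ`. -/
def label? : CTree L → Option (Option Str)
  | leaf v => some v
  | single r dom child => if f (a ++ r) ∈ dom then (child (f (a ++ r))).label? else none
  | twin r x y hit miss =>
    if f (a ++ r) = x ∧ f (a ++ flip r) = y then hit.label? else miss.label?

/-- The number of membership queries asked for the classification of `a`. -/
def cost : CTree L → ℕ
  | leaf _ => 0
  | single r dom child => 1 + if f (a ++ r) ∈ dom then (child (f (a ++ r))).cost else 0
  | twin r x y hit miss =>
    2 + if f (a ++ r) = x ∧ f (a ++ flip r) = y then hit.cost else miss.cost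

/-- The tree after adding a leaf labelled `a` where `a` gets stuck (and the tree itself if `a`
does not get stuck). -/
def grow : CTree L → CTree L
  | leaf v => leaf v
  | single r dom child =>
    if f (a ++ r) ∈ dom then
      single r dom (Function.update child (f (a ++ r)) (child (f (a ++ r))).grow)
    else single r (f (a ++ r) :: dom) (Function.update child (f (a ++ r)) (leaf (some a)))
  | twin r x y hit miss =>
    if f (a ++ r) = x ∧ f (a ++ flip r) = y then twin r x y hit.grow miss
    else twin r x y hit miss.grow

/-- The value observed at the single-test node at which `a` gets stuck (irrelevant if `a` does
not get stuck). -/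
def stuckValue : CTree L → L
  | leaf _ => f a
  | single r dom child =>
    if f (a ++ r) ∈ dom then (child (f (a ++ r))).stuckValue else f (a ++ r)
  | twin r x y hit miss =>
    if f (a ++ r) = x ∧ f (a ++ flip r) = y then hit.stuckValue else miss.stuckValue

/-- The result of the classification of `a`. -/
def result (T : CTree L) : CResult L :=
  match T.label? f a with
  | some v => .label v
  | none => .stuck (T.stuckValue f a) (T.grow f a)

variable {f a}

lemma result_of_label? {T : CTree L} {v : Option Str} (h : T.label? f a = some v) :
    T.result f a = .label v := by
  simp [result, h]

lemma result_of_stuck {T : CTree L} (h : T.label? f a = none) :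
    T.result f a = .stuck (T.stuckValue f a) (T.grow f a) := by
  simp [result, h]

variable (f a)

lemma result_single (r : Str) (dom : List L) (child : L → CTree L) :
    (single r dom child).result f a =
      if f (a ++ r) ∈ dom then
        ((child (f (a ++ r))).result f a).mapTree fun T =>
          single r dom (Function.update child (f (a ++ r)) T)
      else .stuck (f (a ++ r))
        (single r (f (a ++ r) :: dom) (Function.update child (f (a ++ r)) (leaf (some a)))) := by
  simp only [result, label?, stuckValue, grow]
  split_ifs
  · cases (child (f (a ++ r))).label? f a <;> rfl
  · rfl

lemma result_twin (r : Str) (x y : L) (hit miss : CTree L) :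
    (twin r x y hit miss).result f a =
      if f (a ++ r) = x ∧ f (a ++ flip r) = y then
        (hit.result f a).mapTree fun T => twin r x y T miss
      else (miss.result f a).mapTree fun T => twin r x y hit T := by
  simp only [result, label?, stuckValue, grow]
  split_ifs
  · cases hit.label? f a <;> rfl
  · cases miss.label? f a <;> rfl

lemma yields_classify (T : CTree L) : Yields f (T.classify a) (T.result f a) (T.cost f a) := by
  induction T with
  | leaf v => exact Yields.pure _
  | single r dom child ih =>
    rw [result_single]
    refine (Yields.ask (a ++ r)).bind ?_
    split_ifs
    · exact (ih _).bind_pure _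
    · exact Yields.pure _
  | twin r x y hit miss ihHit ihMiss =>
    rw [result_twin, cost, show 2 = 1 + 1 from rfl, add_assoc]
    refine (Yields.ask (a ++ r)).bind ((Yields.ask (a ++ flip r)).bind ?_)
    split_ifs
    · exact ihHit.bind_pure _
    · exact ihMiss.bind_pure _

lemma label?_subst (T : CTree L) (v : Option Str) (T' : CTree L) :
    (T.subst v T').label? f a =
      if T.label? f a = some v then T'.label? f a else T.label? f a := by
  induction T with
  | leaf w =>
    by_cases h : w = v <;> simp [subst, label?, h]
  | single r dom child ih =>
    by_cases h : f (a ++ r) ∈ dom <;> simp [subst, label?, h, ih]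
  | twin r x y hit miss ihHit ihMiss =>
    by_cases h : f (a ++ r) = x ∧ f (a ++ flip r) = y <;>
      simp [subst, label?, h, ihHit, ihMiss]

lemma cost_subst (T : CTree L) (v : Option Str) (T' : CTree L) :
    (T.subst v T').cost f a =
      T.cost f a + if T.label? f a = some v then T'.cost f a else 0 := by
  induction T with
  | leaf w =>
    by_cases h : w = v <;> simp [subst, label?, cost, h]
  | single r dom child ih =>
    by_cases h : f (a ++ r) ∈ dom <;> simp [subst, label?, cost, h, ih, add_assoc]
  | twin r x y hit miss ihHit ihMiss =>
    by_cases h : f (a ++ r) = x ∧ f (a ++ flip r) = y <;>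
      simp [subst, label?, cost, h, ihHit, ihMiss, add_assoc]

variable {f a}

lemma label?_grow_self {T : CTree L} (h : T.label? f a = none) :
    (T.grow f a).label? f a = some (some a) := by
  induction T with
  | leaf w => simp [label?] at h
  | single r dom child ih =>
    by_cases hd : f (a ++ r) ∈ dom
    · rw [label?, if_pos hd] at h
      simp [grow, label?, hd, ih _ h]
    · simp [grow, label?, hd]
  | twin r x y hit miss ihHit ihMiss =>
    by_cases hd : f (a ++ r) = x ∧ f (a ++ flip r) = y
    · rw [label?, if_pos hd] at h
      rw [grow, if_pos hd, label?, if_pos hd, ihHit h]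
    · rw [label?, if_neg hd] at h
      rw [grow, if_neg hd, label?, if_neg hd, ihMiss h]

variable (f a)

lemma label?_grow (b : Str) (T : CTree L) :
    (T.grow f a).label? f b = T.label? f b ∨
      T.label? f b = none ∧ (T.grow f a).label? f b = some (some a) := by
  induction T with
  | leaf w => exact Or.inl rfl
  | single r dom child ih =>
    by_cases hd : f (a ++ r) ∈ dom
    · simp only [grow, if_pos hd, label?]
      by_cases hb : f (b ++ r) = f (a ++ r)
      · simpa [hb, hd] using ih (f (a ++ r))
      · simp [hb]
    · simp only [grow, if_neg hd, label?]
      by_cases hb : f (b ++ r) = f (a ++ r)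
      · simp [hb, hd, label?]
      · simp [hb]
  | twin r x y hit miss ihHit ihMiss =>
    by_cases hd : f (a ++ r) = x ∧ f (a ++ flip r) = y
    · simp only [grow, if_pos hd, label?]
      split_ifs
      · exact ihHit
      · exact Or.inl rfl
    · simp only [grow, if_neg hd, label?]
      split_ifs
      · exact Or.inl rfl
      · exact ihMiss

/-- The tree `T'` classifies all strings as `T` does, except that `a` and maybe other strings at
which `T` is stuck are classified as `a`. -/
structure IsGrowth (T T' : CTree L) : Prop where
  label?_self : T'.label? f a = some (some a)
  label?_eq : ∀ b, T'.label? f b = T.label? f b ∨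
    T.label? f b = none ∧ T'.label? f b = some (some a)

variable {f a} in
lemma isGrowth_grow {T : CTree L} (h : T.label? f a = none) : IsGrowth f a T (T.grow f a) :=
  ⟨label?_grow_self h, fun b => label?_grow f a b T⟩

variable {f a} in
lemma IsGrowth.label?_of_some {T T' : CTree L} (h : IsGrowth f a T T') {b : Str} {v : Option Str}
    (hb : T.label? f b = some v) : T'.label? f b = some v := by
  rcases h.label?_eq b with heq | ⟨hnone, -⟩
  · rw [heq, hb]
  · simp [hb] at hnone

variable {f a} in
lemma IsGrowth.subst {T₁ T₂ : CTree L} (h : IsGrowth f a T₁ T₂) {T : CTree L} {v : Option Str}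
    (ha : T.label? f a = some v) : IsGrowth f a (T.subst v T₁) (T.subst v T₂) where
  label?_self := by rw [label?_subst, if_pos ha, h.label?_self]
  label?_eq b := by
    simp only [label?_subst]
    split_ifs
    · exact h.label?_eq b
    · exact Or.inl rfl

lemma cost_grow (b : Str) (T : CTree L) : (T.grow f a).cost f b = T.cost f b := by
  induction T with
  | leaf w => rfl
  | single r dom child ih =>
    by_cases hd : f (a ++ r) ∈ dom
    · simp only [grow, if_pos hd, cost]
      by_cases hb : f (b ++ r) = f (a ++ r)
      · simp [hb, hd, ih]
      · simp [hb]
    · simp only [grow, if_neg hd, cost]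
      by_cases hb : f (b ++ r) = f (a ++ r)
      · simp [hb, hd, cost]
      · simp [hb]
  | twin r x y hit miss ihHit ihMiss =>
    by_cases hd : f (a ++ r) = x ∧ f (a ++ flip r) = y
    · simp only [grow, if_pos hd, cost, ihHit]
    · simp only [grow, if_neg hd, cost, ihMiss]

variable {f a}

lemma TestsOfLength.grow {k : ℕ} {T : CTree L} {last : Str} (h : T.TestsOfLength k last)
    (f : Str → L) (a : Str) : (T.grow f a).TestsOfLength k last := by
  induction T generalizing last with
  | leaf w => exact h
  | single r dom child ih =>
    obtain ⟨hr, hlast, hchild⟩ := h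
    by_cases hd : f (a ++ r) ∈ dom
    · rw [CTree.grow, if_pos hd]
      refine ⟨hr, hlast, fun l hl => ?_⟩
      rcases eq_or_ne l (f (a ++ r)) with rfl | hne
      · simpa using ih _ (hchild _ hl)
      · simpa [Function.update_of_ne hne] using hchild l hl
    · rw [CTree.grow, if_neg hd]
      refine ⟨hr, hlast, fun l hl => ?_⟩
      rcases eq_or_ne l (f (a ++ r)) with rfl | hne
      · simpa [TestsOfLength] using hlast
      · simpa [Function.update_of_ne hne] using hchild l ((List.mem_cons.1 hl).resolve_left hne)
  | twin r x y hit miss ihHit ihMiss =>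
    rw [CTree.grow]
    split_ifs
    · exact ⟨h.1, ihHit h.2.1, h.2.2⟩
    · exact ⟨h.1, h.2.1, ihMiss h.2.2⟩

lemma isSome_lastTwin {T : CTree L} {p : Str} (last : Str)
    (h : T.label? f a = some (some p)) : (T.lastTwin p last).isSome := by
  induction T generalizing last with
  | leaf w =>
    simp only [label?, Option.some.injEq] at h
    simp [lastTwin, h]
  | single r dom child ih =>
    by_cases hd : f (a ++ r) ∈ dom
    · rw [label?, if_pos hd] at h
      exact List.findSome?_isSome_iff.2 ⟨_, hd, ih _ _ h⟩
    · simp [label?, hd] at h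
  | twin r x y hit miss ihHit ihMiss =>
    rw [lastTwin, Option.isSome_or, Bool.or_eq_true]
    rw [label?] at h
    split_ifs at h
    · exact Or.inl (ihHit _ h)
    · exact Or.inr (ihMiss _ h)

lemma TestsOfLength.label?_congr {k : ℕ} {T : CTree L} {last : Str}
    (h : T.TestsOfLength k last) {b : Str}
    (hab : ∀ s : Str, s.length = k → f (a ++ s) = f (b ++ s)) :
    T.label? f a = T.label? f b := by
  induction T generalizing last with
  | leaf w => rfl
  | single r dom child ih =>
    simp only [label?, hab r h.1]
    split_ifs with hd
    · exact ih _ (h.2.2 _ hd)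
    · rfl
  | twin r x y hit miss ihHit ihMiss =>
    simp only [label?, hab r h.1, hab (flip r) (by rw [length_flip, h.1])]
    rw [ihHit h.2.1, ihMiss h.2.2]

end Classify

section IsTop

variable {L : Type} {f : Str → L} {T : CTree L}

/-- The form of the tree `T m` that classifies strings of full length: a single test for the value
of the function, every leaf being labelled by a sink with that value. -/
def IsTop (f : Str → L) (T : CTree L) : Prop :=
  ∃ dom child, T = single [] dom child ∧ ∀ l ∈ dom, ∃ u, child l = leaf (some u) ∧ f u = l

variable [DecidableEq L]

lemma IsTop.eq_of_label? (h : T.IsTop f) {a : Str} {v : Option Str}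
    (hv : T.label? f a = some v) : ∃ u, v = some u ∧ f u = f a := by
  obtain ⟨dom, child, rfl, hc⟩ := h
  simp only [label?, List.append_nil] at hv
  split_ifs at hv with hd
  obtain ⟨u, hu, hfu⟩ := hc _ hd
  rw [hu] at hv
  exact ⟨u, by simpa [label?] using hv.symm, hfu⟩

lemma IsTop.stuckValue_eq (h : T.IsTop f) (a : Str) : T.stuckValue f a = f a := by
  obtain ⟨dom, child, rfl, hc⟩ := h
  simp only [stuckValue, List.append_nil]
  split_ifs with hd
  · obtain ⟨u, hu, -⟩ := hc _ hd
    rw [hu, stuckValue]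
  · rfl

lemma IsTop.grow (h : T.IsTop f) (a : Str) : (T.grow f a).IsTop f := by
  obtain ⟨dom, child, rfl, hc⟩ := h
  simp only [CTree.grow, List.append_nil]
  split_ifs with hd
  · refine ⟨_, _, rfl, fun l hl => ?_⟩
    rcases eq_or_ne l (f a) with rfl | hne
    · obtain ⟨u, hu, hfu⟩ := hc _ hd
      exact ⟨u, by simp [hu, CTree.grow], hfu⟩
    · simpa [Function.update_of_ne hne] using hc l hl
  · refine ⟨_, _, rfl, fun l hl => ?_⟩
    rcases eq_or_ne l (f a) with rfl | hne
    · exact ⟨a, by simp, rfl⟩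
    · simpa [Function.update_of_ne hne] using hc l ((List.mem_cons.1 hl).resolve_left hne)

end IsTop

section IsSingleTest

variable {L : Type} {r : Str} {T : CTree L}

/-- The tree consists of a single test for `r`, and every leaf is labelled by a node. NodeSplit
replaces a leaf by a tree of this form. -/
def IsSingleTest (r : Str) (T : CTree L) : Prop :=
  ∃ dom child, T = single r dom child ∧ ∀ l ∈ dom, ∃ u, child l = leaf (some u)

namespace IsSingleTest

lemma testsOfLength (h : T.IsSingleTest r) {last : Str} (hlast : last.length = r.length) :
    T.TestsOfLength r.length last := by
  obtain ⟨dom, child, rfl, hc⟩ := h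
  refine ⟨rfl, hlast, fun l hl => ?_⟩
  obtain ⟨u, hu⟩ := hc l hl
  rw [hu]
  exact hlast

lemma testsOfLength_subst {k : ℕ} {T' : CTree L} (h : T.IsSingleTest r) (hr : r.length = k)
    (hT' : T'.TestsOfLength k []) (v : Str) : (T'.subst (some v) T).TestsOfLength k [] :=
  hT'.subst fun _ hlast => hr ▸ h.testsOfLength ((hlast (Option.some_ne_none v)).trans hr.symm)

variable [DecidableEq L] (h : T.IsSingleTest r) (f : Str → L) (a : Str)

include h

lemma label?_ne : T.label? f a ≠ some none := by
  obtain ⟨dom, child, rfl, hc⟩ := h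
  rw [label?]
  split_ifs with hd
  · obtain ⟨u, hu⟩ := hc _ hd
    simp [hu, label?]
  · exact Option.some_ne_none _ ∘ Eq.symm

lemma cost_le_one : T.cost f a ≤ 1 := by
  obtain ⟨dom, child, rfl, hc⟩ := h
  rw [cost]
  split_ifs with hd
  · obtain ⟨u, hu⟩ := hc _ hd
    simp [hu, cost]
  · rfl

lemma grow : (T.grow f a).IsSingleTest r := by
  obtain ⟨dom, child, rfl, hc⟩ := h
  simp only [CTree.grow]
  split_ifs with hd
  · refine ⟨_, _, rfl, fun l hl => ?_⟩
    rcases eq_or_ne l (f (a ++ r)) with rfl | hne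
    · obtain ⟨u, hu⟩ := hc _ hd
      exact ⟨u, by simp [hu, CTree.grow]⟩
    · simpa [Function.update_of_ne hne] using hc l hl
  · refine ⟨_, _, rfl, fun l hl => ?_⟩
    rcases eq_or_ne l (f (a ++ r)) with rfl | hne
    · exact ⟨a, by simp⟩
    · simpa [Function.update_of_ne hne] using hc l ((List.mem_cons.1 hl).resolve_left hne)

end IsSingleTest

end IsSingleTest

end CTree

/-! ### Reduced diagrams -/

namespace Diagram

variable {V W L : Type*}

/-- The number of variables that precede the label of the node `v`; `m` if `v` is a sink. -/
def level (D : Diagram V L) (m : ℕ) (v : V) : ℕ :=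
  match D.cell v with
  | .sink _ => m
  | .branch i _ _ => i

section Cells

variable {D : Diagram V L} {v lo hi : V} {i : ℕ} {l : L}

lemma level_of_sink {m : ℕ} (h : D.cell v = .sink l) : D.level m v = m := by simp [level, h]

lemma level_of_branch {m : ℕ} (h : D.cell v = .branch i lo hi) : D.level m v = i := by
  simp [level, h]

lemma evalFrom_of_sink (h : D.cell v = .sink l) (a : Str) (n : ℕ) :
    D.evalFrom a n v = some l := by
  cases n <;> simp [evalFrom, h]

lemma evalFrom_succ_of_branch (h : D.cell v = .branch i lo hi) (a : Str) (n : ℕ) :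
    D.evalFrom a (n + 1) v = D.evalFrom a n (if a.getD i false then hi else lo) := by
  simp [evalFrom, h]

lemma child_lo (h : D.cell v = .branch i lo hi) : D.Child v lo := ⟨i, lo, hi, h, .inl rfl⟩

lemma child_hi (h : D.cell v = .branch i lo hi) : D.Child v hi := ⟨i, lo, hi, h, .inr rfl⟩

lemma child_ite (h : D.cell v = .branch i lo hi) (b : Bool) :
    D.Child v (if b then hi else lo) := by
  cases b
  · exact child_lo h
  · exact child_hi h

end Cells

namespace IsOrdered

variable {D : Diagram V L} {m : ℕ} (hD : D.IsOrdered m)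

include hD

lemma level_le {v : V} (hv : v ∈ D.nodes) : D.level m v ≤ m := by
  cases h : D.cell v with
  | sink l => rw [level_of_sink h]
  | branch i lo hi => rw [level_of_branch h]; exact (hD.var_lt v hv i lo hi h).le

lemma level_lt_of_child {v w : V} (hv : v ∈ D.nodes) (h : D.Child v w) :
    D.level m v < D.level m w := by
  obtain ⟨i, lo, hi, hc, hw⟩ := h
  rw [level_of_branch hc]
  cases hcw : D.cell w with
  | sink l => rw [level_of_sink hcw]; exact hD.var_lt v hv i lo hi hc
  | branch j lo' hi' =>
    rw [level_of_branch hcw]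
    exact hD.ordered v hv i lo hi hc w ⟨i, lo, hi, hc, hw⟩ j lo' hi' hcw

lemma induction {P : (v : V) → v ∈ D.nodes → Prop}
    (step : ∀ (v : V) (hv : v ∈ D.nodes),
      (∀ (w : V) (hw : w ∈ D.nodes), D.level m v < D.level m w → P w hw) → P v hv) :
    ∀ (v : V) (hv : v ∈ D.nodes), P v hv := by
  suffices ∀ k, ∀ (v : V) (hv : v ∈ D.nodes), m - D.level m v = k → P v hv from
    fun v hv => this _ v hv rfl
  intro k
  induction k using Nat.strong_induction_on with
  | _ k ih =>
    intro v hv hk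
    refine step v hv fun w hw hlt => ih _ ?_ w hw rfl
    have := hD.level_le hw
    omega

lemma evalFrom_fuel {v : V} (hv : v ∈ D.nodes) (a : Str) {n n' : ℕ}
    (hn : m ≤ n + D.level m v) (hn' : m ≤ n' + D.level m v) :
    D.evalFrom a n v = D.evalFrom a n' v := by
  induction v, hv using hD.induction generalizing n n' with
  | step v hv ih =>
    cases h : D.cell v with
    | sink l => rw [evalFrom_of_sink h, evalFrom_of_sink h]
    | branch i lo hi =>
      have hi_lt := hD.var_lt v hv i lo hi h
      have hc := child_ite h (a.getD i false)
      have hlt := hD.level_lt_of_child hv hc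
      rw [level_of_branch h] at hn hn'
      obtain ⟨k, rfl⟩ : ∃ k, n = k + 1 := ⟨n - 1, by omega⟩
      obtain ⟨k', rfl⟩ : ∃ k, n' = k + 1 := ⟨n' - 1, by omega⟩
      rw [evalFrom_succ_of_branch h, evalFrom_succ_of_branch h]
      rw [level_of_branch h] at hlt
      exact ih _ (hD.child_mem v hv _ hc) (by rwa [level_of_branch h]) (by omega) (by omega)

lemma evalFrom_of_branch {v lo hi : V} {i : ℕ} (hv : v ∈ D.nodes)
    (h : D.cell v = .branch i lo hi) (a : Str) :
    D.evalFrom a m v = D.evalFrom a m (if a.getD i false then hi else lo) := by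
  rw [hD.evalFrom_fuel hv a (n' := m + 1) (by omega) (by omega), evalFrom_succ_of_branch h]

lemma evalFrom_congr {v : V} (hv : v ∈ D.nodes) {a b : Str}
    (hab : ∀ j, D.level m v ≤ j → a.getD j false = b.getD j false) :
    D.evalFrom a m v = D.evalFrom b m v := by
  induction v, hv using hD.induction with
  | step v hv ih =>
    cases h : D.cell v with
    | sink l => rw [evalFrom_of_sink h, evalFrom_of_sink h]
    | branch i lo hi =>
      have hc := child_ite h (a.getD i false)
      have hlt := hD.level_lt_of_child hv hc
      rw [hD.evalFrom_of_branch hv h, hD.evalFrom_of_branch hv h,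
        ← hab i (level_of_branch h).le]
      exact ih _ (hD.child_mem v hv _ hc) hlt fun j hj => hab j (by omega)

lemma evalFrom_set_of_branch {v lo hi : V} {i : ℕ} (hv : v ∈ D.nodes)
    (h : D.cell v = .branch i lo hi) {a : Str} (ha : a.length = m) (b : Bool) :
    D.evalFrom (a.set i b) m v = D.evalFrom a m (if b then hi else lo) := by
  have hi_lt := hD.var_lt v hv i lo hi h
  have hbit : (a.set i b).getD i false = b := by simp [List.getD, ha, hi_lt]
  have hc := child_ite h b
  have hlt := hD.level_lt_of_child hv hc
  rw [level_of_branch h] at hlt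
  rw [hD.evalFrom_of_branch hv h, hbit]
  refine hD.evalFrom_congr (hD.child_mem v hv _ hc) fun j hj => ?_
  simp [List.getD, List.getElem?_set_ne (show i ≠ j by omega)]

lemma evalFrom_set_of_lt_level {v : V} {i : ℕ} (hv : v ∈ D.nodes) (hi : i < D.level m v)
    (a : Str) (b : Bool) : D.evalFrom (a.set i b) m v = D.evalFrom a m v := by
  refine hD.evalFrom_congr hv fun j hj => ?_
  simp [List.getD, List.getElem?_set_ne (show i ≠ j by omega)]

lemma exists_evalFrom_append_eq {v : V} (hv : v ∈ D.nodes) (p : Str) (hp : p.length ≤ m) :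
    ∃ w ∈ D.nodes, p.length ≤ D.level m w ∧
      ∀ a : Str, D.evalFrom (p ++ a) m v = D.evalFrom (p ++ a) m w := by
  induction v, hv using hD.induction with
  | step v hv ih =>
    by_cases hl : p.length ≤ D.level m v
    · exact ⟨v, hv, hl, fun a => rfl⟩
    · cases h : D.cell v with
      | sink l => rw [level_of_sink h] at hl; exact absurd hp hl
      | branch i lo hi =>
        have hc := child_ite h (p.getD i false)
        obtain ⟨w, hw, hlw, heval⟩ :=
          ih _ (hD.child_mem v hv _ hc) (hD.level_lt_of_child hv hc)
        refine ⟨w, hw, hlw, fun a => ?_⟩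
        rw [level_of_branch h] at hl
        rw [← heval, hD.evalFrom_of_branch hv h, List.getD_append _ _ _ _ (by omega)]

lemma mem_nodes_of_reachable {v : V} (h : Relation.ReflTransGen D.Child D.root v) :
    v ∈ D.nodes := by
  induction h with
  | refl => exact hD.root_mem
  | tail _ hc ih => exact hD.child_mem _ ih _ hc

lemma exists_accessString {v : V} (h : Relation.ReflTransGen D.Child D.root v) :
    ∃ p : Str, p.length = D.level m v ∧
      ∀ a : Str, D.evalFrom (p ++ a) m D.root = D.evalFrom (p ++ a) m v := by
  induction h with
  | refl => exact ⟨List.replicate (D.level m D.root) false, by simp, fun a => rfl⟩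
  | @tail u w hu hc ih =>
    have hu := hD.mem_nodes_of_reachable hu
    obtain ⟨p, hp, heval⟩ := ih
    have hlt := hD.level_lt_of_child hu hc
    obtain ⟨i, lo, hi, hcu, hw⟩ := hc
    obtain ⟨b, rfl⟩ : ∃ b : Bool, w = if b then hi else lo := by
      rcases hw with rfl | rfl
      · exact ⟨false, rfl⟩
      · exact ⟨true, rfl⟩
    rw [level_of_branch hcu] at hp hlt
    set padding := List.replicate (D.level m (if b then hi else lo) - i - 1) false with hpad
    refine ⟨p ++ b :: padding, by simp [hp, hpad]; omega, fun a => ?_⟩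
    have hbit : (p ++ b :: (padding ++ a)).getD i false = b := by simp [List.getD, ← hp]
    rw [List.append_assoc, heval, List.cons_append, hD.evalFrom_of_branch hu hcu, hbit]

end IsOrdered

/-- The node `v` of `D` and the node `w` of `E` represent the same function of `m` bits. -/
def Equivalent (D : Diagram V L) (E : Diagram W L) (m : ℕ) (v : V) (w : W) : Prop :=
  ∀ a : Str, a.length = m → D.evalFrom a m v = E.evalFrom a m w

/-- Distinct nodes of `D` represent distinct functions. -/
def Separated (D : Diagram V L) (m : ℕ) : Prop :=
  ∀ v ∈ D.nodes, ∀ w ∈ D.nodes, D.Equivalent D m v w → v = w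

/-- The node `v` is a sink or depends on its variable: its successors represent distinct
functions. -/
def DependsOnVar (D : Diagram V L) (m : ℕ) (v : V) : Prop :=
  ∀ i lo hi, D.cell v = .branch i lo hi → ¬ D.Equivalent D m lo hi

section Equivalent

variable {D : Diagram V L} {E : Diagram W L} {m : ℕ} {v : V} {w : W}

lemma Equivalent.symm (h : D.Equivalent E m v w) : E.Equivalent D m w v :=
  fun a ha => (h a ha).symm

lemma Equivalent.trans {X : Type*} {F : Diagram X L} {x : X} (h : D.Equivalent E m v w)
    (h' : E.Equivalent F m w x) : D.Equivalent F m v x :=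
  fun a ha => (h a ha).trans (h' a ha)

lemma Equivalent.level_le (hD : D.IsOrdered m) (hE : E.IsOrdered m) (hv : v ∈ D.nodes)
    (hw : w ∈ E.nodes) (hdep : D.DependsOnVar m v) (h : D.Equivalent E m v w) :
    E.level m w ≤ D.level m v := by
  by_contra! hlt
  cases hcell : D.cell v with
  | sink l =>
    rw [level_of_sink hcell] at hlt
    exact (hE.level_le hw).not_gt hlt
  | branch i lo hi =>
    rw [level_of_branch hcell] at hlt
    have hconst (b : Bool) (a : Str) (ha : a.length = m) :
        D.evalFrom a m (if b then hi else lo) = E.evalFrom a m w := by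
      rw [← hD.evalFrom_set_of_branch hv hcell ha b, h _ (by simpa using ha),
        hE.evalFrom_set_of_lt_level hw hlt]
    exact hdep i lo hi hcell fun a ha => (hconst false a ha).trans (hconst true a ha).symm

lemma Equivalent.child {i : ℕ} {lo hi : V} {lo' hi' : W} (hD : D.IsOrdered m)
    (hE : E.IsOrdered m) (hv : v ∈ D.nodes) (hw : w ∈ E.nodes)
    (hcv : D.cell v = .branch i lo hi) (hcw : E.cell w = .branch i lo' hi')
    (h : D.Equivalent E m v w) (b : Bool) :
    D.Equivalent E m (if b then hi else lo) (if b then hi' else lo') := by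
  intro a ha
  rw [← hD.evalFrom_set_of_branch hv hcv ha, ← hE.evalFrom_set_of_branch hw hcw ha,
    h _ (by simpa using ha)]

lemma Equivalent.cell_cases (hD : D.IsOrdered m) (hE : E.IsOrdered m) (hv : v ∈ D.nodes)
    (hw : w ∈ E.nodes) (hdv : D.DependsOnVar m v) (hdw : E.DependsOnVar m w)
    (h : D.Equivalent E m v w) :
    (∃ l, D.cell v = .sink l ∧ E.cell w = .sink l) ∨
      ∃ i lo hi lo' hi', D.cell v = .branch i lo hi ∧ E.cell w = .branch i lo' hi' ∧
        D.Equivalent E m lo lo' ∧ D.Equivalent E m hi hi' := by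
  have hlevel := le_antisymm (h.symm.level_le hE hD hw hv hdw) (h.level_le hD hE hv hw hdv)
  cases hcv : D.cell v with
  | sink l =>
    rw [level_of_sink hcv] at hlevel
    cases hcw : E.cell w with
    | sink l' =>
      have hl := h (List.replicate m false) (by simp)
      rw [evalFrom_of_sink hcv, evalFrom_of_sink hcw, Option.some.injEq] at hl
      exact .inl ⟨l, rfl, by rw [hl]⟩
    | branch j lo' hi' =>
      rw [level_of_branch hcw] at hlevel
      exact absurd hlevel (hE.var_lt w hw j lo' hi' hcw).ne'
  | branch i lo hi =>
    rw [level_of_branch hcv] at hlevel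
    cases hcw : E.cell w with
    | sink l' =>
      rw [level_of_sink hcw] at hlevel
      exact absurd hlevel (hD.var_lt v hv i lo hi hcv).ne
    | branch j lo' hi' =>
      rw [level_of_branch hcw] at hlevel
      subst hlevel
      exact .inr ⟨i, lo, hi, lo', hi', rfl, rfl, h.child hD hE hv hw hcv hcw false,
        h.child hD hE hv hw hcv hcw true⟩

end Equivalent

section Reduced

variable {D : Diagram V L} {m : ℕ}

lemma Separated.dependsOnVar (hS : D.Separated m) (hD : D.IsOrdered m) {v : V}
    (hv : v ∈ D.nodes) : D.DependsOnVar m v := by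
  intro i lo hi hcell heq
  have hlo := hD.child_mem v hv _ (child_lo hcell)
  have hlo_hi : lo = hi := hS lo hlo hi (hD.child_mem v hv _ (child_hi hcell)) heq
  have hv_lo : v = lo := hS v hv lo hlo fun a _ => by
    rw [hD.evalFrom_of_branch hv hcell, ← hlo_hi, ite_self]
  have hlt := hD.level_lt_of_child hv (child_lo hcell)
  exact hlt.ne (congrArg _ hv_lo)

lemma IsReduced.separated (hD : D.IsReduced m) : D.Separated m := by
  have hO := hD.toIsOrdered
  suffices ∀ k, ∀ v ∈ D.nodes, ∀ w ∈ D.nodes, m < k + D.level m v → m < k + D.level m w →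
      D.Equivalent D m v w → v = w from
    fun v hv w hw h => this (m + 1) v hv w hw (by omega) (by omega) h
  intro k
  induction k with
  | zero =>
    intro v hv w _ hlv
    have := hO.level_le hv
    omega
  | succ k ih =>
    have hchild {v c : V} (hv : v ∈ D.nodes) (hlv : m < k + 1 + D.level m v)
        (hc : D.Child v c) : c ∈ D.nodes ∧ m < k + D.level m c :=
      ⟨hO.child_mem v hv c hc, by have := hO.level_lt_of_child hv hc; omega⟩
    have hdep {v : V} (hv : v ∈ D.nodes) (hlv : m < k + 1 + D.level m v) :
        D.DependsOnVar m v := fun i lo hi hcell heq =>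
      have hlo := hchild hv hlv (child_lo hcell)
      have hhi := hchild hv hlv (child_hi hcell)
      hD.no_redundant v hv i lo hi hcell (ih lo hlo.1 hi hhi.1 hlo.2 hhi.2 heq)
    intro v hv w hw hlv hlw h
    refine hD.no_duplicate v hv w hw ?_
    rcases h.cell_cases hO hO hv hw (hdep hv hlv) (hdep hw hlw) with
      ⟨l, hcv, hcw⟩ | ⟨i, lo, hi, lo', hi', hcv, hcw, hlo, hhi⟩
    · rw [hcv, hcw]
    · have hmem := hchild hv hlv (child_lo hcv)
      have hmem' := hchild hw hlw (child_lo hcw)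
      have hmem_hi := hchild hv hlv (child_hi hcv)
      have hmem_hi' := hchild hw hlw (child_hi hcw)
      rw [hcv, hcw, ih lo hmem.1 lo' hmem'.1 hmem.2 hmem'.2 hlo,
        ih hi hmem_hi.1 hi' hmem_hi'.1 hmem_hi.2 hmem_hi'.2 hhi]

variable {H : Diagram W L}

lemma root_equivalent (heq : ∀ a : Str, a.length = m → H.eval a = D.eval a) :
    D.Equivalent H m D.root H.root := fun a ha => by
  have := heq a ha
  rw [eval, eval, ha] at this
  exact this.symm

lemma IsReduced.exists_equivalent (hD : D.IsReduced m) (hH : H.IsOrdered m)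
    (hroot : D.Equivalent H m D.root H.root) {v : V} (hv : v ∈ D.nodes) :
    ∃ w ∈ H.nodes, D.Equivalent H m v w := by
  have hO := hD.toIsOrdered
  obtain ⟨p, hp, hDp⟩ := hO.exists_accessString (hD.reachable v hv)
  obtain ⟨w, hw, hlw, hHp⟩ :=
    hH.exists_evalFrom_append_eq hH.root_mem p (hp ▸ hO.level_le hv)
  refine ⟨w, hw, fun a ha => ?_⟩
  have hlen : (p ++ a.drop p.length).length = m := by
    have := hO.level_le hv
    simp only [List.length_append, List.length_drop]
    omega
  have hagree (j : ℕ) (hj : p.length ≤ j) :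
      a.getD j false = (p ++ a.drop p.length).getD j false := by
    rw [List.getD_append_right _ _ _ _ hj]
    simp [List.getD, List.getElem?_drop, Nat.add_sub_cancel' hj]
  rw [hH.evalFrom_congr hw fun j hj => hagree j (hlw.trans hj), ← hHp, ← hroot _ hlen, hDp,
    ← hO.evalFrom_congr hv fun j hj => hagree j (hp ▸ hj)]

theorem IsReduced.iso (hD : D.IsReduced m) (hH : H.IsOrdered m)
    (heq : ∀ a : Str, a.length = m → H.eval a = D.eval a)
    (hcard : H.nodes.card ≤ D.nodes.card) : D.Iso H := by
  have hO := hD.toIsOrdered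
  have hroot := root_equivalent heq
  have : Nonempty W := ⟨H.root⟩
  have hex := fun v hv => hD.exists_equivalent hH hroot (v := v) hv
  choose! φ hφ hφeq using hex
  have hinj : Set.InjOn φ D.nodes := fun v hv w hw h =>
    hD.separated v hv w hw ((hφeq v hv).trans (h ▸ (hφeq w hw).symm))
  have hsurj : Set.SurjOn φ D.nodes H.nodes :=
    Finset.surjOn_of_injOn_of_card_le φ hφ hinj hcard
  have hSH : H.Separated m := by
    intro w hw w' hw' h
    obtain ⟨v, hv, rfl⟩ := hsurj hw
    obtain ⟨v', hv', rfl⟩ := hsurj hw'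
    rw [hD.separated v hv v' hv' (((hφeq v hv).trans h).trans (hφeq v' hv').symm)]
  have hφ_unique {v : V} {w : W} (hv : v ∈ D.nodes) (hw : w ∈ H.nodes)
      (h : D.Equivalent H m v w) : φ v = w :=
    hSH _ (hφ v hv) w hw ((hφeq v hv).symm.trans h)
  refine ⟨φ, ⟨hφ, hinj, hsurj⟩, hφ_unique hO.root_mem hH.root_mem hroot, fun v hv => ?_⟩
  rcases (hφeq v hv).cell_cases hO hH hv (hφ v hv) (hD.separated.dependsOnVar hO hv)
    (hSH.dependsOnVar hH (hφ v hv)) with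
    ⟨l, hcv, hcw⟩ | ⟨i, lo, hi, lo', hi', hcv, hcw, hlo, hhi⟩
  · rw [hcv, hcw, Cell.map]
  · rw [hcv, hcw, Cell.map,
      hφ_unique (hO.child_mem v hv _ (child_lo hcv))
        (hH.child_mem _ (hφ v hv) _ (child_lo hcw)) hlo,
      hφ_unique (hO.child_mem v hv _ (child_hi hcv))
        (hH.child_mem _ (hφ v hv) _ (child_hi hcw)) hhi]

end Reduced

section Residuals

variable {V : Type*} {L : Type} {D : Diagram V L} {m : ℕ} {f : Str → L}

/-- The node `w` is reached after the prefix `a` has been read. -/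
def ReachedBy (D : Diagram V L) (m : ℕ) (f : Str → L) (a : Str) (w : V) : Prop :=
  w ∈ D.nodes ∧ a.length ≤ D.level m w ∧
    ∀ s : Str, a.length + s.length = m → some (f (a ++ s)) = D.evalFrom (a ++ s) m w

lemma IsOrdered.exists_reachedBy (hD : D.IsOrdered m) (hf : CorrectMQ D m f) {a : Str}
    (ha : a.length ≤ m) : ∃ w, D.ReachedBy m f a w := by
  obtain ⟨w, hw, hlw, heval⟩ := hD.exists_evalFrom_append_eq hD.root_mem a ha
  refine ⟨w, hw, hlw, fun s hs => ?_⟩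
  have hlen : (a ++ s).length = m := by simpa using hs
  rw [← hf _ hlen, eval, hlen, heval]

lemma ReachedBy.level_eq_of_essential (hD : D.IsOrdered m) {a : Str} {w : V}
    (hw : D.ReachedBy m f a w) (ha : Essential f m a) : D.level m w = a.length := by
  obtain ⟨hmem, hlevel, hval⟩ := hw
  obtain ⟨r, hr, hlen, hne⟩ := ha
  by_contra hcon
  refine hne (Option.some_injective _ ?_)
  rw [hval r hlen, hval (flip r) (by simpa using hlen)]
  refine hD.evalFrom_congr hmem fun j hj => ?_
  rw [List.getD_append_right _ _ _ _ (by omega), List.getD_append_right _ _ _ _ (by omega)]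
  obtain ⟨k, hk⟩ : ∃ k, j - a.length = k + 1 := ⟨j - a.length - 1, by omega⟩
  rw [hk]
  cases r with
  | nil => exact absurd rfl hr
  | cons b r => simp [flip]

lemma ReachedBy.congr (hD : D.IsOrdered m) {a b : Str} {w : V} (ha : D.ReachedBy m f a w)
    (hb : D.ReachedBy m f b w) (hab : a.length = b.length) (hlevel : D.level m w = a.length)
    {s : Str} (hs : a.length + s.length = m) : f (a ++ s) = f (b ++ s) := by
  refine Option.some_injective _ ?_
  rw [ha.2.2 s hs, hb.2.2 s (by omega)]
  refine hD.evalFrom_congr ha.1 fun j hj => ?_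
  rw [List.getD_append_right _ _ _ _ (by omega), List.getD_append_right _ _ _ _ (by omega), hab]

theorem IsOrdered.card_le_of_separated (hD : D.IsOrdered m) (hf : CorrectMQ D m f)
    {X : Finset Str} (hX : ∀ a ∈ X, a.length = m ∨ Essential f m a)
    (hsep : ∀ a ∈ X, ∀ b ∈ X, a.length = b.length →
      (∀ s : Str, a.length + s.length = m → f (a ++ s) = f (b ++ s)) → a = b) :
    X.card ≤ D.nodes.card := by
  have hlen (a : Str) (ha : a ∈ X) : a.length ≤ m := by
    rcases hX a ha with h | ⟨r, -, h, -⟩ <;> omega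
  have : Nonempty V := ⟨D.root⟩
  have hex := fun a ha => hD.exists_reachedBy hf (hlen a ha)
  choose! g hg using hex
  have hlevel (a : Str) (ha : a ∈ X) : D.level m (g a) = a.length := by
    rcases hX a ha with h | h
    · exact le_antisymm (h ▸ hD.level_le (hg a ha).1) (hg a ha).2.1
    · exact (hg a ha).level_eq_of_essential hD h
  refine Finset.card_le_card_of_injOn g (fun a ha => (hg a ha).1) fun a ha b hb hab => ?_
  have hab_len : a.length = b.length := by rw [← hlevel a ha, ← hlevel b hb, hab]
  exact hsep a ha b hb hab_len fun s hs =>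
    (hg a ha).congr hD (hab ▸ hg b hb) hab_len (hlevel a ha) hs

end Residuals

end Diagram

/-! ### Invariants of the hypothesis -/

namespace OMTBDDAS

section NodeSet

variable {L : Type} {S S' : OMTBDDAS L} {v : Str} {E E' : Edge}

/-- The set of all nodes. -/
def nodeSet (S : OMTBDDAS L) : Finset Str := (S.inner ++ S.sinks.map Prod.fst).toFinset

/-- The set of the nodes of length `i`. -/
def level (S : OMTBDDAS L) (i : ℕ) : Finset Str := S.nodeSet.filter fun v => v.length = i

/-- The node `v` has an outgoing edge that begins with the bit `b`. -/
def HasOut (S : OMTBDDAS L) (v : Str) (b : Bool) : Prop :=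
  ∃ E ∈ S.edges, E.src = v ∧ E.lab.head? = some b

/-- The node `v` has both outgoing edges. -/
def Full (S : OMTBDDAS L) (v : Str) : Prop := ∀ b, S.HasOut v b

/-- A potential that pays for the membership queries of the classifications: two queries for every
pair of an edge and a node. -/
def weight (S : OMTBDDAS L) : ℕ := 2 * S.edges.length * S.nodeSet.card

lemma mem_nodeSet : v ∈ S.nodeSet ↔ v ∈ S.inner ∨ ∃ l, (v, l) ∈ S.sinks := by
  simp [nodeSet]

lemma mem_level {i : ℕ} : v ∈ S.level i ↔ v ∈ S.nodeSet ∧ v.length = i := by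
  simp [level]

lemma nodeSet_addInner (S : OMTBDDAS L) (v : Str) :
    (S.addInner v).nodeSet = insert v S.nodeSet := by
  ext u
  simp [nodeSet, addInner]

lemma nodeSet_addSink (S : OMTBDDAS L) (v : Str) (l : L) :
    (S.addSink v l).nodeSet = insert v S.nodeSet := by
  ext u
  simp [nodeSet, addSink]

lemma level_of_nodeSet_insert (h : S'.nodeSet = insert v S.nodeSet) :
    S'.level v.length = insert v (S.level v.length) := by
  rw [level, h, Finset.filter_insert, if_pos rfl, level]

lemma level_of_nodeSet_insert_ne {i : ℕ} (h : S'.nodeSet = insert v S.nodeSet)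
    (hi : v.length ≠ i) : S'.level i = S.level i := by
  rw [level, h, Finset.filter_insert, if_neg hi, level]

lemma card_filter_length_lt_add_card_level (S : OMTBDDAS L) (i : ℕ) :
    (S.nodeSet.filter fun u => u.length < i).card + (S.level i).card =
      (S.nodeSet.filter fun u => u.length < i + 1).card := by
  rw [level, ← Finset.card_union_of_disjoint
    (Finset.disjoint_filter.2 fun u _ hlt heq => hlt.ne heq), ← Finset.filter_or]
  simp only [Nat.lt_succ_iff_lt_or_eq]

lemma length_replaceEdge (hE : E ∈ S.edges) :
    (S.replaceEdge E E').edges.length = S.edges.length := by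
  simp only [replaceEdge, List.length_cons, List.length_erase_of_mem hE]
  exact Nat.sub_add_cancel (List.length_pos_of_mem hE)

lemma weight_addEdge (S : OMTBDDAS L) (E : Edge) :
    (S.addEdge E).weight = S.weight + 2 * S.nodeSet.card := by
  change 2 * (S.edges.length + 1) * S.nodeSet.card = _
  rw [weight]
  ring

lemma weight_of_nodeSet_insert (hS' : S'.nodeSet = insert v S.nodeSet) (hv : v ∉ S.nodeSet)
    (hlen : S'.edges.length = S.edges.length) :
    S'.weight = S.weight + 2 * S.edges.length := by
  rw [weight, hlen, hS', Finset.card_insert_of_notMem hv, weight]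
  ring

end NodeSet

section IsValid

variable {L : Type} {f : Str → L} {m : ℕ} {S : OMTBDDAS L} {v : Str} {E E' : Edge}

/-- The structural invariant: the nodes and edges of `S` are well-formed, the sinks have the
values given by `f`, and the edges that leave a node have different first bits. -/
structure IsValid (f : Str → L) (m : ℕ) (S : OMTBDDAS L) : Prop where
  inner_lt : ∀ v ∈ S.inner, v.length < m
  sink_eq : ∀ p ∈ S.sinks, p.1.length = m ∧ p.2 = f p.1
  root_mem : [] ∈ S.inner
  src_mem : ∀ E ∈ S.edges, E.src ∈ S.inner
  tgt_mem : ∀ E ∈ S.edges, E.tgt ∈ S.nodeSet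
  length_eq : ∀ E ∈ S.edges, E.src.length + E.lab.length = E.tgt.length
  lab_ne : ∀ E ∈ S.edges, E.lab ≠ []
  nodup : S.edges.Nodup
  edge_inj : ∀ E ∈ S.edges, ∀ F ∈ S.edges, E.src = F.src → E.lab.head? = F.lab.head? → E = F

namespace IsValid

lemma length_le (h : S.IsValid f m) (hv : v ∈ S.nodeSet) : v.length ≤ m := by
  rcases mem_nodeSet.1 hv with hv | ⟨l, hl⟩
  · exact (h.inner_lt v hv).le
  · exact (h.sink_eq _ hl).1.le

lemma addEdge (h : S.IsValid f m) (hsrc : E.src ∈ S.inner) (htgt : E.tgt ∈ S.nodeSet)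
    (hlen : E.src.length + E.lab.length = E.tgt.length) (hlab : E.lab ≠ [])
    (hfresh : ∀ F ∈ S.edges, F.src = E.src → F.lab.head? ≠ E.lab.head?) :
    (S.addEdge E).IsValid f m where
  inner_lt := h.inner_lt
  sink_eq := h.sink_eq
  root_mem := h.root_mem
  src_mem := List.forall_mem_cons.2 ⟨hsrc, h.src_mem⟩
  tgt_mem := List.forall_mem_cons.2 ⟨htgt, h.tgt_mem⟩
  length_eq := List.forall_mem_cons.2 ⟨hlen, h.length_eq⟩
  lab_ne := List.forall_mem_cons.2 ⟨hlab, h.lab_ne⟩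
  nodup := List.nodup_cons.2 ⟨fun hE => hfresh E hE rfl rfl, h.nodup⟩
  edge_inj := by
    intro F hF G hG hsrc_eq hhead_eq
    rcases List.mem_cons.1 hF with rfl | hF' <;> rcases List.mem_cons.1 hG with rfl | hG'
    · rfl
    · exact absurd hhead_eq.symm (hfresh G hG' hsrc_eq.symm)
    · exact absurd hhead_eq (hfresh F hF' hsrc_eq)
    · exact h.edge_inj F hF' G hG' hsrc_eq hhead_eq

lemma addInner (h : S.IsValid f m) (hv : v.length < m) : (S.addInner v).IsValid f m where
  inner_lt := List.forall_mem_cons.2 ⟨hv, h.inner_lt⟩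
  sink_eq := h.sink_eq
  root_mem := List.mem_cons_of_mem _ h.root_mem
  src_mem E hE := List.mem_cons_of_mem _ (h.src_mem E hE)
  tgt_mem E hE := by
    rw [nodeSet_addInner]
    exact Finset.mem_insert_of_mem (h.tgt_mem E hE)
  length_eq := h.length_eq
  lab_ne := h.lab_ne
  nodup := h.nodup
  edge_inj := h.edge_inj

lemma addSink (h : S.IsValid f m) (hv : v.length = m) : (S.addSink v (f v)).IsValid f m where
  inner_lt := h.inner_lt
  sink_eq := List.forall_mem_cons.2 ⟨⟨hv, rfl⟩, h.sink_eq⟩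
  root_mem := h.root_mem
  src_mem := h.src_mem
  tgt_mem E hE := by
    rw [nodeSet_addSink]
    exact Finset.mem_insert_of_mem (h.tgt_mem E hE)
  length_eq := h.length_eq
  lab_ne := h.lab_ne
  nodup := h.nodup
  edge_inj := h.edge_inj

lemma mem_replaceEdge (h : S.IsValid f m) {F : Edge} :
    F ∈ (S.replaceEdge E E').edges ↔ F = E' ∨ (F ≠ E ∧ F ∈ S.edges) := by
  simp [OMTBDDAS.replaceEdge, h.nodup.mem_erase_iff]

lemma replaceEdge (h : S.IsValid f m) (hE : E ∈ S.edges) (hsrc : E'.src = E.src)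
    (htgt : E'.tgt ∈ S.nodeSet) (hlen : E'.src.length + E'.lab.length = E'.tgt.length)
    (hlab : E'.lab ≠ []) (hhead : E'.lab.head? = E.lab.head?) :
    (S.replaceEdge E E').IsValid f m := by
  have hrest : ∀ F ∈ S.edges.erase E, F ∈ S.edges := fun F => List.mem_of_mem_erase
  have hfresh : ∀ F ∈ S.edges.erase E, F.src = E'.src → F.lab.head? ≠ E'.lab.head? := by
    intro F hF hFsrc hFhead
    rw [h.nodup.mem_erase_iff] at hF
    exact hF.1 (h.edge_inj F hF.2 E hE (hFsrc.trans hsrc) (hFhead.trans hhead))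
  have herase : IsValid f m { S with edges := S.edges.erase E } :=
    { inner_lt := h.inner_lt
      sink_eq := h.sink_eq
      root_mem := h.root_mem
      src_mem := fun F hF => h.src_mem F (hrest F hF)
      tgt_mem := fun F hF => h.tgt_mem F (hrest F hF)
      length_eq := fun F hF => h.length_eq F (hrest F hF)
      lab_ne := fun F hF => h.lab_ne F (hrest F hF)
      nodup := h.nodup.erase E
      edge_inj := fun F hF G hG => h.edge_inj F (hrest F hF) G (hrest G hG) }
  exact herase.addEdge (E := E') (hsrc ▸ h.src_mem E hE) htgt hlen hlab hfresh

lemma hasOut_replaceEdge (h : S.IsValid f m) (hE : E ∈ S.edges) (hsrc : E'.src = E.src)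
    (hhead : E'.lab.head? = E.lab.head?) (v : Str) (b : Bool) :
    (S.replaceEdge E E').HasOut v b ↔ S.HasOut v b := by
  constructor
  · rintro ⟨F, hF, hFv, hFb⟩
    rcases h.mem_replaceEdge.1 hF with rfl | ⟨-, hF⟩
    · exact ⟨E, hE, hsrc ▸ hFv, hhead ▸ hFb⟩
    · exact ⟨F, hF, hFv, hFb⟩
  · rintro ⟨F, hF, hFv, hFb⟩
    rcases eq_or_ne F E with rfl | hFE
    · exact ⟨E', h.mem_replaceEdge.2 (Or.inl rfl), hsrc.trans hFv, hhead.trans hFb⟩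
    · exact ⟨F, h.mem_replaceEdge.2 (Or.inr ⟨hFE, hF⟩), hFv, hFb⟩

end IsValid

end IsValid

end OMTBDDAS

open OMTBDDAS

section Grows

variable {L : Type} {d d' : ℕ} {P P' : Str → Option Bool → Prop} {h h' h'' : Hyp L}

/-- The changes made by AddEdge: nodes of length greater than `d` are added, and edges that begin
at nodes of length at least `d`. The new edges that begin at an old node `u` satisfy `P u b`, where
`b` is their first bit. -/
structure Grows (d : ℕ) (P : Str → Option Bool → Prop) (h h' : Hyp L) : Prop where
  edges : ∃ new, h'.S.edges = new ++ h.S.edges ∧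
    ∀ E ∈ new, d ≤ E.src.length ∧ (E.src ∈ h.S.inner → P E.src E.lab.head?)
  tree_eq : ∀ i ≤ d, h'.T i = h.T i
  level_eq : ∀ i ≤ d, h'.S.level i = h.S.level i
  inner_sub : h.S.inner ⊆ h'.S.inner
  sinks_sub : h.S.sinks ⊆ h'.S.sinks

namespace Grows

lemma trans (hg : Grows d P h h') (hg' : Grows d' P' h' h'') (hd : d ≤ d')
    (hP : ∀ u ∈ h.S.inner, ∀ b, P' u b → P u b) : Grows d P h h'' where
  edges := by
    obtain ⟨new, hnew, hmem⟩ := hg.edges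
    obtain ⟨new', hnew', hmem'⟩ := hg'.edges
    refine ⟨new' ++ new, by rw [hnew', hnew, List.append_assoc], fun E hE => ?_⟩
    rcases List.mem_append.1 hE with hE | hE
    · exact ⟨hd.trans (hmem' E hE).1, fun hs => hP _ hs _ ((hmem' E hE).2 (hg.inner_sub hs))⟩
    · exact hmem E hE
  tree_eq i hi := (hg'.tree_eq i (hi.trans hd)).trans (hg.tree_eq i hi)
  level_eq i hi := (hg'.level_eq i (hi.trans hd)).trans (hg.level_eq i hi)
  inner_sub := List.Subset.trans hg.inner_sub hg'.inner_sub
  sinks_sub := List.Subset.trans hg.sinks_sub hg'.sinks_sub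

lemma mono (hg : Grows d P h h') (hP : ∀ u b, P u b → P' u b) : Grows d P' h h' where
  edges := by
    obtain ⟨new, hnew, hmem⟩ := hg.edges
    exact ⟨new, hnew, fun E hE => ⟨(hmem E hE).1, fun hs => hP _ _ ((hmem E hE).2 hs)⟩⟩
  tree_eq := hg.tree_eq
  level_eq := hg.level_eq
  inner_sub := hg.inner_sub
  sinks_sub := hg.sinks_sub

lemma mem_edges (hg : Grows d P h h') {E : Edge} (hE : E ∈ h.S.edges) : E ∈ h'.S.edges := by
  obtain ⟨new, hnew, -⟩ := hg.edges
  rw [hnew]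
  exact List.mem_append_right _ hE

lemma mem_or_le_length (hg : Grows d P h h') {E : Edge} (hE : E ∈ h'.S.edges) :
    E ∈ h.S.edges ∨ d ≤ E.src.length := by
  obtain ⟨new, hnew, hmem⟩ := hg.edges
  rw [hnew] at hE
  exact (List.mem_append.1 hE).symm.imp_right fun hE => (hmem E hE).1

lemma hasOut (hg : Grows d P h h') {v : Str} {b : Bool} : h.S.HasOut v b → h'.S.HasOut v b :=
  fun ⟨E, hE, hEv⟩ => ⟨E, hg.mem_edges hE, hEv⟩

lemma full (hg : Grows d P h h') {v : Str} (hv : h.S.Full v) : h'.S.Full v :=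
  fun b => hg.hasOut (hv b)

lemma of_hasOut (hg : Grows d P h h') {v : Str} {b : Bool} (hv : v ∈ h.S.inner)
    (ho : h'.S.HasOut v b) : h.S.HasOut v b ∨ P v (some b) := by
  obtain ⟨new, hnew, hmem⟩ := hg.edges
  obtain ⟨E, hE, rfl, hEb⟩ := ho
  rw [hnew] at hE
  rcases List.mem_append.1 hE with hE | hE
  · exact Or.inr (hEb ▸ (hmem E hE).2 hv)
  · exact Or.inl ⟨E, hE, rfl, hEb⟩

lemma nodeSet_subset (hg : Grows d P h h') : h.S.nodeSet ⊆ h'.S.nodeSet := by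
  intro v hv
  rcases mem_nodeSet.1 hv with hv | ⟨l, hl⟩
  · exact mem_nodeSet.2 (Or.inl (hg.inner_sub hv))
  · exact mem_nodeSet.2 (Or.inr ⟨l, hg.sinks_sub hl⟩)

lemma addEdge (h : Hyp L) {E : Edge} (hd : d ≤ E.src.length) (hP : P E.src E.lab.head?) :
    Grows d P h (h.mapS fun S => S.addEdge E) where
  edges := by
    refine ⟨[E], rfl, fun F hF => ?_⟩
    rw [List.mem_singleton.1 hF]
    exact ⟨hd, fun _ => hP⟩
  tree_eq _ _ := rfl
  level_eq _ _ := rfl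
  inner_sub _ := id
  sinks_sub _ := id

end Grows

end Grows

section Invariants

variable {L : Type} [DecidableEq L] {f : Str → L} {m i d : ℕ} {ns : Finset Str} {T : CTree L}
  {S S' : OMTBDDAS L} {E : Edge} {P : Str → Option Bool → Prop} {h h' : Hyp L}

/-- The invariant of the tree that classifies the strings of length `i`, where `ns` is the set of
the nodes of this length. -/
structure TreeOK (f : Str → L) (m i : ℕ) (ns : Finset Str) (T : CTree L) : Prop where
  label?_self : ∀ v ∈ ns, T.label? f v = some (some v)
  mem_of_label? : ∀ a u : Str, a.length = i → T.label? f a = some (some u) → u ∈ ns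
  essential : i < m → ∀ a : Str, a.length = i → T.label? f a ≠ some none → Essential f m a
  testsOfLength : T.TestsOfLength (m - i) []

/-- The classification tree for strings of length `i` agrees with the edge `E`: the end of `E` is
classified as the target of `E`, and the inner points of `E` as `μ`. -/
structure EdgeOK (f : Str → L) (i : ℕ) (T : CTree L) (E : Edge) : Prop where
  land : E.src.length + E.lab.length = i → T.label? f (E.src ++ E.lab) = some (some E.tgt)
  cross : E.src.length < i → i < E.src.length + E.lab.length →
    T.label? f (E.src ++ E.lab.take (i - E.src.length)) = some none

/-- The invariant that concerns the strings of length `i`. -/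
structure LevelOK (f : Str → L) (m : ℕ) (S : OMTBDDAS L) (i : ℕ) (T : CTree L) : Prop where
  tree : TreeOK f m i (S.level i) T
  edge : ∀ E ∈ S.edges, EdgeOK f i T E
  cost_le : ∀ a : Str, T.cost f a ≤ 2 * (S.level i).card

/-- The part of the invariant of the main loop that AddEdge needs and preserves when it is executed
for a node of length `d`. The levels up to `d` may be inconsistent at that time. -/
structure ConsistentAbove (f : Str → L) (m d : ℕ) (h : Hyp L) : Prop where
  valid : h.S.IsValid f m
  levels : ∀ i, d < i → i ≤ m → LevelOK f m h.S i (h.T i)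
  top : (h.T m).IsTop f

lemma TreeOK.of_isGrowth (h : TreeOK f m i ns T) {T' : CTree L} {a : Str}
    (hT' : CTree.IsGrowth f a T T') (htests : T'.TestsOfLength (m - i) []) :
    TreeOK f m i (insert a ns) T' where
  label?_self v hv := by
    rcases Finset.mem_insert.1 hv with rfl | hv
    · exact hT'.label?_self
    · exact hT'.label?_of_some (h.label?_self v hv)
  mem_of_label? b u hb hu := by
    rcases hT'.label?_eq b with heq | ⟨-, heq⟩
    · exact Finset.mem_insert_of_mem (h.mem_of_label? b u hb (heq ▸ hu))
    · obtain rfl : a = u := by simpa [heq] using hu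
      exact Finset.mem_insert_self _ _
  essential hi b hb hne :=
    h.essential hi b hb fun heq => hne (hT'.label?_of_some heq)
  testsOfLength := htests

lemma EdgeOK.of_isGrowth (h : EdgeOK f i T E) {T' : CTree L} {a : Str}
    (hT' : CTree.IsGrowth f a T T') : EdgeOK f i T' E where
  land hi := hT'.label?_of_some (h.land hi)
  cross hlt hgt := hT'.label?_of_some (h.cross hlt hgt)

lemma EdgeOK.of_le_src (T : CTree L) (hi : i ≤ E.src.length) (hE : E.lab ≠ []) :
    EdgeOK f i T E where
  land hland := absurd (List.length_pos_iff.2 hE) (by omega)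
  cross hlt _ := absurd hlt (by omega)

lemma EdgeOK.of_label? {T : ℕ → CTree L} {v s u : Str}
    (hend : (T (v.length + s.length)).label? f (v ++ s) = some (some u))
    (hpass : ∀ j, 1 ≤ j → j < s.length →
      (T (v.length + j)).label? f (v ++ s.take j) = some none) (hi : v.length < i) :
    EdgeOK f i (T i) ⟨v, s, u⟩ where
  land hland := hland ▸ hend
  cross _ hlt := by
    obtain ⟨j, rfl⟩ := Nat.exists_eq_add_of_lt hi
    rw [add_assoc, Nat.add_sub_cancel_left]
    exact hpass _ (by omega) (by simp only at hlt; omega)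

lemma LevelOK.mono (h : LevelOK f m S i T) (hlevel : S'.level i = S.level i)
    (hE : ∀ E ∈ S'.edges, E ∈ S.edges ∨ EdgeOK f i T E) : LevelOK f m S' i T where
  tree := hlevel ▸ h.tree
  edge E hE' := (hE E hE').elim (h.edge E) id
  cost_le := hlevel ▸ h.cost_le

lemma Grows.levelOK (hg : Grows d P h h') (hvalid : h'.S.IsValid f m) (hi : i ≤ d)
    (hlevel : LevelOK f m h.S i (h.T i)) : LevelOK f m h'.S i (h'.T i) := by
  rw [hg.tree_eq i hi]
  refine hlevel.mono (hg.level_eq i hi) fun E hE => ?_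
  exact (hg.mem_or_le_length hE).imp_right fun hd =>
    EdgeOK.of_le_src _ (hi.trans hd) (hvalid.lab_ne E hE)

lemma Grows.consistentAbove {d' : ℕ} (hg : Grows d P h h') (hh : ConsistentAbove f m d' h)
    (hh' : ConsistentAbove f m d h') : ConsistentAbove f m d' h' where
  valid := hh'.valid
  levels i hi him := by
    rcases le_or_gt i d with hle | hlt
    · exact hg.levelOK hh'.valid hle (hh.levels i hi him)
    · exact hh'.levels i hlt him
  top := hh'.top

lemma ConsistentAbove.mono {d' : ℕ} (hh : ConsistentAbove f m d h) (hd : d ≤ d') :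
    ConsistentAbove f m d' h where
  valid := hh.valid
  levels i hi := hh.levels i (hd.trans_lt hi)
  top := hh.top

lemma ConsistentAbove.addEdge (hh : ConsistentAbove f m d h) (hsrc : E.src ∈ h.S.inner)
    (htgt : E.tgt ∈ h.S.nodeSet) (hlen : E.src.length + E.lab.length = E.tgt.length)
    (hlab : E.lab ≠ []) (hfresh : ∀ F ∈ h.S.edges, F.src = E.src → F.lab.head? ≠ E.lab.head?)
    (hE : ∀ i, d < i → EdgeOK f i (h.T i) E) :
    ConsistentAbove f m d (h.mapS fun S => S.addEdge E) where
  valid := hh.valid.addEdge hsrc htgt hlen hlab hfresh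
  levels i hi him := by
    refine (hh.levels i hi him).mono rfl fun F hF => ?_
    rcases List.mem_cons.1 hF with rfl | hF
    · exact Or.inr (hE i hi)
    · exact Or.inl hF
  top := hh.top

end Invariants

section InsertNode

variable {L : Type} [DecidableEq L] {f : Str → L} {m d : ℕ} {h : Hyp L} {S' : OMTBDDAS L} {a : Str}

/-- The new node `a`, at which a classification got stuck, is added to the diagram and to the
classification tree of its length; `S'` is the new diagram. -/
def Hyp.insertNode (h : Hyp L) (f : Str → L) (a : Str) (S' : OMTBDDAS L) : Hyp L where
  S := S'
  T := Function.update h.T a.length ((h.T a.length).grow f a)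

lemma ConsistentAbove.insertNode (hh : ConsistentAbove f m d h) (hd : d < a.length)
    (ha : a.length ≤ m) (hstuck : (h.T a.length).label? f a = none)
    (hnodes : S'.nodeSet = insert a h.S.nodeSet) (hedges : S'.edges = h.S.edges)
    (hvalid : S'.IsValid f m) : ConsistentAbove f m d (h.insertNode f a S') where
  valid := hvalid
  levels i hi him := by
    rcases eq_or_ne i a.length with rfl | hne
    · have hlevel := hh.levels a.length hd ha
      simp only [Hyp.insertNode, Function.update_self]
      have hgrowth := CTree.isGrowth_grow hstuck
      refine ⟨?_, fun E hE => (hlevel.edge E (hedges ▸ hE)).of_isGrowth hgrowth, fun b => ?_⟩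
      · rw [level_of_nodeSet_insert hnodes]
        exact hlevel.tree.of_isGrowth hgrowth (hlevel.tree.testsOfLength.grow f a)
      · rw [CTree.cost_grow, level_of_nodeSet_insert hnodes]
        exact (hlevel.cost_le b).trans (by gcongr; exact Finset.subset_insert _ _)
    · simp only [Hyp.insertNode, Function.update_of_ne hne]
      exact (hh.levels i hi him).mono (level_of_nodeSet_insert_ne hnodes hne.symm)
        fun E hE => Or.inl (hedges ▸ hE)
  top := by
    rcases eq_or_ne m a.length with rfl | hne
    · simpa only [Hyp.insertNode, Function.update_self] using hh.top.grow a
    · simpa only [Hyp.insertNode, Function.update_of_ne hne] using hh.top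

lemma Grows.insertNode {P : Str → Option Bool → Prop} (hd : d < a.length)
    (hnodes : S'.nodeSet = insert a h.S.nodeSet) (hedges : S'.edges = h.S.edges)
    (hinner : h.S.inner ⊆ S'.inner) (hsinks : h.S.sinks ⊆ S'.sinks) :
    Grows d P h (h.insertNode f a S') where
  edges := ⟨[], hedges, by simp⟩
  tree_eq i hi := Function.update_of_ne (by omega) _ _
  level_eq i hi := level_of_nodeSet_insert_ne hnodes (by omega)
  inner_sub := hinner
  sinks_sub := hsinks

end InsertNode

/-! ### AddEdge -/

section AddEdge

variable {L : Type} [DecidableEq L] {f : Str → L} {m : ℕ} {v t u a : Str} {b : Bool}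
  {B B' : Set Bool} {h h' h'' : Hyp L}

/-- The effect of adding edges that leave the node `v` and begin with the bits in `B`, together
with the new nodes that are their targets and all that is needed to complete these. -/
structure AddsOut (f : Str → L) (m : ℕ) (v : Str) (B : Set Bool) (h h' : Hyp L) : Prop where
  consistent : ConsistentAbove f m v.length h'
  grows : Grows v.length (fun u c => u = v ∧ ∃ b ∈ B, c = some b) h h'
  out : ∀ b ∈ B, h'.S.HasOut v b
  full_new : ∀ u ∈ h'.S.inner, u ∈ h.S.inner ∨ h'.S.Full u

/-- The precondition for the execution of AddEdge for the node `v` and the string `t`, which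
begins with the bit `b`. -/
structure CanAddEdge (f : Str → L) (m : ℕ) (v t : Str) (b : Bool) (h : Hyp L) : Prop where
  consistent : ConsistentAbove f m v.length h
  mem_inner : v ∈ h.S.inner
  le_length : m ≤ v.length + t.length
  head?_eq : t.head? = some b
  not_hasOut : ¬ h.S.HasOut v b

lemma AddsOut.trans (hadd : AddsOut f m v B h h') (hadd' : AddsOut f m v B' h' h'') :
    AddsOut f m v (B ∪ B') h h'' where
  consistent := hadd'.consistent
  grows := (hadd.grows.mono fun _ _ ⟨hu, b, hb, hc⟩ => ⟨hu, b, Or.inl hb, hc⟩).trans hadd'.grows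
    le_rfl fun _ _ _ ⟨hu, b, hb, hc⟩ => ⟨hu, b, Or.inr hb, hc⟩
  out b hb := hb.elim (fun hb => hadd'.grows.hasOut (hadd.out b hb)) (hadd'.out b)
  full_new u hu := (hadd'.full_new u hu).elim
    (fun hu => (hadd.full_new u hu).imp_right hadd'.grows.full) Or.inr

lemma AddsOut.of_grows (hg : Grows v.length (fun _ _ => False) h h')
    (hinner : h'.S.inner ⊆ h.S.inner) (hadd : AddsOut f m v B h' h'') :
    AddsOut f m v B h h'' where
  consistent := hadd.consistent
  grows := (hg.mono fun _ _ => False.elim).trans hadd.grows le_rfl fun _ _ _ => id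
  out := hadd.out
  full_new u hu := (hadd.full_new u hu).imp_left fun hu => hinner hu

lemma AddsOut.of_new (hg : Grows v.length (fun u c => u = v ∧ ∃ b ∈ B, c = some b) h h')
    (hcons : ConsistentAbove f m v.length h') (hout : ∀ b ∈ B, h'.S.HasOut v b)
    (hinner : h'.S.inner ⊆ u :: h.S.inner) (hu : u ∉ h.S.inner) (hvu : v.length ≤ u.length)
    (hadd : AddsOut f m u Set.univ h' h'') : AddsOut f m v B h h'' where
  consistent := hadd.grows.consistentAbove hcons hadd.consistent
  grows := hg.trans hadd.grows hvu fun w hw _ hwu => absurd (hwu.1 ▸ hw) hu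
  out b hb := hadd.grows.hasOut (hout b hb)
  full_new w hw := by
    rcases hadd.full_new w hw with hw | hfull
    · rcases List.mem_cons.1 (hinner hw) with rfl | hw
      · exact Or.inr fun b => hadd.out b trivial
      · exact Or.inl hw
    · exact Or.inr hfull

namespace CanAddEdge

lemma addsOut (hpre : CanAddEdge f m v t b h) {j : ℕ} (hj : 1 ≤ j) (hjm : v.length + j ≤ m)
    (hend : (h.T (v.length + j)).label? f (v ++ t.take j) = some (some u))
    (hpass : ∀ i, 1 ≤ i → i < j → (h.T (v.length + i)).label? f (v ++ t.take i) = some none) :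
    AddsOut f m v {b} h (h.mapS fun S => S.addEdge ⟨v, t.take j, u⟩) := by
  have hjt : (t.take j).length = j := by
    have := hpre.le_length
    rw [List.length_take]
    omega
  have hhead : (t.take j).head? = some b := by
    rw [List.head?_take, if_neg (by omega), hpre.head?_eq]
  obtain ⟨hu, hulen⟩ := mem_level.1 <| (hpre.consistent.levels _ (by omega) hjm).tree.mem_of_label?
    _ u (by rw [List.length_append, hjt]) hend
  have hne : t.take j ≠ [] := List.ne_nil_of_length_pos (by rw [hjt]; exact hj)
  constructor
  · refine hpre.consistent.addEdge hpre.mem_inner hu (by simp only [hjt, hulen]) hne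
      (fun F hF hFv hFb => ?_) fun i hi => ?_
    · exact hpre.not_hasOut ⟨F, hF, hFv, hFb.trans hhead⟩
    · refine EdgeOK.of_label? (by rwa [hjt]) (fun k hk hkj => ?_) hi
      rw [hjt] at hkj
      rw [List.take_take, min_eq_left hkj.le]
      exact hpass k hk hkj
  · exact Grows.addEdge h le_rfl ⟨rfl, b, rfl, hhead⟩
  · rintro _ rfl
    exact ⟨_, List.mem_cons_self, rfl, hhead⟩
  · exact fun w hw => Or.inl hw

lemma insertNode (hpre : CanAddEdge f m v t b h) {S' : OMTBDDAS L} (hva : v.length < a.length)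
    (ha : a.length ≤ m) (hstuck : (h.T a.length).label? f a = none)
    (hnodes : S'.nodeSet = insert a h.S.nodeSet) (hedges : S'.edges = h.S.edges)
    (hinner : h.S.inner ⊆ S'.inner) (hvalid : S'.IsValid f m) :
    CanAddEdge f m v t b (h.insertNode f a S') where
  consistent := hpre.consistent.insertNode hva ha hstuck hnodes hedges hvalid
  mem_inner := hinner hpre.mem_inner
  le_length := hpre.le_length
  head?_eq := hpre.head?_eq
  not_hasOut := fun ⟨E, hE, hEv⟩ => hpre.not_hasOut ⟨E, hedges ▸ hE, hEv⟩

end CanAddEdge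

lemma ConsistentAbove.notMem_nodeSet {d : ℕ} (hh : ConsistentAbove f m d h) (hd : d < a.length)
    (ha : a.length ≤ m) (hstuck : (h.T a.length).label? f a = none) : a ∉ h.S.nodeSet := by
  intro hmem
  have hlabel := (hh.levels a.length hd ha).tree.label?_self a (mem_level.2 ⟨hmem, rfl⟩)
  rw [hstuck] at hlabel
  exact Option.some_ne_none _ hlabel.symm

lemma exists_addsOut_univ {A : Str → Hyp L → Prog L (Hyp L)}
    (hA : ∀ {t b h}, CanAddEdge f m v t b h → ∃ h' c, Yields f (A t h) h' c ∧
      AddsOut f m v {b} h h' ∧ c + h.S.weight ≤ h'.S.weight)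
    (hcons : ConsistentAbove f m v.length h) (hv : v ∈ h.S.inner)
    (ht : m ≤ v.length + t.length) (hout : ∀ b, ¬ h.S.HasOut v b) :
    ∃ h₁ h₂ c₁ c₂, Yields f (A t h) h₁ c₁ ∧ Yields f (A (flip t) h₁) h₂ c₂ ∧
      AddsOut f m v Set.univ h h₂ ∧ c₁ + c₂ + h.S.weight ≤ h₂.S.weight := by
  have hvm := hcons.valid.inner_lt v hv
  obtain ⟨b, s, rfl⟩ : ∃ b s, t = b :: s :=
    List.exists_cons_of_ne_nil (List.ne_nil_of_length_pos (by omega))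
  obtain ⟨h₁, c₁, hyields₁, hadd₁, hweight₁⟩ := hA ⟨hcons, hv, ht, rfl, hout b⟩
  have hpre₁ : CanAddEdge f m v (flip (b :: s)) (!b) h₁ :=
    { consistent := hadd₁.consistent
      mem_inner := hadd₁.grows.inner_sub hv
      le_length := by rwa [length_flip]
      head?_eq := rfl
      not_hasOut := fun hb => (hadd₁.grows.of_hasOut hv hb).elim (hout _) (by simp) }
  obtain ⟨h₂, c₂, hyields₂, hadd₂, hweight₂⟩ := hA hpre₁
  refine ⟨h₁, h₂, c₁, c₂, hyields₁, hyields₂, ?_, by omega⟩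
  have huniv : ({b} ∪ {!b} : Set Bool) = Set.univ := by
    ext d
    cases b <;> cases d <;> simp
  exact huniv ▸ hadd₁.trans hadd₂

section Step

variable {fuel j : ℕ} (hpre : CanAddEdge f m v t b h) (hj : 1 ≤ j) (hjm : v.length + j ≤ m)
  (hpass : ∀ i, 1 ≤ i → i < j → (h.T (v.length + i)).label? f (v ++ t.take i) = some none)

include hpre hj hjm hpass

lemma exists_addEdgeFrom_of_label?
    (hl : (h.T (v.length + j)).label? f (v ++ t.take j) = some (some u)) :
    ∃ h', Yields f (addEdgeFrom m (fuel + 1) v t j h) h'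
        ((h.T (v.length + j)).cost f (v ++ t.take j)) ∧
      AddsOut f m v {b} h h' ∧ h.S.weight + 2 * h.S.nodeSet.card ≤ h'.S.weight := by
  have hyields := CTree.yields_classify f (v ++ t.take j) (h.T (v.length + j))
  rw [CTree.result_of_label? hl] at hyields
  refine ⟨_, ?_, hpre.addsOut hj hjm hl hpass, (weight_addEdge _ _).ge⟩
  unfold addEdgeFrom
  refine hyields.bind (d := 0) ?_
  exact Yields.pure _

variable {S' : OMTBDDAS L} (hstuck : (h.T (v.length + j)).label? f (v ++ t.take j) = none)

include hstuck

lemma addsOut_insertNode (ha : v ++ t.take j = a) (hlen : v.length + j = a.length)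
    (hnodes : S'.nodeSet = insert a h.S.nodeSet) (hedges : S'.edges = h.S.edges)
    (hinner : h.S.inner ⊆ S'.inner) (hsinks : h.S.sinks ⊆ S'.sinks) (hvalid : S'.IsValid f m) :
    Grows v.length (fun _ _ => False) h (h.insertNode f a S') ∧
      AddsOut f m v {b} (h.insertNode f a S')
        ((h.insertNode f a S').mapS fun S => S.addEdge ⟨v, t.take j, a⟩) ∧
      h.S.weight + 2 * h.S.nodeSet.card + 2 * h.S.edges.length ≤
        ((h.insertNode f a S').mapS fun S => S.addEdge ⟨v, t.take j, a⟩).S.weight := by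
  subst ha
  rw [hlen] at hstuck hjm
  have hva : v.length < (v ++ t.take j).length := by omega
  refine ⟨Grows.insertNode hva hnodes hedges hinner hsinks,
    (hpre.insertNode hva hjm hstuck hnodes hedges hinner hvalid).addsOut hj (hlen ▸ hjm) ?_ ?_, ?_⟩
  · simp only [hlen, Hyp.insertNode, Function.update_self]
    exact CTree.label?_grow_self hstuck
  · intro i hi hij
    simp only [Hyp.insertNode,
      Function.update_of_ne (show v.length + i ≠ (v ++ t.take j).length by omega)]
    exact hpass i hi hij
  · change _ ≤ (S'.addEdge _).weight
    rw [weight_addEdge, weight_of_nodeSet_insert hnodes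
      (hpre.consistent.notMem_nodeSet hva hjm hstuck) (by rw [hedges])]
    have := Finset.card_le_card (hnodes ▸ Finset.subset_insert _ h.S.nodeSet)
    omega

lemma exists_addEdgeFrom_of_stuck_of_eq (hm : v.length + j = m) :
    ∃ h', Yields f (addEdgeFrom m (fuel + 1) v t j h) h'
        ((h.T (v.length + j)).cost f (v ++ t.take j)) ∧
      AddsOut f m v {b} h h' ∧ h.S.weight + 2 * h.S.nodeSet.card ≤ h'.S.weight := by
  have hlen : v.length + j = (v ++ t.take j).length := by
    have := hpre.le_length
    rw [List.length_append, List.length_take]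
    omega
  obtain ⟨hgrows, hadd, hweight⟩ := addsOut_insertNode hpre hj hjm hpass hstuck rfl hlen
    (nodeSet_addSink h.S _ _) rfl (List.Subset.refl _) (List.subset_cons_self _ _)
    (hpre.consistent.valid.addSink (hlen.symm.trans hm))
  refine ⟨_, ?_, hadd.of_grows hgrows (List.Subset.refl _), by
    exact (Nat.le_add_right _ _).trans hweight⟩
  have hyields := CTree.yields_classify f (v ++ t.take j) (h.T (v.length + j))
  have htop : (h.T (v.length + j)).IsTop f := hm ▸ hpre.consistent.top
  rw [CTree.result_of_stuck hstuck, htop.stuckValue_eq] at hyields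
  unfold addEdgeFrom Hyp.insertNode
  refine hyields.bind (d := 0) ?_
  simp only [if_pos (show j = m - v.length by omega), ← hlen]
  exact Yields.pure _

lemma exists_addEdgeFrom_of_stuck_of_lt (hm : v.length + j < m)
    (ih : ∀ {v t b h}, CanAddEdge f m v t b h → fuel + v.length = m →
      ∃ h' c, Yields f (addEdgeFrom m fuel v t 1 h) h' c ∧ AddsOut f m v {b} h h' ∧
        c + h.S.weight ≤ h'.S.weight) (hfuel : fuel + v.length + j = m) :
    ∃ h' c, Yields f (addEdgeFrom m (fuel + 1) v t j h) h'
        ((h.T (v.length + j)).cost f (v ++ t.take j) + c) ∧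
      AddsOut f m v {b} h h' ∧ c + h.S.weight + 2 * h.S.nodeSet.card ≤ h'.S.weight := by
  set a := v ++ t.take j with ha
  have hlen : v.length + j = a.length := by
    have := hpre.le_length
    rw [ha, List.length_append, List.length_take]
    omega
  obtain ⟨hgrows, hadd, hweight⟩ := addsOut_insertNode hpre hj hjm hpass hstuck ha.symm hlen
    (nodeSet_addInner h.S a) rfl (List.subset_cons_self _ _) (List.Subset.refl _)
    (hpre.consistent.valid.addInner (hlen ▸ hm))
  have hnew : a ∉ h.S.inner := fun hmem =>
    hpre.consistent.notMem_nodeSet (hlen ▸ by omega) (hlen ▸ hjm) (hlen ▸ hstuck)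
      (mem_nodeSet.2 (Or.inl hmem))
  have hout : ∀ b, ¬ ((h.S.addInner a).addEdge ⟨v, t.take j, a⟩).HasOut a b := by
    rintro b ⟨E, hE, hEa, -⟩
    rcases List.mem_cons.1 hE with rfl | hE
    · have : v.length = a.length := congrArg List.length hEa
      omega
    · exact hnew (hEa ▸ hpre.consistent.valid.src_mem E hE)
  obtain ⟨h₁, h₂, c₁, c₂, hyields₁, hyields₂, haddBoth, hweight₂⟩ :=
    exists_addsOut_univ (t := t) (fun hcan => ih hcan (by omega))
      (hadd.consistent.mono (by omega)) List.mem_cons_self (by have := hpre.le_length; omega) hout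
  refine ⟨h₂, c₁ + c₂, ?_, ?_, by omega⟩
  · have hyields := CTree.yields_classify f a (h.T (v.length + j))
    rw [CTree.result_of_stuck hstuck] at hyields
    unfold addEdgeFrom
    refine hyields.bind ?_
    simp only [if_neg (show ¬ j = m - v.length by omega)]
    rw [hlen]
    exact hyields₁.bind hyields₂
  · exact AddsOut.of_new ((hgrows.mono fun _ _ => False.elim).trans hadd.grows le_rfl
      fun _ _ _ => id) hadd.consistent hadd.out (List.Subset.refl _) hnew (by omega) haddBoth

end Step

lemma exists_addEdgeFrom (fuel : ℕ) : ∀ {v t : Str} {b : Bool} {j : ℕ} {h : Hyp L},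
    CanAddEdge f m v t b h → fuel + v.length + j = m + 1 → 1 ≤ j →
    (∀ i, 1 ≤ i → i < j → (h.T (v.length + i)).label? f (v ++ t.take i) = some none) →
    ∃ h' c, Yields f (addEdgeFrom m fuel v t j h) h' c ∧ AddsOut f m v {b} h h' ∧
      c + 2 * (h.S.nodeSet.filter fun u => u.length < v.length + j).card + h.S.weight ≤
        h'.S.weight := by
  induction fuel with
  | zero =>
    intro v t b j h hpre hfuel _ hpass
    have hvm := hpre.consistent.valid.inner_lt v hpre.mem_inner
    have hend := hpass (m - v.length) (by omega) (by omega)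
    rw [Nat.add_sub_cancel' hvm.le] at hend
    obtain ⟨u, hu, -⟩ := hpre.consistent.top.eq_of_label? hend
    exact absurd hu.symm (Option.some_ne_none u)
  | succ fuel ih =>
    intro v t b j h hpre hfuel hj hpass
    have hjm : v.length + j ≤ m := by omega
    have hcost := (hpre.consistent.levels _ (by omega) hjm).cost_le (v ++ t.take j)
    have hsum := h.S.card_filter_length_lt_add_card_level (v.length + j)
    have hcard := Finset.card_filter_le h.S.nodeSet fun u => u.length < v.length + j + 1
    rcases hl : (h.T (v.length + j)).label? f (v ++ t.take j) with _ | _ | u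
    · rcases hjm.eq_or_lt with heq | hlt
      · obtain ⟨h', hyields, hadd, hweight⟩ :=
          exists_addEdgeFrom_of_stuck_of_eq (fuel := fuel) hpre hj hjm hpass hl heq
        exact ⟨h', _, hyields, hadd, by omega⟩
      · obtain ⟨h', c, hyields, hadd, hweight⟩ := exists_addEdgeFrom_of_stuck_of_lt (fuel := fuel)
          hpre hj hjm hpass hl hlt (fun hcan hfuel => by
            obtain ⟨h', c, hyields, hadd, hweight⟩ :=
              ih hcan (by omega) le_rfl fun i _ _ => by omega
            exact ⟨h', c, hyields, hadd, by omega⟩) (by omega)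
        exact ⟨h', _, hyields, hadd, by omega⟩
    · have hyields := CTree.yields_classify f (v ++ t.take j) (h.T (v.length + j))
      rw [CTree.result_of_label? hl] at hyields
      obtain ⟨h', c, hyields', hadd, hweight⟩ := ih (j := j + 1) hpre (by omega) (by omega)
        fun i hi hij => (Nat.lt_succ_iff_lt_or_eq.1 hij).elim (hpass i hi) fun heq => heq ▸ hl
      refine ⟨h', (h.T (v.length + j)).cost f (v ++ t.take j) + c, ?_, hadd, ?_⟩
      · unfold addEdgeFrom
        refine hyields.bind ?_
        exact hyields'
      · rw [← add_assoc] at hweight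
        omega
    · obtain ⟨h', hyields, hadd, hweight⟩ :=
        exists_addEdgeFrom_of_label? (fuel := fuel) hpre hj hjm hpass hl
      exact ⟨h', _, hyields, hadd, by omega⟩

theorem exists_addEdge (hpre : CanAddEdge f m v t b h) :
    ∃ h' c, Yields f (addEdge m v t h) h' c ∧ AddsOut f m v {b} h h' ∧
      c + h.S.weight ≤ h'.S.weight := by
  have hvm := hpre.consistent.valid.inner_lt v hpre.mem_inner
  obtain ⟨h', c, hyields, hadd, hweight⟩ :=
    exists_addEdgeFrom (m - v.length) hpre (by omega) le_rfl fun i _ _ => by omega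
  exact ⟨h', c, hyields, hadd, by omega⟩

theorem exists_addEdge_flip (hcons : ConsistentAbove f m v.length h) (hv : v ∈ h.S.inner)
    (ht : m ≤ v.length + t.length) (hout : ∀ b, ¬ h.S.HasOut v b) :
    ∃ h₁ h₂ c₁ c₂, Yields f (addEdge m v t h) h₁ c₁ ∧ Yields f (addEdge m v (flip t) h₁) h₂ c₂ ∧
      AddsOut f m v Set.univ h h₂ ∧ c₁ + c₂ + h.S.weight ≤ h₂.S.weight :=
  exists_addsOut_univ exists_addEdge hcons hv ht hout

end AddEdge

/-! ### The loop invariant -/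

namespace OMTBDDAS

section Progress

variable {L : Type} {S S' S'' : OMTBDDAS L} {v : Str}

/-- The relation between a hypothesis and its updates: all nodes are kept, and the first bits of
the edges that leave the root. -/
structure RefinedBy (S S' : OMTBDDAS L) : Prop where
  nodeSet_subset : S.nodeSet ⊆ S'.nodeSet
  root_hasOut : ∀ b, S.HasOut [] b → S'.HasOut [] b

open Classical in
/-- A measure of the progress of the algorithm. It increases when a node is added, and when the
root ceases to be a dummy. -/
noncomputable def progress (S : OMTBDDAS L) : ℕ := S.nodeSet.card + if S.Full [] then 1 else 0

namespace RefinedBy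

lemma refl (S : OMTBDDAS L) : S.RefinedBy S := ⟨subset_rfl, fun _ => id⟩

lemma trans (h : S.RefinedBy S') (h' : S'.RefinedBy S'') : S.RefinedBy S'' where
  nodeSet_subset := h.nodeSet_subset.trans h'.nodeSet_subset
  root_hasOut b hb := h'.root_hasOut b (h.root_hasOut b hb)

lemma level_subset (h : S.RefinedBy S') (i : ℕ) : S.level i ⊆ S'.level i :=
  Finset.filter_subset_filter _ h.nodeSet_subset

lemma card_level_lt (h : S.RefinedBy S') (hv : v ∈ S'.nodeSet) (hv' : v ∉ S.nodeSet) :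
    (S.level v.length).card < (S'.level v.length).card :=
  Finset.card_lt_card <| Finset.ssubset_iff_subset_ne.2 ⟨h.level_subset _, fun heq =>
    hv' (mem_level.1 (heq ▸ mem_level.2 ⟨hv, rfl⟩)).1⟩

lemma root_full (h : S.RefinedBy S') (hroot : S.Full []) : S'.Full [] :=
  fun b => h.root_hasOut b (hroot b)

lemma progress_lt_of_notMem (h : S.RefinedBy S') (hv : v ∈ S'.nodeSet) (hv' : v ∉ S.nodeSet) :
    S.progress < S'.progress := by
  have hcard : S.nodeSet.card < S'.nodeSet.card :=
    Finset.card_lt_card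
      (Finset.ssubset_iff_subset_ne.2 ⟨h.nodeSet_subset, fun heq => hv' (heq ▸ hv)⟩)
  have hfull := h.root_full
  unfold progress
  split_ifs <;> first | omega | tauto

lemma progress_lt_of_full (h : S.RefinedBy S') (hroot : ¬ S.Full []) (hroot' : S'.Full []) :
    S.progress < S'.progress := by
  rw [progress, progress, if_neg hroot, if_pos hroot', add_zero]
  exact Nat.lt_succ_of_le (Finset.card_le_card h.nodeSet_subset)

end RefinedBy

end Progress

end OMTBDDAS

/-- The edge `E`, cut off at length `d` and redirected to `w`. -/
def Edge.cut (E : Edge) (d : ℕ) (w : Str) : Edge := ⟨E.src, E.lab.take (d - E.src.length), w⟩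

lemma Edge.cut_of_length_le {E : Edge} {d : ℕ} (h : E.src.length + E.lab.length ≤ d) (w : Str) :
    E.cut d w = ⟨E.src, E.lab, w⟩ := by
  rw [Edge.cut, List.take_of_length_le (by omega)]

section Edges

variable {L : Type} {f : Str → L} {m d : ℕ} {w : Str} {S : OMTBDDAS L} {E F : Edge} {h h' : Hyp L}

lemma Grows.refinedBy {P : Str → Option Bool → Prop} (hg : Grows d P h h') :
    h.S.RefinedBy h'.S :=
  ⟨hg.nodeSet_subset, fun _ => hg.hasOut⟩

lemma OMTBDDAS.IsValid.cut (h : S.IsValid f m) (hE : E ∈ S.edges) (hw : w ∈ S.nodeSet)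
    (hsrc : E.src.length < w.length) (htgt : w.length ≤ E.tgt.length) :
    (S.replaceEdge E (E.cut w.length w)).IsValid f m := by
  have hlen := h.length_eq E hE
  refine h.replaceEdge hE rfl hw ?_ ?_ ?_
  · simp only [Edge.cut, List.length_take]
    omega
  · refine List.ne_nil_of_length_pos ?_
    simp only [Edge.cut, List.length_take]
    omega
  · rw [Edge.cut, List.head?_take, if_neg (by omega)]

/-- The edge `F` is redirected to a new node, the string that leads along `F`. -/
def Hyp.divert (h : Hyp L) (F : Edge) : Hyp L :=
  h.mapS fun S => (S.addInner (F.src ++ F.lab)).replaceEdge F ⟨F.src, F.lab, F.src ++ F.lab⟩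

lemma OMTBDDAS.IsValid.mem_edges_divert (hS : h.S.IsValid f m) {G : Edge} :
    G ∈ (h.divert F).S.edges ↔ G = ⟨F.src, F.lab, F.src ++ F.lab⟩ ∨ (G ≠ F ∧ G ∈ h.S.edges) := by
  simp [Hyp.divert, Hyp.mapS, OMTBDDAS.addInner, OMTBDDAS.replaceEdge, hS.nodup.mem_erase_iff]

end Edges

section LoopInvariant

variable {L : Type} [DecidableEq L] {f : Str → L} {m d i : ℕ} {u v w : Str} {B : Set Bool}
  {T : CTree L} {S : OMTBDDAS L} {E : Edge} {h h' : Hyp L}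

lemma EdgeOK.cut (h : EdgeOK f i T E) (hid : i ≠ d) (hsrc : E.src.length ≤ d)
    (hd : d ≤ E.src.length + E.lab.length) (w : Str) : EdgeOK f i T (E.cut d w) where
  land hland := by
    simp only [Edge.cut, List.length_take] at hland
    omega
  cross hlt hgt := by
    simp only [Edge.cut, List.length_take] at hlt hgt ⊢
    rw [List.take_take, min_eq_left (by omega)]
    exact h.cross hlt (by omega)

/-- The invariant of the main loop, with two exceptions that arise during an update: the level `d`
may be inconsistent, and the node `u` may lack an outgoing edge. There is no exception for `d = 0`
and `u = []`. -/
structure LoopInvariantExcept (f : Str → L) (m d : ℕ) (u : Str) (h : Hyp L) : Prop where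
  valid : h.S.IsValid f m
  levels : ∀ i, 0 < i → i ≤ m → i ≠ d → LevelOK f m h.S i (h.T i)
  top : (h.T m).IsTop f
  full : ∀ v ∈ h.S.inner, v ≠ [] → v ≠ u → h.S.Full v
  root_out : ∃ b, h.S.HasOut [] b
  root_essential : h.S.Full [] → Essential f m []
  sinks_ne : h.S.sinks ≠ []

/-- The invariant of the main loop. -/
abbrev LoopInvariant (f : Str → L) (m : ℕ) (h : Hyp L) : Prop := LoopInvariantExcept f m 0 [] h

namespace LoopInvariantExcept

lemma except (hI : LoopInvariant f m h) (d : ℕ) : LoopInvariantExcept f m d [] h :=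
  { hI with levels := fun i hi him _ => hI.levels i hi him hi.ne' }

lemma consistentAbove (hI : LoopInvariantExcept f m d u h) : ConsistentAbove f m d h where
  valid := hI.valid
  levels i hi him := hI.levels i (by omega) him hi.ne'
  top := hI.top

lemma setTree (hI : LoopInvariantExcept f m d u h) (hdm : d < m) (hT : LevelOK f m h.S d T) :
    LoopInvariantExcept f m 0 u (h.setTree d T) where
  valid := hI.valid
  levels i hi him _ := by
    rcases eq_or_ne i d with rfl | hid
    · simpa only [Hyp.setTree, Function.update_self] using hT
    · simpa only [Hyp.setTree, Function.update_of_ne hid] using hI.levels i hi him hid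
  top := by simpa only [Hyp.setTree, Function.update_of_ne hdm.ne'] using hI.top
  full := hI.full
  root_out := hI.root_out
  root_essential := hI.root_essential
  sinks_ne := hI.sinks_ne

lemma addInner (hI : LoopInvariantExcept f m v.length [] h) (hv : v.length < m) :
    LoopInvariantExcept f m v.length v (h.mapS fun S => S.addInner v) where
  valid := hI.valid.addInner hv
  levels i hi him hid := (hI.levels i hi him hid).mono
    (level_of_nodeSet_insert_ne (nodeSet_addInner h.S v) hid.symm) fun _ => Or.inl
  top := hI.top
  full w hw hne hwv := hI.full w ((List.mem_cons.1 hw).resolve_left hwv) hne hne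
  root_out := hI.root_out
  root_essential := hI.root_essential
  sinks_ne := hI.sinks_ne

lemma cut (hI : LoopInvariantExcept f m w.length u h) (hE : E ∈ h.S.edges)
    (hw : w ∈ h.S.nodeSet) (hsrc : E.src.length < w.length) (htgt : w.length ≤ E.tgt.length) :
    LoopInvariantExcept f m w.length u
      (h.mapS fun S => S.replaceEdge E (E.cut w.length w)) := by
  have hlen := hI.valid.length_eq E hE
  have hhead : (E.cut w.length w).lab.head? = E.lab.head? := by
    rw [Edge.cut, List.head?_take, if_neg (by omega)]
  have hout := hI.valid.hasOut_replaceEdge (E' := E.cut w.length w) hE rfl hhead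
  exact
    { valid := hI.valid.cut hE hw hsrc htgt
      levels := fun i hi him hid => by
        have hlevel := hI.levels i hi him hid
        refine hlevel.mono rfl fun F hF => ?_
        rcases hI.valid.mem_replaceEdge.1 hF with rfl | ⟨-, hF⟩
        · exact Or.inr ((hlevel.edge E hE).cut hid hsrc.le (by omega) w)
        · exact Or.inl hF
      top := hI.top
      full := fun v hv hne hvu b => (hout v b).2 (hI.full v hv hne hvu b)
      root_out := hI.root_out.imp fun b => (hout [] b).2
      root_essential := fun hroot => hI.root_essential fun b => (hout [] b).1 (hroot b)
      sinks_ne := hI.sinks_ne }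

lemma addsOut (hI : LoopInvariantExcept f m d u h) (hadd : AddsOut f m u B h h')
    (hfull : h'.S.Full u) (hess : u = [] → Essential f m []) :
    LoopInvariantExcept f m d [] h' where
  valid := hadd.consistent.valid
  levels i hi him hid := by
    rcases le_or_gt i u.length with hle | hlt
    · exact hadd.grows.levelOK hadd.consistent.valid hle (hI.levels i hi him hid)
    · exact hadd.consistent.levels i hlt him
  top := hadd.consistent.top
  full v hv hne _ := by
    rcases hadd.full_new v hv with hv | hv
    · rcases eq_or_ne v u with rfl | hvu
      · exact hfull
      · exact hadd.grows.full (hI.full v hv hne hvu)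
    · exact hv
  root_out := hI.root_out.imp fun _ => hadd.grows.hasOut
  root_essential hroot := by
    rcases eq_or_ne u [] with hu | hu
    · exact hess hu
    · exact hI.root_essential fun b => (hadd.grows.of_hasOut hI.valid.root_mem
        (hroot b)).resolve_right fun hnew => hu hnew.1.symm
  sinks_ne hnil := hI.sinks_ne (List.subset_nil.1 (hnil ▸ hadd.grows.sinks_sub))

end LoopInvariantExcept

end LoopInvariant

section Divert

variable {L : Type} [DecidableEq L] {f : Str → L} {m d : ℕ} {v t : Str} {F : Edge} {h h' : Hyp L}

lemma LoopInvariantExcept.divert (hI : LoopInvariantExcept f m d [] h) (hF : F ∈ h.S.edges)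
    (hd : F.tgt.length = d) (hdm : d < m) :
    LoopInvariantExcept f m d (F.src ++ F.lab) (h.divert F) := by
  have hlen := hI.valid.length_eq F hF
  have hpos := List.length_pos_iff.2 (hI.valid.lab_ne F hF)
  obtain rfl : (F.src ++ F.lab).length = d := by rw [List.length_append]; omega
  have hcut := (hI.addInner hdm).cut (w := F.src ++ F.lab) (E := F) hF
    (by rw [Hyp.mapS, nodeSet_addInner]; exact Finset.mem_insert_self _ _)
    (by rw [List.length_append]; omega) hd.ge
  rwa [Edge.cut_of_length_le (by rw [List.length_append])] at hcut

lemma exists_addsOut_divert (hI : LoopInvariantExcept f m d [] h) (hF : F ∈ h.S.edges)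
    (hd : F.tgt.length = d) (hdm : d < m) (hnew : F.src ++ F.lab ∉ h.S.nodeSet)
    (ht : m ≤ d + t.length) :
    ∃ h₁ h₂ c₁ c₂, Yields f (addEdge m (F.src ++ F.lab) t (h.divert F)) h₁ c₁ ∧
      Yields f (addEdge m (F.src ++ F.lab) (flip t) h₁) h₂ c₂ ∧
      AddsOut f m (F.src ++ F.lab) Set.univ (h.divert F) h₂ ∧
      c₁ + c₂ + (h.S.weight + 2 * h.S.edges.length) ≤ h₂.S.weight := by
  have hlen : (F.src ++ F.lab).length = d := by
    rw [List.length_append, hI.valid.length_eq F hF, hd]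
  have hweight : (h.divert F).S.weight = h.S.weight + 2 * h.S.edges.length :=
    weight_of_nodeSet_insert (nodeSet_addInner h.S _) hnew (length_replaceEdge hF)
  rw [← hweight]
  refine exists_addEdge_flip (hlen ▸ (hI.divert hF hd hdm).consistentAbove) List.mem_cons_self
    (hlen ▸ ht) ?_
  rintro b ⟨G, hG, hGv, -⟩
  have hmem : F.src ++ F.lab ∈ h.S.inner := by
    rcases hI.valid.mem_edges_divert.1 hG with rfl | ⟨-, hG⟩
    · exact hGv ▸ hI.valid.src_mem F hF
    · exact hGv ▸ hI.valid.src_mem G hG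
  exact hnew (mem_nodeSet.2 (Or.inl hmem))

lemma AddsOut.refinedBy_of_divert (hadd : AddsOut f m v Set.univ (h.divert F) h')
    (hS : h.S.IsValid f m) (hF : F ∈ h.S.edges) : h.S.RefinedBy h'.S := by
  refine RefinedBy.trans ⟨?_, fun b hb => ?_⟩ hadd.grows.refinedBy
  · exact (Finset.subset_insert _ _).trans (nodeSet_addInner h.S (F.src ++ F.lab)).ge
  · obtain ⟨G, hG, hGv, hGb⟩ := hb
    rcases eq_or_ne G F with rfl | hGF
    · exact ⟨_, hS.mem_edges_divert.2 (Or.inl rfl), hGv, hGb⟩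
    · exact ⟨G, hS.mem_edges_divert.2 (Or.inr ⟨hGF, hG⟩), hGv, hGb⟩

lemma AddsOut.mem_nodeSet_of_divert
    (hadd : AddsOut f m v Set.univ (h.divert F) h') : F.src ++ F.lab ∈ h'.S.nodeSet :=
  hadd.grows.nodeSet_subset (mem_nodeSet.2 (Or.inl List.mem_cons_self))

end Divert

/-! ### NodeSplit -/

section NodeSplit

variable {L : Type} [DecidableEq L] {f : Str → L} {m i : ℕ} {p r t u e : Str} {c x : L}
  {ns : Finset Str} {T Te Te' : CTree L} {E F : Edge} {Fs : List Edge} {h h' : Hyp L}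

lemma TreeOK.subst_some (h : TreeOK f m i ns T) (hp : p ∈ ns)
    (hself : Te.label? f p = some (some p))
    (honly : ∀ a u, Te.label? f a = some (some u) → u = p)
    (htests : (T.subst (some p) Te).TestsOfLength (m - i) []) :
    TreeOK f m i ns (T.subst (some p) Te) where
  label?_self v hv := by
    rw [CTree.label?_subst, h.label?_self v hv]
    split_ifs with hvp
    · rw [Option.some.inj (Option.some.inj hvp), hself]
    · rfl
  mem_of_label? a u ha hu := by
    rw [CTree.label?_subst] at hu
    split_ifs at hu with hap
    · rwa [honly a u hu]
    · exact h.mem_of_label? a u ha hu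
  essential hi a ha hne := h.essential hi a ha fun hnone => hne <| by
    rw [CTree.label?_subst, hnone, if_neg (by simp)]
  testsOfLength := htests

/-- The invariant of NodeSplit, which replaces the leaf `p` of the tree `T` by the single-test tree
`Te` with the test string `r`. The edges `Fs` into `p` have not been classified by `Te` yet. -/
structure SplitInvariant (f : Str → L) (m : ℕ) (p r : Str) (T Te : CTree L) (Fs : List Edge)
    (h : Hyp L) : Prop where
  invariant : LoopInvariantExcept f m p.length [] h
  length_lt : p.length < m
  length_eq : r.length = m - p.length
  tree_eq : h.T p.length = T
  testsOfLength : T.TestsOfLength (m - p.length) []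
  isSingleTest : Te.IsSingleTest r
  tree : TreeOK f m p.length (h.S.level p.length) (T.subst (some p) Te)
  edges : ∀ E ∈ h.S.edges, EdgeOK f p.length (T.subst (some p) Te) E ∨ E ∈ Fs
  pending : ∀ F ∈ Fs, F ∈ h.S.edges ∧ F.tgt = p ∧ T.label? f (F.src ++ F.lab) = some (some p)
  nodup : Fs.Nodup

namespace SplitInvariant

lemma retarget (hI : SplitInvariant f m p r T Te (F :: Fs) h)
    (hu : Te.label? f (F.src ++ F.lab) = some (some u)) :
    SplitInvariant f m p r T Te Fs (h.mapS fun S => S.replaceEdge F ⟨F.src, F.lab, u⟩) := by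
  have hvalid := hI.invariant.valid
  obtain ⟨hF, rfl, hFT⟩ := hI.pending F List.mem_cons_self
  have hlen := hvalid.length_eq F hF
  have hpos := List.length_pos_iff.2 (hvalid.lab_ne F hF)
  have hlabel : (T.subst (some F.tgt) Te).label? f (F.src ++ F.lab) = some (some u) := by
    rw [CTree.label?_subst, if_pos hFT, hu]
  obtain ⟨hu_mem, hu_len⟩ := mem_level.1 <|
    hI.tree.mem_of_label? _ u (by rw [List.length_append, hlen]) hlabel
  obtain ⟨hF_notMem, hnodup⟩ := List.nodup_cons.1 hI.nodup
  refine { hI with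
    invariant := ?_
    edges := fun G hG => ?_
    pending := fun G hG => ?_
    nodup := hnodup }
  · have hcut := (hu_len ▸ hI.invariant).cut hF hu_mem (by omega) hu_len.le
    rwa [Edge.cut_of_length_le (by omega), hu_len] at hcut
  · rcases hvalid.mem_replaceEdge.1 hG with rfl | ⟨hGF, hG⟩
    · exact Or.inl ⟨fun _ => hlabel, fun _ hlt => absurd hlen (ne_of_gt hlt)⟩
    · exact (hI.edges G hG).imp_right fun hG => (List.mem_cons.1 hG).resolve_left hGF
  · obtain ⟨hG', hGp⟩ := hI.pending G (List.mem_cons_of_mem _ hG)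
    exact ⟨hvalid.mem_replaceEdge.2 (Or.inr ⟨fun hGF => hF_notMem (hGF ▸ hG), hG'⟩), hGp⟩

lemma divert (hI : SplitInvariant f m p r T Te (F :: Fs) h) (hTe' : Te'.IsSingleTest r)
    (hgrowth : CTree.IsGrowth f (F.src ++ F.lab) Te Te')
    (hadd : AddsOut f m (F.src ++ F.lab) Set.univ (h.divert F) h') :
    SplitInvariant f m p r T Te' Fs h' := by
  have hvalid := hI.invariant.valid
  have hvalid' := hadd.consistent.valid
  obtain ⟨hF, rfl, hFT⟩ := hI.pending F List.mem_cons_self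
  have hlen : (F.src ++ F.lab).length = F.tgt.length := by
    rw [List.length_append, hvalid.length_eq F hF]
  have hgrows := hadd.grows
  rw [hlen] at hgrows
  have hgrowth' : CTree.IsGrowth f (F.src ++ F.lab) (T.subst (some F.tgt) Te)
      (T.subst (some F.tgt) Te') := hgrowth.subst hFT
  have hlevel : h'.S.level F.tgt.length = insert (F.src ++ F.lab) (h.S.level F.tgt.length) := by
    rw [hgrows.level_eq _ le_rfl, ← hlen]
    exact level_of_nodeSet_insert (nodeSet_addInner h.S _)
  obtain ⟨hF_notMem, hnodup⟩ := List.nodup_cons.1 hI.nodup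
  exact
    { invariant := (hI.invariant.divert hF rfl hI.length_lt).addsOut hadd
        (fun b => hadd.out b trivial) (fun hnil => absurd hnil (by simp [hvalid.lab_ne F hF]))
      length_lt := hI.length_lt
      length_eq := hI.length_eq
      tree_eq := (hgrows.tree_eq _ le_rfl).trans hI.tree_eq
      testsOfLength := hI.testsOfLength
      isSingleTest := hTe'
      tree := by
        rw [hlevel]
        exact hI.tree.of_isGrowth hgrowth'
          (hTe'.testsOfLength_subst hI.length_eq hI.testsOfLength _)
      edges := fun G hG => by
        rcases hgrows.mem_or_le_length hG with hG' | hle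
        · rcases hvalid.mem_edges_divert.1 hG' with rfl | ⟨hGF, hG'⟩
          · exact Or.inl ⟨fun _ => hgrowth'.label?_self,
              fun _ hlt => absurd (hvalid.length_eq F hF) (ne_of_gt hlt)⟩
          · exact (hI.edges G hG').imp (·.of_isGrowth hgrowth')
              fun hG => (List.mem_cons.1 hG).resolve_left hGF
        · exact Or.inl (EdgeOK.of_le_src _ hle (hvalid'.lab_ne G hG))
      pending := fun G hG => by
        obtain ⟨hG', hGp⟩ := hI.pending G (List.mem_cons_of_mem _ hG)
        exact ⟨hgrows.mem_edges <|
          hvalid.mem_edges_divert.2 (Or.inr ⟨fun hGF => hF_notMem (hGF ▸ hG), hG'⟩), hGp⟩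
      nodup := hnodup }

lemma notMem_nodeSet (hI : SplitInvariant f m p r T Te (F :: Fs) h)
    (hlabel : Te.label? f (F.src ++ F.lab) ≠ some (some (F.src ++ F.lab))) :
    F.src ++ F.lab ∉ h.S.nodeSet := by
  intro hmem
  obtain ⟨hF, rfl, hFT⟩ := hI.pending F List.mem_cons_self
  have hlen := hI.invariant.valid.length_eq F hF
  have hself := hI.tree.label?_self _ (mem_level.2 ⟨hmem, by rw [List.length_append, hlen]⟩)
  rw [CTree.label?_subst, if_pos hFT] at hself
  exact hlabel hself

lemma exists_divert (hI : SplitInvariant f m p r T Te (F :: Fs) h) (hTe' : Te'.IsSingleTest r)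
    (hstuck : Te.label? f (F.src ++ F.lab) ≠ some (some (F.src ++ F.lab)))
    (hgrowth : CTree.IsGrowth f (F.src ++ F.lab) Te Te') (ht : m ≤ p.length + t.length) :
    ∃ h₁ h₂ c₁ c₂, Yields f (addEdge m (F.src ++ F.lab) t (h.divert F)) h₁ c₁ ∧
      Yields f (addEdge m (F.src ++ F.lab) (flip t) h₁) h₂ c₂ ∧
      AddsOut f m (F.src ++ F.lab) Set.univ (h.divert F) h₂ ∧
      SplitInvariant f m p r T Te' Fs h₂ ∧ h.S.RefinedBy h₂.S ∧
      c₁ + c₂ + (h.S.weight + 2 * h.S.edges.length) ≤ h₂.S.weight := by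
  obtain ⟨hF, hFp, -⟩ := hI.pending F List.mem_cons_self
  obtain ⟨h₁, h₂, c₁, c₂, hy₁, hy₂, hadd, hweight⟩ := exists_addsOut_divert hI.invariant hF
    (congrArg List.length hFp) hI.length_lt (hI.notMem_nodeSet hstuck) ht
  exact ⟨h₁, h₂, c₁, c₂, hy₁, hy₂, hadd, hI.divert hTe' hgrowth hadd,
    hadd.refinedBy_of_divert hI.invariant.valid hF, hweight⟩

lemma loopInvariant (hI : SplitInvariant f m p r T Te [] h)
    (hcost : ∀ a, T.cost f a + 1 ≤ 2 * (h.S.level p.length).card) :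
    LoopInvariant f m (h.setTree p.length (T.subst (some p) Te)) := by
  refine hI.invariant.setTree hI.length_lt
    ⟨hI.tree, fun E hE => (hI.edges E hE).resolve_right List.not_mem_nil, fun a => ?_⟩
  have hTe := hI.isSingleTest.cost_le_one f a
  have hT := hcost a
  rw [CTree.cost_subst]
  split_ifs <;> omega

end SplitInvariant

theorem exists_splitLoop (ht : m ≤ p.length + t.length) (Fs : List Edge) {h : Hyp L}
    {Te : CTree L} (hI : SplitInvariant f m p r T Te Fs h) :
    ∃ h' Te' c, Yields f (splitLoop m t Fs h Te) (h', Te') c ∧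
      SplitInvariant f m p r T Te' [] h' ∧ h.S.RefinedBy h'.S ∧
      c + h.S.weight ≤ h'.S.weight + Fs.length := by
  induction Fs generalizing h Te with
  | nil => exact ⟨h, Te, 0, Yields.pure _, hI, .refl _, by simp⟩
  | cons F Fs ih =>
    have hclassify := CTree.yields_classify f (F.src ++ F.lab) Te
    have hcost := hI.isSingleTest.cost_le_one f (F.src ++ F.lab)
    rcases hlabel : Te.label? f (F.src ++ F.lab) with _ | _ | u
    · rw [CTree.result_of_stuck hlabel] at hclassify
      obtain ⟨h₁, h₂, c₁, c₂, hy₁, hy₂, -, hI₂, href₂, hweight₂⟩ :=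
        hI.exists_divert (hI.isSingleTest.grow f _) (by simp [hlabel])
          (CTree.isGrowth_grow hlabel) ht
      obtain ⟨h₃, Te₃, c₃, hy₃, hI₃, href₃, hweight₃⟩ := ih hI₂
      refine ⟨h₃, Te₃, _, hclassify.bind (hy₁.bind (hy₂.bind hy₃)), hI₃, href₂.trans href₃, ?_⟩
      rw [List.length_cons]
      omega
    · exact absurd hlabel (hI.isSingleTest.label?_ne f _)
    · rw [CTree.result_of_label? hlabel] at hclassify
      obtain ⟨hF, -⟩ := hI.pending F List.mem_cons_self
      obtain ⟨h₃, Te₃, c₃, hy₃, hI₃, href₃, hweight₃⟩ := ih (hI.retarget hlabel)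
      have hweight : (h.mapS fun S => S.replaceEdge F ⟨F.src, F.lab, u⟩).S.weight =
          h.S.weight := congrArg (2 * · * h.S.nodeSet.card) (length_replaceEdge hF)
      have href : h.S.RefinedBy (h.S.replaceEdge F ⟨F.src, F.lab, u⟩) :=
        ⟨subset_rfl, fun b => (hI.invariant.valid.hasOut_replaceEdge
          (E' := ⟨F.src, F.lab, u⟩) hF rfl rfl [] b).2⟩
      refine ⟨h₃, Te₃, _, hclassify.bind hy₃, hI₃, href.trans href₃, ?_⟩
      rw [List.length_cons]
      omega

lemma SplitInvariant.of_loopInvariant (hI : LoopInvariant f m h) (hp : p ∈ h.S.nodeSet)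
    (hp_pos : 0 < p.length) (hp_lt : p.length < m) (hr : r.length = m - p.length)
    (hTe : Te.IsSingleTest r) (hself : Te.label? f p = some (some p))
    (honly : ∀ a u, Te.label? f a = some (some u) → u = p)
    (hFs : ∀ F, F ∈ Fs ↔ F ∈ h.S.edges ∧ F.tgt = p) (hnodup : Fs.Nodup) :
    SplitInvariant f m p r (h.T p.length) Te Fs h := by
  have hlevel := hI.levels p.length hp_pos hp_lt.le hp_pos.ne'
  exact
    { invariant := .except hI p.length
      length_lt := hp_lt
      length_eq := hr
      tree_eq := rfl
      testsOfLength := hlevel.tree.testsOfLength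
      isSingleTest := hTe
      tree := hlevel.tree.subst_some (mem_level.2 ⟨hp, rfl⟩) hself honly
        (hTe.testsOfLength_subst hr hlevel.tree.testsOfLength p)
      edges := fun G hG => by
        refine or_iff_not_imp_right.2 fun hG' => ⟨fun hland => ?_, fun hlt hgt => ?_⟩
        · rw [CTree.label?_subst, (hlevel.edge G hG).land hland,
            if_neg fun heq => hG' ((hFs G).2 ⟨hG, Option.some.inj (Option.some.inj heq)⟩)]
        · rw [CTree.label?_subst, (hlevel.edge G hG).cross hlt hgt, if_neg (by simp)]
      pending := fun F hF => by
        obtain ⟨hF, rfl⟩ := (hFs F).1 hF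
        exact ⟨hF, rfl, (hlevel.edge F hF).land (hI.valid.length_eq F hF)⟩
      nodup := hnodup }

lemma AddsOut.filter_tgt_eq {B : Set Bool}
    (hadd : AddsOut f m (F.src ++ F.lab) B (h.divert F) h')
    (hlen : (F.src ++ F.lab).length = F.tgt.length) (hne : F.src ++ F.lab ≠ F.tgt) :
    h'.S.edges.filter (fun G => G.tgt = F.tgt) =
      (h.S.edges.erase F).filter fun G => G.tgt = F.tgt := by
  obtain ⟨new, hnew, hsrc⟩ := hadd.grows.edges
  have hnew_tgt : ∀ G ∈ new, G.tgt ≠ F.tgt := by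
    intro G hG htgt
    have hG' : G ∈ h'.S.edges := hnew ▸ List.mem_append_left _ hG
    have hlenG := hadd.consistent.valid.length_eq G hG'
    have hpos := List.length_pos_iff.2 (hadd.consistent.valid.lab_ne G hG')
    have hle := (hsrc G hG).1
    rw [htgt] at hlenG
    omega
  rw [hnew, List.filter_append, List.filter_eq_nil_iff.2 (by simpa using hnew_tgt)]
  exact List.filter_cons_of_neg (p := fun G : Edge => decide (G.tgt = F.tgt)) (by simpa using hne)

/-- The tree that separates `p` from `v` by a test for `r`, with the values `c` and `x`. -/
def splitTree (r p v : Str) (c x : L) : CTree L :=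
  .single r [c, x] fun l => if l = c then .leaf (some p) else .leaf (some v)

lemma isSingleTest_splitTree (r p v : Str) (c x : L) : (splitTree r p v c x).IsSingleTest r :=
  ⟨_, _, rfl, fun l _ => by split_ifs <;> exact ⟨_, rfl⟩⟩

lemma isGrowth_splitTree {v : Str} (hx : f (v ++ r) = x) (hxc : x ≠ c) (p : Str) :
    CTree.IsGrowth f v (.single r [c] fun _ => .leaf (some p)) (splitTree r p v c x) where
  label?_self := by simp [splitTree, CTree.label?, hx, hxc]
  label?_eq b := by
    simp only [splitTree, CTree.label?, List.mem_cons, List.not_mem_nil, or_false]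
    grind [CTree.label?]

lemma LoopInvariantExcept.length_tgt_lt (hI : LoopInvariant f m h) (hE : E ∈ h.S.edges)
    (hr : r.length = m - E.tgt.length)
    (hne : f (E.src ++ E.lab ++ r) ≠ f (E.tgt ++ r)) : E.tgt.length < m := by
  have hlen := hI.valid.length_eq E hE
  have hpos := List.length_pos_iff.2 (hI.valid.lab_ne E hE)
  have htm := hI.valid.length_le (hI.valid.tgt_mem E hE)
  refine lt_of_le_of_ne htm fun heq => hne ?_
  have hland := ((hI.levels E.tgt.length (by omega) htm (by omega)).edge E hE).land hlen
  obtain ⟨u, hu, hfu⟩ := hI.top.eq_of_label? (heq ▸ hland)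
  obtain rfl : r = [] := List.eq_nil_of_length_eq_zero (by omega)
  rw [List.append_nil, List.append_nil, ← hfu, Option.some.inj hu]

lemma SplitInvariant.start (hI : LoopInvariant f m h) (hE : E ∈ h.S.edges)
    (hr : r.length = m - E.tgt.length)
    (hne : f (E.src ++ E.lab ++ r) ≠ f (E.tgt ++ r)) :
    SplitInvariant f m E.tgt r (h.T E.tgt.length)
      (.single r [f (E.tgt ++ r)] fun _ => .leaf (some E.tgt))
      (E :: (h.S.edges.erase E).filter fun F => F.tgt = E.tgt) h := by
  have hlen := hI.valid.length_eq E hE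
  have hpos := List.length_pos_iff.2 (hI.valid.lab_ne E hE)
  refine .of_loopInvariant hI (hI.valid.tgt_mem E hE) (by omega) (hI.length_tgt_lt hE hr hne) hr
    ⟨_, _, rfl, fun _ _ => ⟨_, rfl⟩⟩ (by simp [CTree.label?]) (fun a u hu => ?_) (fun F => ?_)
    (List.nodup_cons.2 ⟨fun hmem => hI.valid.nodup.not_mem_erase (List.mem_of_mem_filter hmem),
      (hI.valid.nodup.erase E).filter _⟩)
  · simp only [CTree.label?] at hu
    grind
  · have herase := hI.valid.nodup.mem_erase_iff (a := F) (b := E)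
    grind

lemma LevelOK.exists_lastTwin {S : OMTBDDAS L} {i : ℕ} {T : CTree L} (hT : LevelOK f m S i T)
    (hE : E ∈ S.edges) (hi : E.src.length + E.lab.length = i) :
    ∃ t, T.lastTwin E.tgt [] = some t ∧ t.length = m - i := by
  obtain ⟨t, ht⟩ := Option.isSome_iff_exists.1
    (CTree.isSome_lastTwin [] ((hT.edge E hE).land hi))
  exact ⟨t, ht, hT.tree.testsOfLength.length_lastTwin ht⟩

lemma CTree.label?_single_leaf_ne (f : Str → L) (r : Str) (dom : List L) {p v : Str}
    (hvp : v ≠ p) :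
    CTree.label? f v (.single r dom fun _ => .leaf (some p)) ≠ some (some v) := by
  simp only [CTree.label?]
  split_ifs <;> simp [hvp.symm]

theorem exists_nodeSplit (hI : LoopInvariant f m h) (he : e.length = m) (hE : E ∈ h.S.edges)
    (hc : f (E.tgt ++ e.drop E.tgt.length) = c)
    (hx : f (E.src ++ E.lab ++ e.drop E.tgt.length) = x) (hxc : x ≠ c) :
    ∃ h' q, Yields f (nodeSplit m h e E c x) h' q ∧ LoopInvariant f m h' ∧
      h.S.progress < h'.S.progress ∧ q + h.S.weight ≤ h'.S.weight := by
  have hlen := hI.valid.length_eq E hE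
  have hpos := List.length_pos_iff.2 (hI.valid.lab_ne E hE)
  have hvlen : (E.src ++ E.lab).length = E.tgt.length := by rw [List.length_append, hlen]
  have hvE : E.src ++ E.lab ≠ E.tgt := fun heq => hxc (by rw [← hx, ← hc, heq])
  have hlevel := hI.levels E.tgt.length (by omega)
    (hI.valid.length_le (hI.valid.tgt_mem E hE)) (by omega)
  obtain ⟨t, ht, htlen⟩ := hlevel.exists_lastTwin hE hlen
  have hstart := SplitInvariant.start hI hE (by rw [List.length_drop, he]) (hx ▸ hc ▸ hxc)
  rw [hc] at hstart
  have hstuck := CTree.label?_single_leaf_ne f (e.drop E.tgt.length) [c] hvE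
  obtain ⟨h₁, h₂, c₁, c₂, hy₁, hy₂, hadd, hI₂, href₂, hweight₂⟩ :=
    hstart.exists_divert (t := t) (isSingleTest_splitTree _ _ _ c x) hstuck
      (isGrowth_splitTree hx hxc _) (by omega)
  rw [← hadd.filter_tgt_eq hvlen hvE] at hI₂
  obtain ⟨h₃, Te, c₃, hy₃, hI₃, href₃, hweight₃⟩ := exists_splitLoop (t := t) (by omega) _ hI₂
  have hv : E.src ++ E.lab ∈ h₃.S.nodeSet :=
    href₃.nodeSet_subset hadd.mem_nodeSet_of_divert
  have hv' : E.src ++ E.lab ∉ h.S.nodeSet := hstart.notMem_nodeSet hstuck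
  have href := href₂.trans href₃
  refine ⟨h₃.setTree (E.src ++ E.lab).length
    ((h₃.T (E.src ++ E.lab).length).subst (some E.tgt) Te), c₁ + (c₂ + (c₃ + 0)), ?_, ?_,
    href.progress_lt_of_notMem hv hv', ?_⟩
  · have ht' : (((h.divert E).T (E.src ++ E.lab).length).lastTwin E.tgt []).getD [] = t := by
      rw [hvlen]
      exact congrArg (Option.getD · []) ht
    rw [← ht'] at hy₁ hy₂ hy₃
    unfold nodeSplit
    exact hy₁.bind (hy₂.bind (hy₃.bind (Yields.pure _)))
  · rw [hvlen, hI₃.tree_eq]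
    refine hI₃.loopInvariant fun a => ?_
    have hcard := hvlen ▸ href.card_level_lt hv hv'
    have hcost := hlevel.cost_le a
    omega
  · have hle : (h₂.S.edges.filter fun G => G.tgt = E.tgt).length ≤ h.S.edges.length := by
      rw [hadd.filter_tgt_eq hvlen hvE]
      exact (List.length_filter_le _ _).trans (List.length_erase_le ..)
    change _ ≤ h₃.S.weight
    omega

end NodeSplit

/-! ### NewBranchingNode -/

/-- The point on the edge `E` that is reached after `k` bits. -/
def Edge.point (E : Edge) (k : ℕ) : Str := E.src ++ E.lab.take k

lemma Edge.length_point {E : Edge} {k : ℕ} (hk : k ≤ E.lab.length) :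
    (E.point k).length = E.src.length + k := by
  rw [Edge.point, List.length_append, List.length_take, min_eq_left hk]

lemma Edge.point_zero (E : Edge) : E.point 0 = E.src := by
  rw [Edge.point, List.take_zero, List.append_nil]

lemma Edge.point_succ {E : Edge} {k : ℕ} (hk : k < E.lab.length) :
    E.point (k + 1) = E.point k ++ [E.lab[k]] := by
  rw [Edge.point, Edge.point, ← List.take_append_getElem hk, List.append_assoc]

section TwinTest

variable {L : Type} {f : Str → L} {m d k : ℕ} {v r e : Str} {z c y : L} {E : Edge}

/-- The twin test with the string `r` and the outcome `(z, c)`, which proves `v` essential. -/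
structure IsTwinTest (f : Str → L) (m : ℕ) (v r : Str) (z c : L) : Prop where
  ne_nil : r ≠ []
  length_eq : v.length + r.length = m
  fst_eq : f (v ++ r) = z
  snd_eq : f (v ++ flip r) = c
  ne : z ≠ c

lemma IsTwinTest.essential (h : IsTwinTest f m v r z c) : Essential f m v :=
  ⟨r, h.ne_nil, h.length_eq, by rw [h.fst_eq, h.snd_eq]; exact h.ne⟩

lemma exists_head?_eq_of_ne {a : Bool} (hr : r ≠ []) (hne : f (v ++ r) ≠ f (v ++ a :: r.tail)) :
    ∃ b, r.head? = some b ∧ a = !b ∧ a :: r.tail = flip r := by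
  obtain ⟨b, r, rfl⟩ := List.exists_cons_of_ne_nil hr
  obtain rfl : a = !b := Bool.eq_not_of_ne fun hab => hne (by rw [hab, List.tail_cons])
  exact ⟨b, rfl, rfl, rfl⟩

lemma src_append_cro_append (he : E.tgt.length ≤ e.length)
    (hlen : E.src.length + E.lab.length = E.tgt.length) (hk : k ≤ E.lab.length) :
    E.src ++ cro E.lab ((e.drop E.src.length).take E.lab.length) (E.lab.length - k) ++
      e.drop E.tgt.length = E.point k ++ e.drop (E.point k).length := by
  have htake : ((e.drop E.src.length).take E.lab.length).length = E.lab.length := by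
    rw [List.length_take, List.length_drop]
    omega
  have hsplit : (e.drop E.src.length).take E.lab.length ++ e.drop E.tgt.length =
      e.drop E.src.length := by
    rw [← hlen, ← List.drop_drop, List.take_append_drop]
  rw [cro, htake, Nat.sub_sub_self hk, ← List.append_assoc, ← Edge.point, List.append_assoc,
    ← List.drop_append_of_le_length (hk.trans htake.ge), hsplit, List.drop_drop,
    Edge.length_point hk]

lemma exists_isTwinTest_point (he : e.length = m) (hk : k < E.lab.length)
    (hm : E.src.length + E.lab.length ≤ m)
    (hz : f (E.point k ++ e.drop (E.point k).length) = z)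
    (hc : f (E.point (k + 1) ++ e.drop (E.point (k + 1)).length) = c) (hzc : z ≠ c) :
    IsTwinTest f m (E.point k) (e.drop (E.point k).length) z c ∧
      ∃ b, (e.drop (E.point k).length).head? = some b ∧ (E.lab.drop k).head? = some (!b) := by
  have hlen := Edge.length_point hk.le
  have hne : e.drop (E.point k).length ≠ [] := by
    rw [Ne, List.drop_eq_nil_iff]
    omega
  rw [Edge.length_point hk, Nat.succ_eq_add_one, ← add_assoc, ← hlen, ← List.tail_drop,
    Edge.point_succ hk, List.append_assoc, List.singleton_append] at hc
  obtain ⟨b, hb, hlab, hflip⟩ := exists_head?_eq_of_ne hne (hz.trans_ne (hc ▸ hzc))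
  refine ⟨⟨hne, ?_, hz, hflip ▸ hc, hzc⟩, b, hb, ?_⟩
  · rw [List.length_drop]
    omega
  · rw [List.drop_eq_getElem_cons hk, List.head?_cons, hlab]

lemma exists_bsearch_isTwinTest [DecidableEq L] (he : e.length = m)
    (hlen : E.src.length + E.lab.length = E.tgt.length) (htgt : E.tgt.length ≤ m)
    (hlab : E.lab ≠ []) (hc : f (E.src ++ E.lab ++ e.drop E.tgt.length) = c)
    (hy : f (E.src ++ e.drop E.src.length) = y) (hyc : y ≠ c) :
    ∃ k z q, k < E.lab.length ∧ q ≤ Nat.clog 2 m ∧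
      Yields f (bsearch (fun j => ask (E.src ++
        cro E.lab ((e.drop E.src.length).take E.lab.length) j ++ e.drop E.tgt.length))
        c E.lab.length 0 E.lab.length y) (E.lab.length - k, z) q ∧
      IsTwinTest f m (E.point k) (e.drop (E.point k).length) z c ∧
      ∃ b, (e.drop (E.point k).length).head? = some b ∧ (E.lab.drop k).head? = some (!b) := by
  set g : ℕ → L := fun j => f (E.src ++
    cro E.lab ((e.drop E.src.length).take E.lab.length) j ++ e.drop E.tgt.length)
  have hgk : ∀ k ≤ E.lab.length,
      g (E.lab.length - k) = f (E.point k ++ e.drop (E.point k).length) := fun k hk =>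
    congrArg f (src_append_cro_append (by omega) hlen hk)
  have hg_zero : g 0 = c := by
    rw [← Nat.sub_self E.lab.length, hgk _ le_rfl, Edge.length_point le_rfl, hlen, Edge.point,
      List.take_length, hc]
  have hg_length : g E.lab.length = y := by
    rw [← Nat.sub_zero E.lab.length, hgk 0 (Nat.zero_le _), Edge.point_zero, hy]
  have hpow : E.lab.length ≤ 0 + 2 ^ Nat.clog 2 m := by
    have := Nat.le_pow_clog one_lt_two m
    omega
  obtain ⟨j, q, hj, hjl, hpred, hne, hq, hyields⟩ :=
    Yields.bsearch (g := g) (phi := fun j => ask (E.src ++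
        cro E.lab ((e.drop E.src.length).take E.lab.length) j ++ e.drop E.tgt.length))
      (c := c) (fun j => Yields.ask _) E.lab.length 0 E.lab.length (Nat.clog 2 m)
      (List.length_pos_iff.2 hlab) (by omega) hpow hg_zero (hg_length.trans_ne hyc)
  obtain ⟨k, hk, rfl⟩ : ∃ k < E.lab.length, j = E.lab.length - k :=
    ⟨E.lab.length - j, by omega, by omega⟩
  rw [hg_length] at hyields
  rw [Nat.sub_sub, hgk (k + 1) hk] at hpred
  exact ⟨k, _, q, hk, hq, hyields,
    exists_isTwinTest_point he hk (hlen.trans_le htgt) (hgk k hk.le).symm hpred hne⟩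

end TwinTest

section NewBranchingNode

variable {L : Type} [DecidableEq L] {f : Str → L} {m i k : ℕ} {v r e : Str} {z c y : L} {b : Bool}
  {ns : Finset Str} {T : CTree L} {E F : Edge} {Fs : List Edge} {h : Hyp L}

/-- The tree by which NewBranchingNode replaces the leaf `μ`, for the new node `v`. -/
def branchTree (v r : Str) (z c : L) : CTree L := .twin r z c (.leaf (some v)) (.leaf none)

lemma label?_branchTree (f : Str → L) (a v r : Str) (z c : L) :
    (branchTree v r z c).label? f a =
      if f (a ++ r) = z ∧ f (a ++ flip r) = c then some (some v) else some none := rfl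

lemma cost_branchTree (f : Str → L) (a v r : Str) (z c : L) :
    (branchTree v r z c).cost f a = 2 := by
  simp [branchTree, CTree.cost]

lemma TreeOK.branch (h : TreeOK f m v.length ns T) (hv : T.label? f v = some none)
    (htest : IsTwinTest f m v r z c) :
    TreeOK f m v.length (insert v ns) (T.subst none (branchTree v r z c)) where
  label?_self u hu := by
    rw [CTree.label?_subst]
    rcases Finset.mem_insert.1 hu with rfl | hu
    · rw [if_pos hv, label?_branchTree, if_pos ⟨htest.fst_eq, htest.snd_eq⟩]
    · rw [h.label?_self u hu, if_neg (by simp)]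
  mem_of_label? a u ha hu := by
    rw [CTree.label?_subst, label?_branchTree] at hu
    split_ifs at hu
    · obtain rfl : v = u := by simpa using hu
      exact Finset.mem_insert_self _ _
    · simp at hu
    · exact Finset.mem_insert_of_mem (h.mem_of_label? a u ha hu)
  essential hm a ha hne := by
    rw [CTree.label?_subst, label?_branchTree] at hne
    split_ifs at hne with hnone hhit
    · have hlen := htest.length_eq
      exact ⟨r, htest.ne_nil, by omega, by rw [hhit.1, hhit.2]; exact htest.ne⟩
    · exact absurd rfl hne
    · exact h.essential hm a ha hne
  testsOfLength := by
    have hr : r.length = m - v.length := Nat.eq_sub_of_add_eq' htest.length_eq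
    exact h.testsOfLength.subst fun _ _ => ⟨hr, hr, trivial⟩

/-- The invariant of the loop of NewBranchingNode for the new node `v`. The edges `Fs` that pass
the level of `v` have not been classified by the new tree yet. -/
structure BranchInvariant (f : Str → L) (m : ℕ) (v r : Str) (z c : L) (Fs : List Edge)
    (h : Hyp L) : Prop where
  invariant : LoopInvariantExcept f m v.length v h
  mem_inner : v ∈ h.S.inner
  tree : TreeOK f m v.length (h.S.level v.length)
    ((h.T v.length).subst none (branchTree v r z c))
  cost_le : ∀ a : Str, (h.T v.length).cost f a + 2 ≤ 2 * (h.S.level v.length).card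
  edges : ∀ E ∈ h.S.edges,
    EdgeOK f v.length ((h.T v.length).subst none (branchTree v r z c)) E ∨ E ∈ Fs
  pending : ∀ F ∈ Fs, F ∈ h.S.edges ∧ F.src.length < v.length ∧ v.length < F.tgt.length ∧
    (h.T v.length).label? f (F.src ++ F.lab.take (v.length - F.src.length)) = some none
  nodup : Fs.Nodup

namespace BranchInvariant

lemma redirect (hI : BranchInvariant f m v r z c (F :: Fs) h)
    (hhit : (branchTree v r z c).label? f (F.src ++ F.lab.take (v.length - F.src.length)) =
      some (some v)) :
    BranchInvariant f m v r z c Fs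
      (h.mapS fun S => S.replaceEdge F (F.cut v.length v)) := by
  have hvalid := hI.invariant.valid
  obtain ⟨hF, hsrc, htgt, hlabel⟩ := hI.pending F List.mem_cons_self
  have hlen := hvalid.length_eq F hF
  obtain ⟨hF_notMem, hnodup⟩ := List.nodup_cons.1 hI.nodup
  refine { hI with
    invariant := hI.invariant.cut hF (mem_nodeSet.2 (Or.inl hI.mem_inner)) hsrc htgt.le
    edges := fun G hG => ?_
    pending := fun G hG => ?_
    nodup := hnodup }
  · rcases hvalid.mem_replaceEdge.1 hG with rfl | ⟨hGF, hG⟩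
    · refine Or.inl ⟨fun _ => ?_, fun _ hlt => ?_⟩
      · exact (CTree.label?_subst ..).trans ((if_pos hlabel).trans hhit)
      · simp only [Edge.cut, List.length_take] at hlt
        omega
    · exact (hI.edges G hG).imp_right fun hG => (List.mem_cons.1 hG).resolve_left hGF
  · obtain ⟨hG', hGv⟩ := hI.pending G (List.mem_cons_of_mem _ hG)
    exact ⟨hvalid.mem_replaceEdge.2 (Or.inr ⟨fun hGF => hF_notMem (hGF ▸ hG), hG'⟩), hGv⟩

lemma skip (hI : BranchInvariant f m v r z c (F :: Fs) h)
    (hmiss : (branchTree v r z c).label? f (F.src ++ F.lab.take (v.length - F.src.length)) =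
      some none) :
    BranchInvariant f m v r z c Fs h := by
  obtain ⟨hF, hsrc, htgt, hlabel⟩ := hI.pending F List.mem_cons_self
  have hlen := hI.invariant.valid.length_eq F hF
  refine { hI with
    edges := fun G hG => ?_
    pending := fun G hG => hI.pending G (List.mem_cons_of_mem _ hG)
    nodup := (List.nodup_cons.1 hI.nodup).2 }
  rcases eq_or_ne G F with rfl | hGF
  · refine Or.inl ⟨fun hland => by omega, fun _ _ => ?_⟩
    rw [CTree.label?_subst, if_pos hlabel, hmiss]
  · exact (hI.edges G hG).imp_right fun hG => (List.mem_cons.1 hG).resolve_left hGF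

lemma setTree (hI : BranchInvariant f m v r z c [] h) :
    LoopInvariantExcept f m 0 v
      (h.setTree v.length ((h.T v.length).subst none (branchTree v r z c))) := by
  refine hI.invariant.setTree (hI.invariant.valid.inner_lt v hI.mem_inner)
    ⟨hI.tree, fun E hE => (hI.edges E hE).resolve_right List.not_mem_nil, fun a => ?_⟩
  have hcost := hI.cost_le a
  rw [CTree.cost_subst, cost_branchTree]
  split_ifs <;> omega

end BranchInvariant

lemma exists_branchLoop (Fs : List Edge) {h : Hyp L} (hI : BranchInvariant f m v r z c Fs h) :
    ∃ h' q, Yields f (branchLoop v (branchTree v r z c) Fs h) h' q ∧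
      BranchInvariant f m v r z c [] h' ∧ h'.S.nodeSet = h.S.nodeSet ∧
      (∀ u b, h'.S.HasOut u b ↔ h.S.HasOut u b) ∧ h'.S.weight = h.S.weight ∧
      q ≤ 2 * Fs.length := by
  induction Fs generalizing h with
  | nil => exact ⟨h, 0, Yields.pure _, hI, rfl, fun _ _ => Iff.rfl, rfl, le_rfl⟩
  | cons F Fs ih =>
    have hclassify := CTree.yields_classify f (F.src ++ F.lab.take (v.length - F.src.length))
      (branchTree v r z c)
    rw [cost_branchTree] at hclassify
    by_cases hhit : (branchTree v r z c).label? f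
        (F.src ++ F.lab.take (v.length - F.src.length)) = some (some v)
    · obtain ⟨hF, hsrc, -⟩ := hI.pending F List.mem_cons_self
      rw [CTree.result_of_label? hhit] at hclassify
      obtain ⟨h', q, hyields, hI', hnodes, hout, hweight, hq⟩ := ih (hI.redirect hhit)
      have hhead : (F.cut v.length v).lab.head? = F.lab.head? := by
        rw [Edge.cut, List.head?_take, if_neg (by omega)]
      have hout_cut := hI.invariant.valid.hasOut_replaceEdge (E' := F.cut v.length v) hF rfl hhead
      refine ⟨h', 2 + q, hclassify.bind hyields, hI', hnodes, fun u b =>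
        (hout u b).trans (hout_cut u b), hweight.trans
        (congrArg (2 * · * h.S.nodeSet.card) (length_replaceEdge hF)), ?_⟩
      rw [List.length_cons]
      omega
    · have hmiss : (branchTree v r z c).label? f
          (F.src ++ F.lab.take (v.length - F.src.length)) = some none := by
        rw [label?_branchTree] at hhit ⊢
        exact if_neg fun hif => hhit (if_pos hif)
      rw [CTree.result_of_label? hmiss] at hclassify
      obtain ⟨h', q, hyields, hI', hnodes, hout, hweight, hq⟩ := ih (hI.skip hmiss)
      refine ⟨h', 2 + q, hclassify.bind hyields, hI', hnodes, hout, hweight, ?_⟩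
      rw [List.length_cons]
      omega

end NewBranchingNode

section SplitEdge

variable {L : Type} {f : Str → L} {m k : ℕ} {u v : Str} {b : Bool} {E F : Edge} {h : Hyp L}

/-- A new node is inserted into the edge `E` after `k` bits. -/
def Hyp.splitEdge (h : Hyp L) (E : Edge) (k : ℕ) : Hyp L :=
  h.mapS fun S => ((S.addInner (E.point k)).replaceEdge E ⟨E.src, E.lab.take k, E.point k⟩).addEdge
    ⟨E.point k, E.lab.drop k, E.tgt⟩

lemma cut_point (hk : k ≤ E.lab.length) :
    E.cut (E.point k).length (E.point k) = ⟨E.src, E.lab.take k, E.point k⟩ := by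
  rw [Edge.cut, Edge.length_point hk, Nat.add_sub_cancel_left]

lemma OMTBDDAS.IsValid.mem_edges_splitEdge (hS : h.S.IsValid f m) :
    F ∈ (h.splitEdge E k).S.edges ↔ F = ⟨E.point k, E.lab.drop k, E.tgt⟩ ∨
      F = ⟨E.src, E.lab.take k, E.point k⟩ ∨ (F ≠ E ∧ F ∈ h.S.edges) := by
  simp [Hyp.splitEdge, Hyp.mapS, OMTBDDAS.addEdge, OMTBDDAS.addInner, OMTBDDAS.replaceEdge,
    hS.nodup.mem_erase_iff]

lemma OMTBDDAS.IsValid.hasOut_splitEdge (hS : h.S.IsValid f m) (hE : E ∈ h.S.edges) (hk : 0 < k)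
    (hout : h.S.HasOut u b) : (h.splitEdge E k).S.HasOut u b := by
  obtain ⟨F, hF, hFu, hFb⟩ := hout
  rcases eq_or_ne F E with rfl | hFE
  · refine ⟨_, hS.mem_edges_splitEdge.2 (Or.inr (Or.inl rfl)), hFu, ?_⟩
    rwa [List.head?_take, if_neg hk.ne']
  · exact ⟨F, hS.mem_edges_splitEdge.2 (Or.inr (Or.inr ⟨hFE, hF⟩)), hFu, hFb⟩

lemma OMTBDDAS.IsValid.hasOut_splitEdge_point (hS : h.S.IsValid f m) (hE : E ∈ h.S.edges)
    (hv : E.point k ∉ h.S.inner) :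
    (h.splitEdge E k).S.HasOut (E.point k) b ↔ (E.lab.drop k).head? = some b := by
  refine ⟨fun ⟨F, hF, hFv, hFb⟩ => ?_, fun hb => ⟨_, List.mem_cons_self, rfl, hb⟩⟩
  rcases hS.mem_edges_splitEdge.1 hF with rfl | rfl | ⟨-, hF⟩
  · exact hFb
  · exact absurd (hFv ▸ hS.src_mem E hE) hv
  · exact absurd (hFv ▸ hS.src_mem F hF) hv

lemma OMTBDDAS.IsValid.refinedBy_splitEdge (hS : h.S.IsValid f m) (hE : E ∈ h.S.edges)
    (hk : 0 < k) : h.S.RefinedBy (h.splitEdge E k).S where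
  nodeSet_subset := (Finset.subset_insert _ _).trans (nodeSet_addInner h.S (E.point k)).ge
  root_hasOut _ := hS.hasOut_splitEdge hE hk

lemma length_edges_splitEdge (hE : E ∈ h.S.edges) (k : ℕ) :
    (h.splitEdge E k).S.edges.length = h.S.edges.length + 1 :=
  congrArg (· + 1) (length_replaceEdge (S := h.S) hE)

lemma weight_splitEdge (hE : E ∈ h.S.edges) (hv : E.point k ∉ h.S.nodeSet) :
    h.S.weight + 2 * (h.S.edges.length + 1) ≤ (h.splitEdge E k).S.weight := by
  have hnodes : (h.splitEdge E k).S.nodeSet = insert (E.point k) h.S.nodeSet :=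
    nodeSet_addInner h.S _
  rw [weight, weight, hnodes, length_edges_splitEdge hE, Finset.card_insert_of_notMem hv]
  linarith

lemma full_of_hasOut_not {S : OMTBDDAS L} (hb : S.HasOut v b) (hb' : S.HasOut v (!b)) :
    S.Full v := by
  intro b'
  rcases eq_or_ne b' b with rfl | hne
  · exact hb
  · exact Bool.eq_not_of_ne hne ▸ hb'

end SplitEdge

section NewBranchingNode

variable {L : Type} [DecidableEq L] {f : Str → L} {m i k : ℕ} {u r e : Str} {z c y : L}
  {b : Bool} {T : CTree L} {E : Edge} {h : Hyp L}

lemma EdgeOK.drop (hE : EdgeOK f i T E) (hk : k ≤ E.lab.length) :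
    EdgeOK f i T ⟨E.point k, E.lab.drop k, E.tgt⟩ where
  land hland := by
    simp only [Edge.length_point hk, List.length_drop] at hland
    rw [Edge.point, List.append_assoc, List.take_append_drop]
    exact hE.land (by omega)
  cross hlt hgt := by
    simp only [Edge.length_point hk, List.length_drop] at hlt hgt ⊢
    rw [Edge.point, List.append_assoc, ← List.take_add, show k + (i - (E.src.length + k)) =
      i - E.src.length by omega]
    exact hE.cross (by omega) (by omega)

lemma LoopInvariantExcept.addEdge (hI : LoopInvariantExcept f m E.src.length u h)
    (hsrc : E.src ∈ h.S.inner) (htgt : E.tgt ∈ h.S.nodeSet)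
    (hlen : E.src.length + E.lab.length = E.tgt.length) (hlab : E.lab ≠ [])
    (hfresh : ∀ F ∈ h.S.edges, F.src = E.src → F.lab.head? ≠ E.lab.head?) (hne : E.src ≠ [])
    (hE : ∀ i, E.src.length < i → i ≤ m → EdgeOK f i (h.T i) E) :
    LoopInvariantExcept f m E.src.length u (h.mapS fun S => S.addEdge E) := by
  have hgrows : Grows E.src.length (fun u _ => u = E.src) h (h.mapS fun S => S.addEdge E) :=
    .addEdge h le_rfl rfl
  have hvalid := hI.valid.addEdge hsrc htgt hlen hlab hfresh
  exact
    { valid := hvalid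
      levels := fun i hi him hid => by
        rcases lt_or_gt_of_ne hid with hlt | hgt
        · exact hgrows.levelOK hvalid hlt.le (hI.levels i hi him hid)
        · refine (hI.levels i hi him hid).mono rfl fun F hF => ?_
          rcases List.mem_cons.1 hF with rfl | hF
          · exact Or.inr (hE i hgt him)
          · exact Or.inl hF
      top := hI.top
      full := fun v hv hne hvu => hgrows.full (hI.full v hv hne hvu)
      root_out := hI.root_out.imp fun _ => hgrows.hasOut
      root_essential := fun hroot => hI.root_essential fun b =>
        (hgrows.of_hasOut hI.valid.root_mem (hroot b)).resolve_right hne.symm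
      sinks_ne := hI.sinks_ne }

lemma LoopInvariantExcept.label?_point (hI : LoopInvariant f m h) (hE : E ∈ h.S.edges)
    (hk : 0 < k) (hkl : k < E.lab.length) :
    (h.T (E.point k).length).label? f (E.point k) = some none := by
  have hlen := hI.valid.length_eq E hE
  have htgt := hI.valid.length_le (hI.valid.tgt_mem E hE)
  have hlevel := hI.levels (E.src.length + k) (by omega) (by omega) (by omega)
  have hcross := (hlevel.edge E hE).cross (by omega) (by omega)
  rwa [Nat.add_sub_cancel_left, ← Edge.length_point hkl.le] at hcross

lemma LoopInvariantExcept.point_notMem (hI : LoopInvariant f m h) (hE : E ∈ h.S.edges)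
    (hk : 0 < k) (hkl : k < E.lab.length) : E.point k ∉ h.S.nodeSet := by
  intro hmem
  have hlen := hI.valid.length_eq E hE
  have htgt := hI.valid.length_le (hI.valid.tgt_mem E hE)
  have hpoint := Edge.length_point hkl.le
  have hlevel := hI.levels (E.point k).length (by omega) (by omega) (by omega)
  have hself := hlevel.tree.label?_self _ (mem_level.2 ⟨hmem, rfl⟩)
  rw [hI.label?_point hE hk hkl] at hself
  simp at hself

lemma LoopInvariantExcept.splitEdge (hI : LoopInvariant f m h) (hE : E ∈ h.S.edges)
    (hk : 0 < k) (hkl : k < E.lab.length) :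
    LoopInvariantExcept f m (E.point k).length (E.point k) (h.splitEdge E k) := by
  have hlen := hI.valid.length_eq E hE
  have htgt := hI.valid.length_le (hI.valid.tgt_mem E hE)
  have hpoint := Edge.length_point hkl.le
  have hnotMem := hI.point_notMem hE hk hkl
  have hcut := ((LoopInvariantExcept.except hI _).addInner (v := E.point k) (by omega)).cut
    (w := E.point k) hE (mem_nodeSet.2 (Or.inl List.mem_cons_self)) (by omega) (by omega)
  rw [cut_point hkl.le] at hcut
  refine hcut.addEdge (E := ⟨E.point k, E.lab.drop k, E.tgt⟩) List.mem_cons_self ?_ ?_ ?_ ?_ ?_ ?_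
  · exact (nodeSet_addInner h.S _).ge (Finset.mem_insert_of_mem (hI.valid.tgt_mem E hE))
  · simp only [List.length_drop]
    omega
  · rw [Ne, List.drop_eq_nil_iff]
    omega
  · intro F hF hsrc
    change F.src = E.point k at hsrc
    refine absurd (mem_nodeSet.2 (Or.inl ?_)) hnotMem
    rw [← hsrc]
    rcases (hI.valid.addInner (by omega)).mem_replaceEdge.1 hF with rfl | ⟨-, hF⟩
    · exact hI.valid.src_mem E hE
    · exact hI.valid.src_mem F hF
  · exact List.ne_nil_of_length_pos (l := E.point k) (by omega)
  · intro i hi him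
    exact ((hI.levels i (Nat.zero_lt_of_lt hi) him (Nat.ne_zero_of_lt hi)).edge E hE).drop hkl.le

lemma BranchInvariant.start (hI : LoopInvariant f m h) (hE : E ∈ h.S.edges) (hk : 0 < k)
    (hkl : k < E.lab.length) (htest : IsTwinTest f m (E.point k) r z c) :
    BranchInvariant f m (E.point k) r z c ((h.splitEdge E k).S.edges.filter fun F =>
      F.src.length < (E.point k).length ∧ (E.point k).length < F.tgt.length)
      (h.splitEdge E k) := by
  have hsplit := hI.splitEdge hE hk hkl
  have hlabel := hI.label?_point hE hk hkl
  have hnotMem := hI.point_notMem hE hk hkl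
  have hlen := hI.valid.length_eq E hE
  have htgt := hI.valid.length_le (hI.valid.tgt_mem E hE)
  have hpoint := Edge.length_point hkl.le
  have hlevel := hI.levels (E.point k).length (by omega) (by omega) (by omega)
  have hlevel_eq : (h.splitEdge E k).S.level (E.point k).length =
      insert (E.point k) (h.S.level (E.point k).length) :=
    level_of_nodeSet_insert (nodeSet_addInner h.S _)
  exact
    { invariant := hsplit
      mem_inner := List.mem_cons_self
      tree := hlevel_eq ▸ hlevel.tree.branch hlabel htest
      cost_le := fun a => by
        rw [hlevel_eq, Finset.card_insert_of_notMem fun hmem => hnotMem (mem_level.1 hmem).1]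
        exact Nat.add_le_add_right (hlevel.cost_le a) 2
      edges := fun F hF => by
        refine or_iff_not_imp_right.2 fun hF' => ?_
        rcases hI.valid.mem_edges_splitEdge.1 hF with rfl | rfl | ⟨-, hF₀⟩
        · exact .of_le_src _ le_rfl (hsplit.valid.lab_ne _ hF)
        · refine ⟨fun _ => ?_, fun _ hlt => absurd (hsplit.valid.length_eq _ hF) (ne_of_gt hlt)⟩
          rw [CTree.label?_subst]
          exact (if_pos hlabel).trans (if_pos ⟨htest.fst_eq, htest.snd_eq⟩)
        · refine ⟨fun hland => ?_, fun hlt hgt => absurd (List.mem_filter.2 ⟨hF, ?_⟩) hF'⟩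
          · rw [CTree.label?_subst]
            exact (if_neg fun hnone => Option.some_ne_none F.tgt (Option.some.inj
              (((hlevel.edge F hF₀).land hland).symm.trans hnone))).trans
                ((hlevel.edge F hF₀).land hland)
          · exact decide_eq_true ⟨hlt, hI.valid.length_eq F hF₀ ▸ hgt⟩
      pending := fun F hF => by
        obtain ⟨hF, hpass⟩ := List.mem_filter.1 hF
        obtain ⟨hlt, hgt⟩ := of_decide_eq_true hpass
        refine ⟨hF, hlt, hgt, ?_⟩
        rcases hI.valid.mem_edges_splitEdge.1 hF with rfl | rfl | ⟨-, hF⟩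
        · exact absurd hlt (lt_irrefl _)
        · exact absurd hgt (lt_irrefl _)
        · exact (hlevel.edge F hF).cross hlt (hI.valid.length_eq F hF ▸ hgt)
      nodup := hsplit.valid.nodup.filter _ }

lemma exists_branch (hI : LoopInvariant f m h) (hE : E ∈ h.S.edges) (hk : 0 < k)
    (hkl : k < E.lab.length) (htest : IsTwinTest f m (E.point k) r z c)
    (hb : r.head? = some b) (hlab : (E.lab.drop k).head? = some (!b)) :
    ∃ h₁ h' q₁ q₂, Yields f (branchLoop (E.point k) (branchTree (E.point k) r z c)
        ((h.splitEdge E k).S.edges.filter fun F =>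
          F.src.length < (E.point k).length ∧ (E.point k).length < F.tgt.length)
        (h.splitEdge E k)) h₁ q₁ ∧
      Yields f (addEdge m (E.point k) r (h₁.setTree (E.point k).length
        ((h₁.T (E.point k).length).subst none (branchTree (E.point k) r z c)))) h' q₂ ∧
      LoopInvariant f m h' ∧ h.S.progress < h'.S.progress ∧
      q₁ + q₂ + h.S.weight ≤ h'.S.weight := by
  have hnotMem := hI.point_notMem hE hk hkl
  have hne : E.point k ≠ [] := List.ne_nil_of_length_pos (by rw [Edge.length_point hkl.le]; omega)
  obtain ⟨h₁, q₁, hyields₁, hI₁, hnodes₁, hout₁, hweight₁, hq₁⟩ :=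
    exists_branchLoop _ (BranchInvariant.start hI hE hk hkl htest)
  have hout : ∀ b', h₁.S.HasOut (E.point k) b' ↔ (E.lab.drop k).head? = some b' := fun b' =>
    (hout₁ _ b').trans (hI.valid.hasOut_splitEdge_point hE
      fun hmem => hnotMem (mem_nodeSet.2 (Or.inl hmem)))
  have hI₂ := hI₁.setTree
  obtain ⟨h', q₂, hyields₂, hadd, hweight₂⟩ := exists_addEdge
    { consistent := hI₂.consistentAbove.mono (Nat.zero_le _)
      mem_inner := hI₁.mem_inner
      le_length := htest.length_eq.ge
      head?_eq := hb
      not_hasOut := fun hvb => by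
        have hhead := (hout b).1 hvb
        rw [hlab] at hhead
        simp at hhead }
  have href : h.S.RefinedBy h'.S :=
    ((hI.valid.refinedBy_splitEdge hE hk).trans
      ⟨hnodes₁.ge, fun b => (hout₁ [] b).2⟩).trans hadd.grows.refinedBy
  have hmem : E.point k ∈ h'.S.nodeSet :=
    hadd.grows.nodeSet_subset (mem_nodeSet.2 (Or.inl hI₁.mem_inner))
  refine ⟨h₁, h', q₁, q₂, hyields₁, hyields₂, hI₂.addsOut hadd ?_ (absurd · hne),
    href.progress_lt_of_notMem hmem hnotMem, ?_⟩
  · exact full_of_hasOut_not (hadd.out b rfl) (hadd.grows.hasOut ((hout _).2 hlab))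
  · have hfilter := (List.length_filter_le (fun F : Edge => F.src.length < (E.point k).length ∧
      (E.point k).length < F.tgt.length) _).trans (length_edges_splitEdge hE k).le
    have hweight := weight_splitEdge hE hnotMem
    have hweight_set : (h₁.setTree (E.point k).length
      ((h₁.T (E.point k).length).subst none (branchTree (E.point k) r z c))).S.weight =
        h₁.S.weight := rfl
    omega

lemma exists_addEdge_root (hI : LoopInvariant f m h) (hE : E ∈ h.S.edges) (hsrc : E.src = [])
    (hroot : ¬ h.S.Full []) (hess : Essential f m []) (hr : r.length = m)
    (hb : r.head? = some b) (hlab : E.lab.head? = some (!b)) :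
    ∃ h' q, Yields f (addEdge m [] r h) h' q ∧ LoopInvariant f m h' ∧
      h.S.progress < h'.S.progress ∧ q + h.S.weight ≤ h'.S.weight := by
  have hout : h.S.HasOut [] (!b) := ⟨E, hE, hsrc, hlab⟩
  obtain ⟨h', q, hyields, hadd, hweight⟩ := exists_addEdge
    { consistent := hI.consistentAbove
      mem_inner := hI.valid.root_mem
      le_length := by rw [hr, List.length_nil, zero_add]
      head?_eq := hb
      not_hasOut := fun hb => hroot (full_of_hasOut_not hb hout) }
  have hfull : h'.S.Full [] := full_of_hasOut_not (hadd.out b rfl) (hadd.grows.hasOut hout)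
  exact ⟨h', q, hyields, hI.addsOut hadd hfull fun _ => hess,
    hadd.grows.refinedBy.progress_lt_of_full hroot hfull, hweight⟩

theorem exists_newBranchingNode (hI : LoopInvariant f m h) (he : e.length = m)
    (hE : E ∈ h.S.edges)
    (hstep : E.lab.head? = some (e.getD E.src.length false) ∨ E.src = [] ∧ ¬ h.S.Full [])
    (hc : f (E.src ++ E.lab ++ e.drop E.tgt.length) = c)
    (hy : f (E.src ++ e.drop E.src.length) = y) (hyc : y ≠ c) :
    ∃ h' q, Yields f (newBranchingNode m h e E c y) h' q ∧ LoopInvariant f m h' ∧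
      h.S.progress < h'.S.progress ∧ q + h.S.weight ≤ Nat.clog 2 m + h'.S.weight := by
  have hlen := hI.valid.length_eq E hE
  have htgt := hI.valid.length_le (hI.valid.tgt_mem E hE)
  obtain ⟨k, z, q, hkl, hq, hyields, htest, b, hb, hlab⟩ :=
    exists_bsearch_isTwinTest he hlen htgt (hI.valid.lab_ne E hE) hc hy hyc
  have hsub : E.lab.length - (E.lab.length - k) = k := by omega
  unfold newBranchingNode
  rcases Nat.eq_zero_or_pos k with rfl | hk
  · rw [Edge.point_zero] at htest hb
    rw [List.drop_zero] at hlab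
    obtain ⟨hsrc, hroot⟩ : E.src = [] ∧ ¬ h.S.Full [] := by
      refine hstep.resolve_left fun hhead => ?_
      rw [List.head?_drop] at hb
      rw [hlab, List.getD, hb] at hhead
      simp at hhead
    rw [hsrc] at htest hb
    obtain ⟨h', q', hyields', hI', hprogress, hweight⟩ := exists_addEdge_root hI hE hsrc hroot
      htest.essential (by simpa using htest.length_eq) hb hlab
    refine ⟨h', q + q', hyields.bind ?_, hI', hprogress, by omega⟩
    simpa [hsrc] using hyields'
  · obtain ⟨h₁, h', q₁, q₂, hyields₁, hyields₂, hI', hprogress, hweight⟩ :=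
      exists_branch hI hE hk hkl htest hb hlab
    refine ⟨h', q + (q₁ + q₂), hyields.bind ?_, hI', hprogress, by omega⟩
    simp only
    rw [if_pos (by omega), hsub]
    exact hyields₁.bind hyields₂

end NewBranchingNode

/-! ### Update-Hypothesis -/

namespace OMTBDDAS

section Next

variable {L : Type} {f : Str → L} {m : ℕ} {S : OMTBDDAS L} {e v w : Str} {b : Bool} {E : Edge}

lemma mem_out : E ∈ S.out v ↔ E ∈ S.edges ∧ E.src = v := by simp [out]

lemma edge?_eq_some (h : S.edge? v b = some E) :
    E ∈ S.edges ∧ E.src = v ∧ E.lab.head? = some b := by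
  obtain ⟨hE, hsrc⟩ := mem_out.1 (List.mem_of_find?_eq_some h)
  exact ⟨hE, hsrc, by simpa using List.find?_some h⟩

lemma HasOut.exists_edge? (h : S.HasOut v b) : ∃ E, S.edge? v b = some E := by
  obtain ⟨E, hE, hsrc, hlab⟩ := h
  rw [← Option.isSome_iff_exists, edge?, List.find?_isSome]
  exact ⟨E, mem_out.2 ⟨hE, hsrc⟩, decide_eq_true hlab⟩

lemma dummyEdge?_eq_some_iff : S.dummyEdge? = some E ↔ S.out [] = [E] := by
  unfold dummyEdge?
  split <;> simp_all

lemma dummyEdge?_eq_none (hroot : S.Full []) : S.dummyEdge? = none := by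
  refine Option.eq_none_iff_forall_ne_some.2 fun E hE => ?_
  have hlab (b : Bool) : E.lab.head? = some b := by
    obtain ⟨F, hF, hsrc, hlab⟩ := hroot b
    have hmem : F ∈ S.out [] := mem_out.2 ⟨hF, hsrc⟩
    rw [dummyEdge?_eq_some_iff.1 hE, List.mem_singleton] at hmem
    rwa [← hmem]
  simpa [hlab true] using hlab false

lemma exists_dummyEdge? (hS : S.IsValid f m) (hout : S.HasOut [] b) (hroot : ¬ S.Full []) :
    ∃ E, S.dummyEdge? = some E := by
  obtain ⟨E, hE, hsrc, hlab⟩ := hout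
  have hunique : ∀ F ∈ S.out [], F = E := fun F hF => by
    obtain ⟨hF, hFsrc⟩ := mem_out.1 hF
    obtain ⟨b', hb'⟩ := Option.isSome_iff_exists.1 (List.isSome_head?.2 (hS.lab_ne F hF))
    refine hS.edge_inj F hF E hE (hFsrc.trans hsrc.symm) ?_
    by_contra hne
    obtain rfl : b' = !b := Bool.eq_not.2 fun hbb => hne (by rw [hb', hlab, hbb])
    exact hroot (full_of_hasOut_not ⟨E, hE, hsrc, hlab⟩ ⟨F, hF, hFsrc, hb'⟩)
  exact ⟨E, dummyEdge?_eq_some_iff.2 <| List.perm_singleton.1 <|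
    (List.perm_ext_iff_of_nodup (hS.nodup.filter _) (List.nodup_singleton E)).2 fun F =>
      ⟨fun hF => List.mem_singleton.2 (hunique F hF), fun hF =>
        List.mem_singleton.1 hF ▸ mem_out.2 ⟨hE, hsrc⟩⟩⟩

lemma next?_of_dummyEdge? (h : S.dummyEdge? = some E) (e : Str) : S.next? e [] = some E := by
  rw [next?, if_pos rfl, h]

lemma next?_eq_edge? (hv : v = [] → S.Full []) (e : Str) :
    S.next? e v = S.edge? v (e.getD v.length false) := by
  unfold next?
  split_ifs with hnil
  · rw [dummyEdge?_eq_none (hv hnil)]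
  · rfl

lemma next?_eq_some (h : S.next? e v = some E) :
    E ∈ S.edges ∧ E.src = v ∧
      (E.lab.head? = some (e.getD E.src.length false) ∨ E.src = [] ∧ ¬ S.Full []) := by
  by_cases hv : v = [] → S.Full []
  · rw [next?_eq_edge? hv] at h
    obtain ⟨hE, rfl, hlab⟩ := edge?_eq_some h
    exact ⟨hE, rfl, Or.inl hlab⟩
  · push Not at hv
    obtain ⟨rfl, hroot⟩ := hv
    rcases hdummy : S.dummyEdge? with _ | F
    · rw [next?, if_pos rfl, hdummy] at h
      obtain ⟨hE, hsrc, hlab⟩ := edge?_eq_some h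
      exact ⟨hE, hsrc, Or.inl (by rwa [hsrc])⟩
    · rw [next?_of_dummyEdge? hdummy, Option.some_inj] at h
      subst h
      have hmem : F ∈ S.out [] := dummyEdge?_eq_some_iff.1 hdummy ▸ List.mem_singleton_self F
      obtain ⟨hF, hsrc⟩ := mem_out.1 hmem
      exact ⟨hF, hsrc, Or.inr ⟨hsrc, hroot⟩⟩

lemma IsValid.next?_eq_none (hS : S.IsValid f m) (hv : v.length = m) : S.next? e v = none :=
  Option.eq_none_iff_forall_ne_some.2 fun E h => by
    obtain ⟨hE, hsrc, -⟩ := next?_eq_some h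
    exact (hS.inner_lt _ (hS.src_mem E hE)).ne (hsrc ▸ hv)

lemma IsValid.length_tgt (hS : S.IsValid f m) (hE : E ∈ S.edges) :
    E.src.length < E.tgt.length := by
  rw [← hS.length_eq E hE]
  exact Nat.lt_add_of_pos_right (List.length_pos_iff.2 (hS.lab_ne E hE))

lemma IsValid.tgt_ne_nil (hS : S.IsValid f m) (hE : E ∈ S.edges) : E.tgt ≠ [] :=
  List.ne_nil_of_length_pos ((Nat.zero_le _).trans_lt (hS.length_tgt hE))

lemma IsValid.lookup_sinks (hS : S.IsValid f m) {l : L} (hv : (v, l) ∈ S.sinks) :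
    S.sinks.lookup v = some (f v) := by
  rcases hlookup : S.sinks.lookup v with _ | l'
  · exact absurd (List.lookup_eq_none_iff.1 hlookup _ hv) (by simp)
  · obtain ⟨l₁, l₂, hl, -⟩ := List.lookup_eq_some_iff.1 hlookup
    exact congrArg some (hS.sink_eq (v, l') (by simp [hl])).2

lemma IsValid.lookup_sinks_eq_none (hS : S.IsValid f m) (hv : v ∈ S.inner) :
    S.sinks.lookup v = none := by
  refine List.lookup_eq_none_iff.2 fun p hp => bne_iff_ne.2 ?_
  rintro rfl
  exact (hS.inner_lt _ hv).ne (hS.sink_eq p hp).1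

lemma IsValid.sinkLabel_eq [Zero L] (hS : S.IsValid f m) {l : L} (hv : (v, l) ∈ S.sinks) :
    S.sinkLabel v = f v := by
  rw [sinkLabel, hS.lookup_sinks hv, Option.getD_some]

lemma root_toDiagram_of_full (hroot : S.Full []) : S.toDiagram.root = [] := by
  simp only [toDiagram, dummyEdge?_eq_none hroot]

lemma root_toDiagram_of_dummyEdge? (hE : S.dummyEdge? = some E) : S.toDiagram.root = E.tgt := by
  simp only [toDiagram, hE]

lemma IsValid.cell_toDiagram_of_mem_sinks (hS : S.IsValid f m) {l : L} (hv : (v, l) ∈ S.sinks) :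
    S.toDiagram.cell v = .sink (f v) := by
  simp only [toDiagram, hS.lookup_sinks hv]

end Next

section Path

variable {L : Type} {S : OMTBDDAS L} {e v w : Str} {P : List Edge} {E : Edge}

/-- `P` is the list of the edges that the assignment `e` passes from the node `v` to the
node `w`. -/
def IsPath (S : OMTBDDAS L) (e : Str) : Str → List Edge → Str → Prop
  | v, [], w => v = w
  | v, E :: P, w => S.next? e v = some E ∧ S.IsPath e E.tgt P w

namespace IsPath

lemma getLastD_eq (h : S.IsPath e v P w) : (v :: P.map Edge.tgt).getLastD [] = w := by
  induction P generalizing v with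
  | nil => exact h
  | cons E P ih => simpa using ih h.2

lemma getD_length (h : S.IsPath e v P w) : (v :: P.map Edge.tgt).getD P.length [] = w := by
  induction P generalizing v with
  | nil => exact h
  | cons E P ih => simpa using ih h.2

lemma getD_eq_src (h : S.IsPath e v P w) {i : ℕ} (hi : P[i]? = some E) :
    (v :: P.map Edge.tgt).getD i [] = E.src := by
  induction P generalizing v i with
  | nil => simp at hi
  | cons F P ih =>
    obtain _ | i := i
    · obtain rfl : F = E := by simpa using hi
      exact (next?_eq_some h.1).2.1.symm
    · simpa using ih h.2 (i := i) (by simpa using hi)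

lemma next?_eq_of_mem (h : S.IsPath e v P w) (hE : E ∈ P) : S.next? e E.src = some E := by
  induction P generalizing v with
  | nil => simp at hE
  | cons F P ih =>
    rcases List.mem_cons.1 hE with rfl | hE
    · rw [(next?_eq_some h.1).2.1, h.1]
    · exact ih h.2 hE

end IsPath

end Path

end OMTBDDAS

section Paths

variable {L : Type} [DecidableEq L] {f : Str → L} {m : ℕ} {e v w : Str} {P : List Edge} {l : L}
  {h : Hyp L}

namespace LoopInvariantExcept

lemma full_inner (hI : LoopInvariant f m h) (hv : v ∈ h.S.inner) (hroot : v = [] → h.S.Full []) :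
    h.S.Full v := by
  rcases eq_or_ne v [] with hnil | hnil
  · exact hnil ▸ hroot hnil
  · exact hI.full v hv hnil hnil

lemma exists_next? (hI : LoopInvariant f m h) (hv : v ∈ h.S.inner) :
    ∃ E, h.S.next? e v = some E := by
  by_cases hroot : v = [] → h.S.Full []
  · rw [next?_eq_edge? hroot]
    exact (hI.full_inner hv hroot _).exists_edge?
  · push Not at hroot
    obtain ⟨rfl, hroot⟩ := hroot
    obtain ⟨b, hb⟩ := hI.root_out
    obtain ⟨E, hE⟩ := exists_dummyEdge? hI.valid hb hroot
    exact ⟨E, next?_of_dummyEdge? hE e⟩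

lemma exists_isPath_pathFrom (hI : LoopInvariant f m h) (e : Str) (fuel : ℕ)
    (hv : v ∈ h.S.nodeSet) (hfuel : m ≤ fuel + v.length) :
    ∃ w l, (w, l) ∈ h.S.sinks ∧ h.S.IsPath e v (h.S.pathFrom e fuel v) w ∧
      (h.S.pathFrom e fuel v).length + v.length ≤ m := by
  induction fuel generalizing v with
  | zero =>
    rcases mem_nodeSet.1 hv with hv | ⟨l, hl⟩
    · have := hI.valid.inner_lt v hv
      omega
    · exact ⟨v, l, hl, rfl, by simp [pathFrom, (hI.valid.sink_eq _ hl).1]⟩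
  | succ fuel ih =>
    rcases mem_nodeSet.1 hv with hv | ⟨l, hl⟩
    · obtain ⟨E, hnext⟩ := hI.exists_next? (e := e) hv
      obtain ⟨hE, rfl, -⟩ := next?_eq_some hnext
      have hlt := hI.valid.length_tgt hE
      obtain ⟨w, l, hl, hpath, hlen⟩ := ih (hI.valid.tgt_mem E hE) (by omega)
      simp only [pathFrom, hnext, List.length_cons]
      exact ⟨w, l, hl, ⟨hnext, hpath⟩, by omega⟩
    · have hlen : v.length = m := (hI.valid.sink_eq _ hl).1
      simp only [pathFrom, hI.valid.next?_eq_none hlen]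
      exact ⟨v, l, hl, rfl, by simp [hlen]⟩

lemma exists_isPath (hI : LoopInvariant f m h) (he : e.length = m) :
    ∃ w l, (w, l) ∈ h.S.sinks ∧ h.S.IsPath e [] (h.S.path e) w ∧ (h.S.path e).length ≤ m := by
  simpa [OMTBDDAS.path] using hI.exists_isPath_pathFrom e e.length (v := [])
    (mem_nodeSet.2 (Or.inl hI.valid.root_mem)) (by simp [he])

lemma value_eq [Zero L] (hI : LoopInvariant f m h) (hl : (w, l) ∈ h.S.sinks)
    (hpath : h.S.IsPath e [] (h.S.path e) w) : h.S.value e = f w := by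
  rw [value, ids, hpath.getLastD_eq, hI.valid.sinkLabel_eq hl]

lemma exists_bsearch_path [Zero L] (hI : LoopInvariant f m h) (he : e.length = m)
    (hne : h.S.value e ≠ f e) :
    ∃ s E q, (h.S.path e)[(h.S.path e).length - s]? = some E ∧ h.S.next? e E.src = some E ∧
      f (E.tgt ++ e.drop E.tgt.length) = h.S.value e ∧
      f (E.src ++ e.drop E.src.length) ≠ h.S.value e ∧ q ≤ Nat.clog 2 m ∧
      Yields f (bsearch (fun s => ask ((h.S.ids e).getD ((h.S.path e).length - s) [] ++
          e.drop ((h.S.ids e).getD ((h.S.path e).length - s) []).length))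
        (h.S.value e) (h.S.path e).length 0 (h.S.path e).length (f e))
        (s, f (E.src ++ e.drop E.src.length)) q := by
  obtain ⟨w, l, hl, hpath, hlen⟩ := hI.exists_isPath he
  have hvalue := hI.value_eq hl hpath
  have hw : w.length = m := (hI.valid.sink_eq _ hl).1
  set k := (h.S.path e).length
  set p : ℕ → Str := fun i => (h.S.ids e).getD i [] with hp
  set g : ℕ → L := fun s => f (p (k - s) ++ e.drop (p (k - s)).length) with hg
  have hpk : p k = w := hpath.getD_length
  have hg_zero : g 0 = h.S.value e := by
    simp only [hg, Nat.sub_zero, hpk, hw, ← he, List.drop_length, List.append_nil, hvalue]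
  have hg_k : g k = f e := by
    simp only [hg, Nat.sub_self]
    rfl
  have hk_pos : 0 < k := Nat.pos_of_ne_zero fun hk0 => hne (by rw [← hg_zero, ← hg_k, hk0])
  obtain ⟨s, q, hs0, hsk, hpred, hsne, hq, hyields⟩ := Yields.bsearch (g := g)
    (fun s => Yields.ask (p (k - s) ++ e.drop (p (k - s)).length)) k 0 k (Nat.clog 2 m) hk_pos
    (by omega) (by have := Nat.le_pow_clog one_lt_two m; omega) hg_zero
    (by rw [hg_k]; exact hne.symm)
  rw [hg_k] at hyields
  obtain ⟨E, hE⟩ : ∃ E, (h.S.path e)[k - s]? = some E :=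
    ⟨_, List.getElem?_eq_getElem (show k - s < (h.S.path e).length by omega)⟩
  have hnext := hpath.next?_eq_of_mem (List.mem_of_getElem? hE)
  have hsrc : p (k - s) = E.src := hpath.getD_eq_src hE
  have htgt : p (k - (s - 1)) = E.tgt := by
    rw [show k - (s - 1) = k - s + 1 by omega]
    simp [hp, ids, hE]
  simp only [hg, hsrc] at hsne hyields
  simp only [hg, htgt] at hpred
  exact ⟨s, E, q, hE, hnext, hpred, hsne, hq, hyields⟩

theorem exists_updateHypothesis [Zero L] (hI : LoopInvariant f m h) (he : e.length = m)
    (hne : h.S.value e ≠ f e) :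
    ∃ h' q, Yields f (updateHypothesis m h e (f e)) h' q ∧ LoopInvariant f m h' ∧
      h.S.progress < h'.S.progress ∧ q + h.S.weight ≤ 2 * Nat.clog 2 m + 1 + h'.S.weight := by
  obtain ⟨s, E, q, hs, hnext, htgt, hsrc, hq, hyields⟩ := hI.exists_bsearch_path he hne
  obtain ⟨hE, -, hstep⟩ := next?_eq_some hnext
  by_cases hx : f (E.src ++ E.lab ++ e.drop E.tgt.length) = h.S.value e
  · obtain ⟨h', q', hyields', hI', hprogress, hweight⟩ :=
      exists_newBranchingNode hI he hE hstep hx rfl hsrc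
    refine ⟨h', q + (1 + q'), hyields.bind ?_, hI', hprogress, by omega⟩
    simp only [hs]
    refine (Yields.ask _).bind ?_
    rwa [if_neg (not_not_intro hx)]
  · obtain ⟨h', q', hyields', hI', hprogress, hweight⟩ := exists_nodeSplit hI he hE htgt rfl hx
    refine ⟨h', q + (1 + q'), hyields.bind ?_, hI', hprogress, by omega⟩
    simp only [hs]
    refine (Yields.ask _).bind ?_
    rwa [if_pos hx]

end LoopInvariantExcept

end Paths

section ToDiagram

variable {L : Type} [DecidableEq L] {f : Str → L} {m : ℕ} {e v w : Str} {P : List Edge} {l : L}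
  {E : Edge} {h : Hyp L}

namespace LoopInvariantExcept

lemma exists_cell_toDiagram_eq_branch (hI : LoopInvariant f m h) (hv : v ∈ h.S.inner)
    (hroot : v = [] → h.S.Full []) :
    ∃ E : Bool → Edge, (∀ b, h.S.edge? v b = some (E b)) ∧
      h.S.toDiagram.cell v = .branch v.length (E false).tgt (E true).tgt := by
  choose E hE using fun b => (hI.full_inner hv hroot b).exists_edge?
  refine ⟨E, hE, ?_⟩
  simp only [toDiagram, hI.valid.lookup_sinks_eq_none hv, hE, Option.map_some, Option.getD_some]

lemma mem_nodes_toDiagram (hI : LoopInvariant f m h) :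
    v ∈ h.S.toDiagram.nodes ↔ v ∈ h.S.nodeSet ∧ (v = [] → h.S.Full []) := by
  by_cases hroot : h.S.Full []
  · simp only [toDiagram, dummyEdge?_eq_none hroot, hroot, implies_true, and_true]
    rfl
  · obtain ⟨b, hb⟩ := hI.root_out
    obtain ⟨E, hE⟩ := exists_dummyEdge? hI.valid hb hroot
    simp only [toDiagram, hE, hroot, imp_false, Finset.mem_erase]
    exact and_comm

lemma card_nodes_toDiagram (hI : LoopInvariant f m h) :
    h.S.toDiagram.nodes.card + 1 = h.S.progress := by
  by_cases hroot : h.S.Full []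
  · have hnodes : h.S.toDiagram.nodes = h.S.nodeSet := by
      ext v
      simp only [hI.mem_nodes_toDiagram, hroot, implies_true, and_true]
    rw [hnodes, progress, if_pos hroot]
  · have hnodes : h.S.toDiagram.nodes = h.S.nodeSet.erase [] := by
      ext v
      simp only [hI.mem_nodes_toDiagram, hroot, imp_false, Finset.mem_erase, and_comm]
    rw [hnodes, progress, if_neg hroot, add_zero,
      Finset.card_erase_add_one (mem_nodeSet.2 (Or.inl hI.valid.root_mem))]

lemma tgt_mem_nodes_toDiagram (hI : LoopInvariant f m h) (hE : E ∈ h.S.edges) :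
    E.tgt ∈ h.S.toDiagram.nodes :=
  hI.mem_nodes_toDiagram.2
    ⟨hI.valid.tgt_mem E hE, fun hnil => absurd hnil (hI.valid.tgt_ne_nil hE)⟩

lemma root_mem_nodes_toDiagram (hI : LoopInvariant f m h) :
    h.S.toDiagram.root ∈ h.S.toDiagram.nodes := by
  by_cases hroot : h.S.Full []
  · rw [root_toDiagram_of_full hroot, hI.mem_nodes_toDiagram]
    exact ⟨mem_nodeSet.2 (Or.inl hI.valid.root_mem), fun _ => hroot⟩
  · obtain ⟨b, hb⟩ := hI.root_out
    obtain ⟨E, hE⟩ := exists_dummyEdge? hI.valid hb hroot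
    rw [root_toDiagram_of_dummyEdge? hE]
    exact hI.tgt_mem_nodes_toDiagram (next?_eq_some (next?_of_dummyEdge? hE [])).1

lemma of_cell_toDiagram_eq_branch (hI : LoopInvariant f m h) (hv : v ∈ h.S.toDiagram.nodes)
    {i : ℕ} {lo hi : Str} (hcell : h.S.toDiagram.cell v = .branch i lo hi) :
    i = v.length ∧ i < m ∧
      ∀ w, w = lo ∨ w = hi → w ∈ h.S.toDiagram.nodes ∧ i < w.length := by
  obtain ⟨hmem, hroot⟩ := hI.mem_nodes_toDiagram.1 hv
  rcases mem_nodeSet.1 hmem with hinner | ⟨l, hl⟩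
  · obtain ⟨E, hE, hcell'⟩ := hI.exists_cell_toDiagram_eq_branch hinner hroot
    obtain ⟨rfl, rfl, rfl⟩ := Cell.branch.inj (hcell'.symm.trans hcell)
    have htgt (b : Bool) : (E b).tgt ∈ h.S.toDiagram.nodes ∧ v.length < (E b).tgt.length := by
      obtain ⟨hEb, hsrc, -⟩ := edge?_eq_some (hE b)
      exact ⟨hI.tgt_mem_nodes_toDiagram hEb, hsrc ▸ hI.valid.length_tgt hEb⟩
    refine ⟨rfl, hI.valid.inner_lt v hinner, ?_⟩
    rintro _ (rfl | rfl)
    exacts [htgt false, htgt true]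
  · simp [hI.valid.cell_toDiagram_of_mem_sinks hl] at hcell

lemma of_cell_toDiagram_eq_sink (hI : LoopInvariant f m h) (hv : v ∈ h.S.toDiagram.nodes)
    (hcell : h.S.toDiagram.cell v = .sink l) : v ∈ h.S.level m ∧ f v = l := by
  obtain ⟨hmem, hroot⟩ := hI.mem_nodes_toDiagram.1 hv
  rcases mem_nodeSet.1 hmem with hinner | ⟨l', hl'⟩
  · obtain ⟨E, -, hcell'⟩ := hI.exists_cell_toDiagram_eq_branch hinner hroot
    simp [hcell'] at hcell
  · rw [hI.valid.cell_toDiagram_of_mem_sinks hl', Cell.sink.injEq] at hcell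
    exact ⟨mem_level.2 ⟨hmem, (hI.valid.sink_eq _ hl').1⟩, hcell⟩

lemma pos (hI : LoopInvariant f m h) : 0 < m := hI.valid.inner_lt _ hI.valid.root_mem

lemma eq_of_mem_level (hI : LoopInvariant f m h) {i : ℕ} (hi : 0 < i) (him : i ≤ m)
    (hv : v ∈ h.S.level i) (hw : w ∈ h.S.level i)
    (hvw : ∀ s : Str, s.length = m - i → f (v ++ s) = f (w ++ s)) : v = w := by
  have htree := (hI.levels i hi him hi.ne').tree
  have hlabel := htree.testsOfLength.label?_congr hvw
  rwa [htree.label?_self v hv, htree.label?_self w hw, Option.some_inj, Option.some_inj] at hlabel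

lemma isOrdered_toDiagram (hI : LoopInvariant f m h) : h.S.toDiagram.IsOrdered m where
  root_mem := hI.root_mem_nodes_toDiagram
  child_mem v hv w := by
    rintro ⟨i, lo, hi, hcell, hw⟩
    exact ((hI.of_cell_toDiagram_eq_branch hv hcell).2.2 w hw).1
  var_lt v hv i lo hi hcell := (hI.of_cell_toDiagram_eq_branch hv hcell).2.1
  ordered v hv i lo hi hcell w hchild j lo' hi' hcell' := by
    obtain ⟨i', lo₁, hi₁, hcell₁, hw⟩ := hchild
    obtain ⟨rfl, rfl, rfl⟩ := Cell.branch.inj (hcell.symm.trans hcell₁)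
    obtain ⟨hmem, hlt⟩ := (hI.of_cell_toDiagram_eq_branch hv hcell).2.2 w hw
    rwa [(hI.of_cell_toDiagram_eq_branch hmem hcell').1]
  sink_unique v hv w hw l hcv hcw := by
    obtain ⟨hv, hfv⟩ := hI.of_cell_toDiagram_eq_sink hv hcv
    obtain ⟨hw, hfw⟩ := hI.of_cell_toDiagram_eq_sink hw hcw
    refine hI.eq_of_mem_level hI.pos le_rfl hv hw fun s hs => ?_
    rw [Nat.sub_self, List.length_eq_zero_iff] at hs
    rw [hs, List.append_nil, List.append_nil, hfv, hfw]

lemma evalFrom_toDiagram_of_isPath (hI : LoopInvariant f m h) (hl : (w, l) ∈ h.S.sinks)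
    (hpath : h.S.IsPath e v P w) (hroot : v = [] → h.S.Full []) {n : ℕ} (hn : P.length ≤ n) :
    h.S.toDiagram.evalFrom e n v = some (f w) := by
  induction P generalizing v n with
  | nil =>
    obtain rfl : v = w := hpath
    exact Diagram.evalFrom_of_sink (hI.valid.cell_toDiagram_of_mem_sinks hl) e n
  | cons E P ih =>
    obtain ⟨n, rfl⟩ : ∃ n', n = n' + 1 := Nat.exists_eq_succ_of_ne_zero (by rintro rfl; simp at hn)
    obtain ⟨hE, hsrc, -⟩ := next?_eq_some hpath.1
    obtain ⟨F, hF, hcell⟩ :=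
      hI.exists_cell_toDiagram_eq_branch (hsrc ▸ hI.valid.src_mem E hE) hroot
    have hEF : E = F (e.getD v.length false) := by
      rw [← Option.some_inj, ← hF, ← next?_eq_edge? hroot, hpath.1]
    have htgt : (if e.getD v.length false then (F true).tgt else (F false).tgt) = E.tgt := by
      rw [hEF]
      cases e.getD v.length false <;> rfl
    rw [Diagram.evalFrom_succ_of_branch hcell, htgt]
    exact ih hpath.2 (fun hnil => absurd hnil (hI.valid.tgt_ne_nil hE)) (Nat.le_of_succ_le_succ hn)

theorem eval_toDiagram [Zero L] (hI : LoopInvariant f m h) (he : e.length = m) :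
    h.S.toDiagram.eval e = some (h.S.value e) := by
  obtain ⟨w, l, hl, hpath, hlen⟩ := hI.exists_isPath he
  rw [hI.value_eq hl hpath, Diagram.eval, he]
  by_cases hroot : h.S.Full []
  · rw [root_toDiagram_of_full hroot]
    exact hI.evalFrom_toDiagram_of_isPath hl hpath (fun _ => hroot) hlen
  · obtain ⟨b, hb⟩ := hI.root_out
    obtain ⟨E, hE⟩ := exists_dummyEdge? hI.valid hb hroot
    have hnext := next?_of_dummyEdge? hE e
    rw [root_toDiagram_of_dummyEdge? hE]
    rcases hP : h.S.path e with _ | ⟨F, P⟩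
    · obtain rfl : [] = w := by rwa [hP] at hpath
      exact absurd (hI.valid.sink_eq _ hl).1 hI.pos.ne
    · rw [hP] at hpath hlen
      obtain rfl : E = F := Option.some_inj.1 (hnext.symm.trans hpath.1)
      exact hI.evalFrom_toDiagram_of_isPath hl hpath.2
        (fun hnil => absurd hnil (hI.valid.tgt_ne_nil (next?_eq_some hnext).1))
        ((Nat.le_succ _).trans hlen)

end LoopInvariantExcept

end ToDiagram

/-! ### The main loop -/

section Const

variable {L : Type*}

lemma Diagram.isOrdered_const (l : L) (m : ℕ) : (const l).IsOrdered m where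
  root_mem := Finset.mem_singleton_self _
  child_mem := by
    rintro v - w ⟨i, lo, hi, hcell, -⟩
    cases hcell
  var_lt := nofun
  ordered := nofun
  sink_unique v hv w hw _ _ _ := (Finset.mem_singleton.1 hv).trans (Finset.mem_singleton.1 hw).symm

lemma Diagram.eval_const (l : L) (a : Str) : (const l).eval a = some l :=
  evalFrom_of_sink rfl _ _

variable {V : Type*} {D : Diagram V L} {m : ℕ} {f : Str → L} {l : L}

lemma Diagram.Iso.cell_root_eq_sink (h : D.Iso (Diagram.const l)) (hD : D.IsOrdered m) :
    D.cell D.root = .sink l := by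
  obtain ⟨φ, -, -, hcell⟩ := h
  have hroot := hcell D.root hD.root_mem
  rcases hr : D.cell D.root with l' | ⟨i, lo, hi⟩ <;> rw [hr] at hroot <;> cases hroot
  rfl

lemma CorrectMQ.eq_of_cell_root_eq_sink (hf : CorrectMQ D m f) (hroot : D.cell D.root = .sink l)
    {a : Str} (ha : a.length = m) : f a = l := by
  rw [← Option.some_inj, ← hf a ha, Diagram.eval, Diagram.evalFrom_of_sink hroot]

end Const

section Bounds

variable {L : Type} [DecidableEq L] {V : Type*} {D : Diagram V L} {m : ℕ} {f : Str → L} {v : Str}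
  {h : Hyp L}

lemma OMTBDDAS.IsValid.length_edges_add_two_le {L : Type} {f : Str → L} {S : OMTBDDAS L}
    (hS : S.IsValid f m) (hsinks : S.sinks ≠ []) :
    S.edges.length + 2 ≤ 2 * S.nodeSet.card := by
  obtain ⟨⟨s, l⟩, hs⟩ := List.exists_mem_of_ne_nil _ hsinks
  have hs_mem : s ∈ S.nodeSet := mem_nodeSet.2 (Or.inr ⟨l, hs⟩)
  have hcard : S.edges.toFinset.card ≤
      ((S.nodeSet.erase s) ×ˢ (Finset.univ : Finset (Option Bool)).erase none).card := by
    refine Finset.card_le_card_of_injOn (fun E => (E.src, E.lab.head?)) (fun E hE => ?_)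
      fun E hE F hF hEF => ?_
    · have hE : E ∈ S.edges := List.mem_toFinset.1 hE
      have hsrc := hS.src_mem E hE
      have hne : E.src ≠ s := fun hEs => (hS.inner_lt _ hsrc).ne (hEs ▸ (hS.sink_eq _ hs).1)
      simpa [hne, hS.lab_ne E hE] using mem_nodeSet.2 (Or.inl hsrc)
    · obtain ⟨hsrc, hhead⟩ := Prod.mk.inj hEF
      exact hS.edge_inj E (List.mem_toFinset.1 hE) F (List.mem_toFinset.1 hF) hsrc hhead
  rw [List.toFinset_card_of_nodup hS.nodup, Finset.card_product, Finset.card_erase_of_mem hs_mem,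
    Finset.card_erase_of_mem (Finset.mem_univ _), Finset.card_univ, Fintype.card_option,
    Fintype.card_bool] at hcard
  have := Finset.card_pos.2 ⟨s, hs_mem⟩
  omega

namespace LoopInvariantExcept

lemma essential_of_mem_nodes_toDiagram (hI : LoopInvariant f m h)
    (hv : v ∈ h.S.toDiagram.nodes) (hvm : v.length < m) : Essential f m v := by
  obtain ⟨hmem, hroot⟩ := hI.mem_nodes_toDiagram.1 hv
  rcases eq_or_ne v [] with rfl | hnil
  · exact hI.root_essential (hroot rfl)
  · have hpos := List.length_pos_iff.2 hnil
    have htree := (hI.levels v.length hpos hvm.le hpos.ne').tree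
    refine htree.essential hvm v rfl ?_
    simp [htree.label?_self v (mem_level.2 ⟨hmem, rfl⟩)]

lemma card_nodes_toDiagram_le (hI : LoopInvariant f m h) (hD : D.IsOrdered m)
    (hf : CorrectMQ D m f) : h.S.toDiagram.nodes.card ≤ D.nodes.card := by
  refine hD.card_le_of_separated hf (fun a ha => ?_) fun a ha b hb hlen hab => ?_
  · exact (hI.valid.length_le (hI.mem_nodes_toDiagram.1 ha).1).eq_or_lt.imp_right
      (hI.essential_of_mem_nodes_toDiagram ha)
  · rcases eq_or_ne a [] with rfl | hnil
    · exact (List.length_eq_zero_iff.1 hlen.symm).symm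
    · have ha := (hI.mem_nodes_toDiagram.1 ha).1
      have hle := hI.valid.length_le ha
      exact hI.eq_of_mem_level (List.length_pos_iff.2 hnil) hle (mem_level.2 ⟨ha, rfl⟩)
        (mem_level.2 ⟨(hI.mem_nodes_toDiagram.1 hb).1, hlen.symm⟩) fun s hs => hab s (by omega)

lemma progress_le (hI : LoopInvariant f m h) (hD : D.IsOrdered m) (hf : CorrectMQ D m f) :
    h.S.progress ≤ D.nodes.card + 1 :=
  hI.card_nodes_toDiagram ▸ Nat.succ_le_succ (hI.card_nodes_toDiagram_le hD hf)

lemma weight_le (hI : LoopInvariant f m h) (hD : D.IsOrdered m) (hf : CorrectMQ D m f) :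
    h.S.weight ≤ 4 * D.nodes.card * (D.nodes.card + 1) := by
  have hedges := hI.valid.length_edges_add_two_le hI.sinks_ne
  have hnodes : h.S.nodeSet.card ≤ D.nodes.card + 1 :=
    (Nat.le_add_right _ _).trans (hI.progress_le hD hf)
  exact Nat.mul_le_mul (by omega) hnodes

end LoopInvariantExcept

end Bounds

section MainLoop

variable {L : Type}

lemma run_ask_bind {α : Type} (MQ : Str → L) (EQ : ℕ → Diagram Str L → Option Str) (a : Str)
    (k : L → Prog L α) (nE nM : ℕ) :
    (ask a >>= k).run MQ EQ nE nM = (k (MQ a)).run MQ EQ nE (nM + 1) := rfl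

lemma run_askEq_bind {α : Type} (MQ : Str → L) (EQ : ℕ → Diagram Str L → Option Str)
    (H : Diagram Str L) (k : Option Str → Prog L α) (nE nM : ℕ) :
    (askEq H >>= k).run MQ EQ nE nM = (k (EQ nE H)).run MQ EQ (nE + 1) nM := rfl

/-- With at least `N` units of fuel, `p` outputs a diagram isomorphic to `D`, after at most `a`
equivalence queries and `b` membership queries. -/
def Learns {V : Type*} (D : Diagram V L) (MQ : Str → L) (EQ : ℕ → Diagram Str L → Option Str)
    (p : ℕ → Prog L (Option (Diagram Str L))) (N a b : ℕ) : Prop :=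
  ∀ nE nM, ∃ H nE' nM', (∀ fuel ≥ N, (p fuel).run MQ EQ nE nM = (some H, nE', nM')) ∧
    D.Iso H ∧ nE' ≤ nE + a ∧ nM' ≤ nM + b

variable {V : Type*} {D : Diagram V L} {m : ℕ} {f : Str → L}
  {EQ : ℕ → Diagram Str L → Option Str} {e : Str} {t : ℕ} {h : Hyp L}

lemma Yields.learns_bind {α : Type} {p : Prog L α} {x : α} {q N a b : ℕ}
    {g : ℕ → α → Prog L (Option (Diagram Str L))} (hp : Yields f p x q)
    (hg : Learns D f EQ (fun fuel => g fuel x) N a b) :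
    Learns D f EQ (fun fuel => p >>= g fuel) N a (q + b) := by
  intro nE nM
  obtain ⟨H, nE', nM', hrun, hiso, hE, hM⟩ := hg nE (nM + q)
  refine ⟨H, nE', nM', fun fuel hfuel => ?_, hiso, hE, by omega⟩
  rw [Prog.run_bind, hp]
  exact hrun fuel hfuel

variable [DecidableEq L]

namespace LoopInvariantExcept

lemma iso_toDiagram (hI : LoopInvariant f m h) (hD : D.IsReduced m) (hf : CorrectMQ D m f)
    (hEQ : CorrectEQ D m EQ) (hnone : EQ t h.S.toDiagram = none) : D.Iso h.S.toDiagram :=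
  hD.iso hI.isOrdered_toDiagram ((hEQ t _ hI.isOrdered_toDiagram).1 hnone)
    (hI.card_nodes_toDiagram_le hD.toIsOrdered hf)

variable [Zero L]

lemma value_ne_of_counterexample (hI : LoopInvariant f m h) (hf : CorrectMQ D m f)
    (hEQ : CorrectEQ D m EQ) (hsome : EQ t h.S.toDiagram = some e) :
    e.length = m ∧ h.S.value e ≠ f e := by
  obtain ⟨he, hne⟩ := (hEQ t _ hI.isOrdered_toDiagram).2 e hsome
  rw [hI.eval_toDiagram he, hf e he] at hne
  exact ⟨he, fun heq => hne (congrArg some heq)⟩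

lemma learns_mainLoop_succ (hI : LoopInvariant f m h) (hD : D.IsReduced m)
    (hf : CorrectMQ D m f) (hEQ : CorrectEQ D m EQ) {N a b : ℕ}
    (hupdate : ∀ e : Str, e.length = m → h.S.value e ≠ f e → ∃ b' < b,
      Learns D f EQ (fun fuel => updateHypothesis m h e (f e) >>= fun h =>
        mainLoop m fuel h e (f e)) N a b') (he : e.length = m) :
    Learns D f EQ (fun fuel => mainLoop m fuel h e (f e)) (N + 1) (a + 1) b := by
  intro nE nM
  by_cases hv : h.S.value e = f e
  · rcases hq : EQ nE h.S.toDiagram with _ | e'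
    · refine ⟨h.S.toDiagram, nE + 1, nM, fun fuel hfuel => ?_, hI.iso_toDiagram hD hf hEQ hq,
        by omega, by omega⟩
      obtain ⟨fuel, rfl⟩ := Nat.exists_eq_add_of_le' hfuel
      simp only [mainLoop, if_pos hv, run_askEq_bind, hq]
      rfl
    · obtain ⟨he', hne⟩ := hI.value_ne_of_counterexample hf hEQ hq
      obtain ⟨b', hb', hlearns⟩ := hupdate e' he' hne
      obtain ⟨H, nE', nM', hrun, hiso, hE, hM⟩ := hlearns (nE + 1) (nM + 1)
      refine ⟨H, nE', nM', fun fuel hfuel => ?_, hiso, by omega, by omega⟩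
      obtain ⟨fuel, rfl⟩ := Nat.exists_eq_add_of_le' hfuel
      simp only [mainLoop, if_pos hv, run_askEq_bind, hq]
      exact hrun _ (Nat.le_add_left _ _)
  · obtain ⟨b', hb', hlearns⟩ := hupdate e he hv
    obtain ⟨H, nE', nM', hrun, hiso, hE, hM⟩ := hlearns nE nM
    refine ⟨H, nE', nM', fun fuel hfuel => ?_, hiso, by omega, by omega⟩
    obtain ⟨fuel, rfl⟩ := Nat.exists_eq_add_of_le' hfuel
    simp only [mainLoop, if_neg hv]
    exact hrun _ (Nat.le_add_left _ _)

theorem learns_mainLoop (hD : D.IsReduced m) (hf : CorrectMQ D m f) (hEQ : CorrectEQ D m EQ)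
    (r : ℕ) {b : ℕ} (hI : LoopInvariant f m h) (he : e.length = m)
    (hr : D.nodes.card + 1 ≤ h.S.progress + r)
    (hb : r * (2 * Nat.clog 2 m + 2) + 4 * D.nodes.card * (D.nodes.card + 1) ≤ b + h.S.weight) :
    Learns D f EQ (fun fuel => mainLoop m fuel h e (f e)) (r + 1) (r + 1) b := by
  induction r generalizing h e b with
  | zero =>
    refine hI.learns_mainLoop_succ hD hf hEQ (fun e he hne => ?_) he
    obtain ⟨h', q, -, hI', hprogress, -⟩ := hI.exists_updateHypothesis he hne
    have := hI'.progress_le hD.toIsOrdered hf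
    omega
  | succ r ih =>
    refine hI.learns_mainLoop_succ hD hf hEQ (fun e he hne => ?_) he
    obtain ⟨h', q, hyields, hI', hprogress, hweight⟩ := hI.exists_updateHypothesis he hne
    have hweight_le := hI'.weight_le hD.toIsOrdered hf
    rw [Nat.succ_mul] at hb
    exact ⟨q + (b - 1 - q), by omega,
      hyields.learns_bind (ih hI' he (by omega) (by omega))⟩

end LoopInvariantExcept

end MainLoop

/-! ### The initial hypothesis -/

section ForkDiagram

variable {L : Type} {f : Str → L} {m : ℕ} {v s t u : Str} {E : Edge}

/-- The data found by the search in Initial-Hypothesis: `t` distinguishes the node `v` from `μ`,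
and the strings `s` and `t` of the same length can label the two edges that leave `v`. -/
structure IsFork (f : Str → L) (m : ℕ) (v s t : Str) : Prop where
  isTwinTest : IsTwinTest f m v t (f (v ++ t)) (f (v ++ s))
  length_eq : v.length + s.length = m
  head?_eq : ∃ b, t.head? = some b ∧ s.head? = some (!b)

/-- The initial diagram: the node `v` with edges to the sinks `v ++ s` and `v ++ t`, below a dummy
root unless `v` is the root. -/
def forkDiagram (f : Str → L) (v s t : Str) : OMTBDDAS L where
  inner := if v = [] then [[]] else [[], v]
  sinks := [(v ++ s, f (v ++ s)), (v ++ t, f (v ++ t))]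
  edges := if v = [] then [⟨v, s, v ++ s⟩, ⟨v, t, v ++ t⟩]
    else [⟨[], v, v⟩, ⟨v, s, v ++ s⟩, ⟨v, t, v ++ t⟩]

lemma mem_inner_forkDiagram : u ∈ (forkDiagram f v s t).inner ↔ u = [] ∨ u = v := by
  rw [forkDiagram]
  split_ifs with hv <;> simp [hv]

lemma mem_sinks_forkDiagram {p : Str × L} : p ∈ (forkDiagram f v s t).sinks ↔
    p = (v ++ s, f (v ++ s)) ∨ p = (v ++ t, f (v ++ t)) := by
  simp [forkDiagram]

lemma mem_edges_forkDiagram : E ∈ (forkDiagram f v s t).edges ↔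
    v ≠ [] ∧ E = ⟨[], v, v⟩ ∨ E = ⟨v, s, v ++ s⟩ ∨ E = ⟨v, t, v ++ t⟩ := by
  rw [forkDiagram]
  split_ifs with hv <;> simp [hv]

lemma mem_nodeSet_forkDiagram : u ∈ (forkDiagram f v s t).nodeSet ↔
    u = [] ∨ u = v ∨ u = v ++ s ∨ u = v ++ t := by
  simp [mem_nodeSet, mem_inner_forkDiagram, mem_sinks_forkDiagram, exists_or, or_assoc]

namespace IsFork

lemma length_lt (h : IsFork f m v s t) : v.length < m := by
  have := List.length_pos_iff.2 h.isTwinTest.ne_nil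
  have := h.isTwinTest.length_eq
  omega

lemma ne_nil (h : IsFork f m v s t) : s ≠ [] := by
  obtain ⟨b, -, hs⟩ := h.head?_eq
  rintro rfl
  cases hs

lemma append_ne (h : IsFork f m v s t) : v ++ s ≠ v ++ t := fun heq =>
  h.isTwinTest.ne (congrArg f heq.symm)

lemma full (h : IsFork f m v s t) : (forkDiagram f v s t).Full v := by
  obtain ⟨b, ht, hs⟩ := h.head?_eq
  exact full_of_hasOut_not ⟨_, mem_edges_forkDiagram.2 (Or.inr (Or.inr rfl)), rfl, ht⟩
    ⟨_, mem_edges_forkDiagram.2 (Or.inr (Or.inl rfl)), rfl, hs⟩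

lemma isValid (h : IsFork f m v s t) : (forkDiagram f v s t).IsValid f m where
  inner_lt u hu := by
    rcases mem_inner_forkDiagram.1 hu with rfl | rfl
    · exact (Nat.zero_le _).trans_lt h.length_lt
    · exact h.length_lt
  sink_eq p hp := by
    rcases mem_sinks_forkDiagram.1 hp with rfl | rfl
    · exact ⟨List.length_append.trans h.length_eq, rfl⟩
    · exact ⟨List.length_append.trans h.isTwinTest.length_eq, rfl⟩
  root_mem := mem_inner_forkDiagram.2 (Or.inl rfl)
  src_mem E hE := by
    rcases mem_edges_forkDiagram.1 hE with ⟨-, rfl⟩ | rfl | rfl <;> simp [mem_inner_forkDiagram]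
  tgt_mem E hE := by
    rcases mem_edges_forkDiagram.1 hE with ⟨-, rfl⟩ | rfl | rfl <;> simp [mem_nodeSet_forkDiagram]
  length_eq E hE := by
    rcases mem_edges_forkDiagram.1 hE with ⟨-, rfl⟩ | rfl | rfl <;> simp
  lab_ne E hE := by
    rcases mem_edges_forkDiagram.1 hE with ⟨hv, rfl⟩ | rfl | rfl
    exacts [hv, h.ne_nil, h.isTwinTest.ne_nil]
  nodup := by
    have hst : s ≠ t := fun heq => h.append_ne (heq ▸ rfl)
    rw [forkDiagram]
    split_ifs with hv
    · simp [hst]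
    · simp [hst, Ne.symm hv]
  edge_inj E hE F hF hsrc hhead := by
    obtain ⟨b, ht, hs⟩ := h.head?_eq
    rcases mem_edges_forkDiagram.1 hE with ⟨hv, rfl⟩ | rfl | rfl <;>
      rcases mem_edges_forkDiagram.1 hF with ⟨hv', rfl⟩ | rfl | rfl <;> simp_all

lemma root_essential (h : IsFork f m v s t) (hroot : (forkDiagram f v s t).Full []) :
    Essential f m [] := by
  rcases eq_or_ne v [] with rfl | hv
  · exact h.isTwinTest.essential
  have hhead : ∀ b, v.head? = some b := by
    intro b
    obtain ⟨E, hE, hsrc, hb⟩ := hroot b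
    rcases mem_edges_forkDiagram.1 hE with ⟨-, rfl⟩ | rfl | rfl
    exacts [hb, absurd hsrc hv, absurd hsrc hv]
  cases (hhead false).symm.trans (hhead true)

lemma exists_hasOut_root (h : IsFork f m v s t) : ∃ b, (forkDiagram f v s t).HasOut [] b := by
  rcases eq_or_ne v [] with rfl | hv
  · exact ⟨true, h.full true⟩
  · exact ⟨v.head hv, _, mem_edges_forkDiagram.2 (Or.inl ⟨hv, rfl⟩), rfl,
      List.head?_eq_some_head hv⟩

lemma level_eq_sinks (h : IsFork f m v s t) :
    (forkDiagram f v s t).level m = {v ++ s, v ++ t} := by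
  have hv := h.length_lt
  have hs := h.length_eq
  have ht := h.isTwinTest.length_eq
  ext u
  simp only [mem_level, mem_nodeSet_forkDiagram, Finset.mem_insert, Finset.mem_singleton]
  constructor
  · rintro ⟨rfl | rfl | hu, hlen⟩
    · exact absurd hlen (by simp; omega)
    · omega
    · exact hu
  · rintro (rfl | rfl) <;> simp [hs, ht]

lemma level_eq_singleton (h : IsFork f m v s t) (hv : v ≠ []) :
    (forkDiagram f v s t).level v.length = {v} := by
  have hs := h.ne_nil
  have ht := h.isTwinTest.ne_nil
  ext u
  simp only [mem_level, mem_nodeSet_forkDiagram, Finset.mem_singleton]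
  constructor
  · rintro ⟨rfl | rfl | rfl | rfl, hlen⟩
    · exact (List.length_eq_zero_iff.1 hlen.symm).symm
    · rfl
    · simp_all
    · simp_all
  · rintro rfl
    simp

lemma level_eq_empty (h : IsFork f m v s t) {i : ℕ} (h_zero : i ≠ 0) (hv : i ≠ v.length)
    (hm : i ≠ m) : (forkDiagram f v s t).level i = ∅ := by
  have hs := h.length_eq
  have ht := h.isTwinTest.length_eq
  refine Finset.eq_empty_of_forall_notMem fun u hu => ?_
  obtain ⟨hu, hlen⟩ := mem_level.1 hu
  rcases mem_nodeSet_forkDiagram.1 hu with rfl | rfl | rfl | rfl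
  · exact h_zero hlen.symm
  · exact hv hlen.symm
  all_goals
    rw [List.length_append] at hlen
    omega

lemma four_le_progress (h : IsFork f m v s t) : 4 ≤ (forkDiagram f v s t).progress := by
  have hnodes : (forkDiagram f v s t).nodeSet = {[], v, v ++ s, v ++ t} := by
    ext u
    simp [mem_nodeSet_forkDiagram]
  have hcard : ({v, v ++ s, v ++ t} : Finset Str).card = 3 := by
    rw [Finset.card_eq_three]
    exact ⟨v, v ++ s, v ++ t, by simp [h.ne_nil], by simp [h.isTwinTest.ne_nil], h.append_ne, rfl⟩
  rw [progress, hnodes]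
  rcases eq_or_ne v [] with rfl | hv
  · rw [Finset.insert_idem, hcard, if_pos h.full]
  · rw [Finset.card_insert_of_notMem (by simp [hv, hv.symm]), hcard]
    omega

end IsFork

end ForkDiagram

section InitialHypothesis

variable {L : Type} [DecidableEq L] {f : Str → L} {m i : ℕ} {v s t u e e' : Str}

/-- The initial tree for the strings of length `m`, where `a` and `b` are the two sinks. -/
def sinkTree (f : Str → L) (a b : Str) : CTree L :=
  .single [] [f a, f b] fun l => if l = f a then .leaf (some a) else .leaf (some b)

/-- The initial trees. -/
def forkTree (f : Str → L) (m : ℕ) (v s t : Str) (i : ℕ) : CTree L :=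
  if i = m then sinkTree f (v ++ s) (v ++ t)
  else if i = v.length then branchTree v t (f (v ++ t)) (f (v ++ s)) else .leaf none

/-- The initial hypothesis, in terms of the node `v` and the labels `s` and `t` of its edges. -/
def forkHyp (f : Str → L) (m : ℕ) (v s t : Str) : Hyp L where
  S := forkDiagram f v s t
  T i := forkTree f m v s t i

lemma isTop_sinkTree {a b : Str} : (sinkTree f a b).IsTop f := by
  refine ⟨_, _, rfl, fun l hl => ?_⟩
  rcases eq_or_ne l (f a) with rfl | hne
  · exact ⟨a, if_pos rfl, rfl⟩
  · exact ⟨b, if_neg hne, by simp_all⟩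

lemma cost_sinkTree_le (f : Str → L) (a b u : Str) : (sinkTree f a b).cost f u ≤ 1 := by
  simp only [sinkTree, CTree.cost]
  split_ifs <;> simp [CTree.cost]

lemma treeOK_sinkTree {a b : Str} (hab : f a ≠ f b) : TreeOK f m m {a, b} (sinkTree f a b) where
  label?_self u hu := by
    rcases Finset.mem_insert.1 hu with rfl | hu
    · simp [sinkTree, CTree.label?]
    · simp [sinkTree, CTree.label?, Finset.mem_singleton.1 hu, hab.symm]
  mem_of_label? a u _ hu := by
    simp only [sinkTree, CTree.label?] at hu
    split_ifs at hu <;> simp_all [CTree.label?]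
  essential hm := absurd hm (lt_irrefl m)
  testsOfLength := by
    refine ⟨by simp, by simp, fun l _ => ?_⟩
    dsimp only
    split_ifs <;> simp [CTree.TestsOfLength]

lemma treeOK_leaf_none (f : Str → L) (m i : ℕ) : TreeOK f m i ∅ (.leaf none) where
  label?_self := by simp
  mem_of_label? a u _ hu := by simp [CTree.label?] at hu
  essential _ a _ hne := absurd rfl hne
  testsOfLength := trivial

lemma forkTree_self (f : Str → L) (m : ℕ) (v s t : Str) :
    forkTree f m v s t m = sinkTree f (v ++ s) (v ++ t) := if_pos rfl

lemma forkTree_of_ne (hm : i ≠ m) (hv : i ≠ v.length) : forkTree f m v s t i = .leaf none :=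
  (if_neg hm).trans (if_neg hv)

namespace IsFork

lemma forkTree_length (h : IsFork f m v s t) :
    forkTree f m v s t v.length = branchTree v t (f (v ++ t)) (f (v ++ s)) :=
  (if_neg h.length_lt.ne).trans (if_pos rfl)

lemma treeOK (h : IsFork f m v s t) (hi : i ≠ 0) :
    TreeOK f m i ((forkDiagram f v s t).level i) (forkTree f m v s t i) := by
  rcases eq_or_ne i m with rfl | hm
  · rw [h.level_eq_sinks, forkTree_self]
    exact treeOK_sinkTree h.isTwinTest.ne.symm
  rcases eq_or_ne i v.length with rfl | hv
  · rw [h.level_eq_singleton (List.length_pos_iff.1 (Nat.pos_of_ne_zero hi)), h.forkTree_length]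
    exact (treeOK_leaf_none f m v.length).branch rfl h.isTwinTest
  · rw [h.level_eq_empty hi hv hm, forkTree_of_ne hm hv]
    exact treeOK_leaf_none f m i

lemma cost_le (h : IsFork f m v s t) (hi : i ≠ 0) (a : Str) :
    (forkTree f m v s t i).cost f a ≤ 2 * ((forkDiagram f v s t).level i).card := by
  rcases eq_or_ne i m with rfl | hm
  · rw [h.level_eq_sinks, forkTree_self, Finset.card_pair h.append_ne]
    exact (cost_sinkTree_le _ _ _ _).trans (by norm_num)
  rcases eq_or_ne i v.length with rfl | hv
  · rw [h.level_eq_singleton (List.length_pos_iff.1 (Nat.pos_of_ne_zero hi)), h.forkTree_length,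
      cost_branchTree, Finset.card_singleton]
  · rw [forkTree_of_ne hm hv]
    exact Nat.zero_le _

lemma edgeOK_of_length_eq (h : IsFork f m v s t) (hlen : v.length + u.length = m) (hu : u ≠ [])
    (hmem : v ++ u ∈ ({v ++ s, v ++ t} : Finset Str)) :
    EdgeOK f i (forkTree f m v s t i) ⟨v, u, v ++ u⟩ := by
  rcases le_or_gt i v.length with hle | hlt
  · exact EdgeOK.of_le_src _ hle hu
  refine EdgeOK.of_label? ?_ (fun j _ hju => ?_) hlt
  · rw [hlen, forkTree_self]
    exact (treeOK_sinkTree h.isTwinTest.ne.symm (m := m)).label?_self _ hmem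
  · rw [forkTree_of_ne (by omega) (by omega)]
    rfl

lemma edgeOK (h : IsFork f m v s t) (hi : 0 < i) {E : Edge}
    (hE : E ∈ (forkDiagram f v s t).edges) : EdgeOK f i (forkTree f m v s t i) E := by
  rcases mem_edges_forkDiagram.1 hE with ⟨-, rfl⟩ | rfl | rfl
  · have hlt := h.length_lt
    refine EdgeOK.of_label? ?_ (fun j _ hjv => ?_) hi
    · rw [List.length_nil, zero_add, h.forkTree_length, label?_branchTree]
      exact if_pos ⟨rfl, h.isTwinTest.snd_eq⟩
    · rw [List.length_nil, zero_add, forkTree_of_ne (by omega) (by omega)]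
      rfl
  · exact h.edgeOK_of_length_eq h.length_eq h.ne_nil (by simp)
  · exact h.edgeOK_of_length_eq h.isTwinTest.length_eq h.isTwinTest.ne_nil (by simp)

lemma loopInvariant (h : IsFork f m v s t) : LoopInvariant f m (forkHyp f m v s t) where
  valid := h.isValid
  levels i hi _ _ := ⟨h.treeOK hi.ne', fun _ => h.edgeOK hi, h.cost_le hi.ne'⟩
  top := (congrArg (CTree.IsTop f) (forkTree_self f m v s t)).mpr isTop_sinkTree
  full u hu hne _ := by
    obtain rfl := (mem_inner_forkDiagram.1 hu).resolve_left hne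
    exact h.full
  root_out := h.exists_hasOut_root
  root_essential := h.root_essential
  sinks_ne := List.cons_ne_nil _ _

end IsFork

lemma exists_isFork (hm : 0 < m) (he' : e'.length = m) (he : e.length = m) (hne : f e ≠ f e') :
    ∃ k q, k < m ∧ q ≤ Nat.clog 2 m ∧
      Yields f (bsearch (fun i => ask (cro e' e i)) (f e') m 0 m (f e))
        (m - k, f (e'.take k ++ e.drop k)) q ∧
      IsFork f m (e'.take k) (e'.drop k) (e.drop k) := by
  have hnil : e' ≠ [] := List.length_pos_iff.1 (he' ▸ hm)
  obtain ⟨k, z, q, hk, hq, hyields, htest, hhead⟩ :=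
    exists_bsearch_isTwinTest (E := ⟨[], e', e'⟩) (f := f) he (by simp) he'.le hnil
      (by simp [he', ← he]) rfl hne
  replace hk : k < m := he' ▸ hk
  have hlen : (e'.take k).length = k := List.length_take_of_le (hk.le.trans he'.ge)
  simp only [Edge.point, List.nil_append, hlen] at htest hhead
  simp only [List.nil_append, List.length_nil, List.drop_zero, he', List.take_of_length_le he.le,
    List.drop_of_length_le he.le, List.append_nil] at hyields
  obtain rfl := htest.fst_eq
  refine ⟨k, q, hk, hq, hyields, ?_, ?_, hhead⟩
  · rwa [List.take_append_drop]
  · rw [← List.length_append, List.take_append_drop, he']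

lemma exists_initialHypothesis (hm : 0 < m) (he' : e'.length = m) (he : e.length = m)
    (hne : f e ≠ f e') :
    ∃ h q, Yields f (initialHypothesis m e' (f e') e (f e)) h q ∧ LoopInvariant f m h ∧
      4 ≤ h.S.progress ∧ q ≤ Nat.clog 2 m := by
  obtain ⟨k, q, hk, hq, hyields, hfork⟩ := exists_isFork hm he' he hne
  refine ⟨forkHyp f m (e'.take k) (e'.drop k) (e.drop k), q, ?_, hfork.loopInvariant,
    hfork.four_le_progress, hq⟩
  have hstart : Yields f (initialHypothesis m e' (f e') e (f e)) _ (q + 0) :=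
    hyields.bind (Yields.pure _)
  have hlen : (e'.take k).length = k := List.length_take_of_le (hk.le.trans he'.ge)
  have hnil_iff : m - k = m ↔ e'.take k = [] := by
    rw [← List.length_eq_zero_iff, hlen]
    omega
  have hcro : cro e' e (m - k) = e'.take k ++ e.drop k := by
    rw [cro, he', he, Nat.sub_sub_self hk.le]
  simpa only [hcro, Nat.sub_sub_self hk.le, hnil_iff, forkHyp, forkDiagram, sinkTree, forkTree,
    branchTree, hlen, List.take_append_drop, Nat.add_zero] using hstart

end InitialHypothesis

section QLearn

variable {L : Type} {V : Type*} {D : Diagram V L} {m : ℕ} {f : Str → L}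
  {EQ : ℕ → Diagram Str L → Option Str} {e e' : Str} {l : L} {t : ℕ}

lemma CorrectEQ.iso_const (hEQ : CorrectEQ D m EQ) (hD : D.IsReduced m)
    (h : EQ t (Diagram.const l) = none) : D.Iso (Diagram.const l) :=
  hD.iso (Diagram.isOrdered_const l m) ((hEQ t _ (Diagram.isOrdered_const l m)).1 h)
    (Finset.card_pos.2 ⟨_, hD.root_mem⟩)

lemma CorrectEQ.ne_of_counterexample_const (hEQ : CorrectEQ D m EQ) (hf : CorrectMQ D m f)
    (h : EQ t (Diagram.const l) = some e) : e.length = m ∧ f e ≠ l := by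
  obtain ⟨he, hne⟩ := (hEQ t _ (Diagram.isOrdered_const l m)).2 e h
  rw [Diagram.eval_const, hf e he] at hne
  exact ⟨he, fun heq => hne (congrArg some heq.symm)⟩

variable [DecidableEq L] [Zero L]

lemma exists_learns_initialHypothesis_bind (hD : D.IsReduced m) (hf : CorrectMQ D m f)
    (hEQ : CorrectEQ D m EQ) (hm : 0 < m) (he' : e'.length = m) (he : e.length = m)
    (hne : f e ≠ f e') :
    ∃ N a b, Learns D f EQ (fun fuel => initialHypothesis m e' (f e') e (f e) >>= fun h =>
        mainLoop m fuel h e (f e)) N a b ∧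
      a + 2 ≤ D.nodes.card ∧
      b + 2 ≤ 2 * D.nodes.card * (Nat.clog 2 m + 3 * D.nodes.card) := by
  obtain ⟨h, q, hyields, hI, hprogress, hq⟩ := exists_initialHypothesis hm he' he hne
  have hprogress_le := hI.progress_le hD.toIsOrdered hf
  obtain ⟨r, hr⟩ : ∃ r, D.nodes.card = r + 3 := Nat.exists_eq_add_of_le' (by omega)
  refine ⟨_, _, _, hyields.learns_bind
    (hI.learns_mainLoop hD hf hEQ r he (by omega) (Nat.le_add_right _ _)), by omega, ?_⟩
  rw [hr]
  nlinarith

variable {fuel : ℕ}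

lemma run_qLearn_of_eq_none (h : EQ 0 (Diagram.const 0) = none) :
    (qLearn m fuel).run f EQ 0 0 = (some (Diagram.const 0), 1, 0) := by
  simp only [qLearn, run_askEq_bind, h]
  rfl

lemma run_qLearn_of_eq_some_of_eq_none (h : EQ 0 (Diagram.const 0) = some e')
    (h' : EQ 1 (Diagram.const (f e')) = none) :
    (qLearn m fuel).run f EQ 0 0 = (some (Diagram.const (f e')), 2, 1) := by
  simp only [qLearn, run_askEq_bind, run_ask_bind, h, zero_add, h']
  rfl

lemma run_qLearn_of_eq_some_of_eq_some (h : EQ 0 (Diagram.const 0) = some e')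
    (h' : EQ 1 (Diagram.const (f e')) = some e) :
    (qLearn m fuel).run f EQ 0 0 = (initialHypothesis m e' (f e') e (f e) >>= fun h =>
      mainLoop m fuel h e (f e)).run f EQ 2 2 := by
  simp only [qLearn, run_askEq_bind, run_ask_bind, h, zero_add, h', one_add_one_eq_two]

end QLearn

end OMTBDD

theorem theorem1_general {L : Type} [DecidableEq L] [Zero L] {m : ℕ} (hm : 1 ≤ m) {V : Type*}
    (D : OMTBDD.Diagram V L) (hD : D.IsReduced m)
    (MQ : OMTBDD.Str → L) (hMQ : OMTBDD.CorrectMQ D m MQ)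
    (EQ : ℕ → OMTBDD.Diagram OMTBDD.Str L → Option OMTBDD.Str)
    (hEQ : OMTBDD.CorrectEQ D m EQ) :
    ∃ (H : OMTBDD.Diagram OMTBDD.Str L) (nE nM N : ℕ),
      (∀ fuel ≥ N, (OMTBDD.qLearn m fuel).run MQ EQ 0 0 = (some H, nE, nM)) ∧
      D.Iso H ∧
      nM ≤ 2 * D.nodes.card * (⌈Real.logb 2 m⌉₊ + 3 * D.nodes.card) ∧
      ((¬ ∃ l : L, l ≠ 0 ∧ D.cell D.root = .sink l) → nE ≤ D.nodes.card) ∧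
      ((∃ l : L, l ≠ 0 ∧ D.cell D.root = .sink l) → nE = 2) := by
  have hlog : ⌈Real.logb 2 m⌉₊ = Nat.clog 2 m := mod_cast Real.natCeil_logb_natCast 2 m
  have hcard : 0 < D.nodes.card := Finset.card_pos.2 ⟨_, hD.root_mem⟩
  rw [hlog]
  rcases h_zero : EQ 0 (.const 0) with _ | e'
  · have hiso := hEQ.iso_const hD h_zero
    refine ⟨_, 1, 0, 0, fun _ _ => OMTBDD.run_qLearn_of_eq_none h_zero, hiso, Nat.zero_le _,
      fun _ => hcard, ?_⟩
    rintro ⟨l, hl, hroot⟩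
    rw [hiso.cell_root_eq_sink hD.toIsOrdered] at hroot
    exact absurd (OMTBDD.Cell.sink.inj hroot).symm hl
  obtain ⟨he', hl'⟩ := hEQ.ne_of_counterexample_const hMQ h_zero
  rcases h_one : EQ 1 (.const (MQ e')) with _ | e
  · have hiso := hEQ.iso_const hD h_one
    exact ⟨_, 2, 1, 0, fun _ _ => OMTBDD.run_qLearn_of_eq_some_of_eq_none h_zero h_one, hiso,
      Nat.mul_pos (by omega) (by omega), fun hroot => absurd ⟨_, hl',
        hiso.cell_root_eq_sink hD.toIsOrdered⟩ hroot, fun _ => rfl⟩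
  obtain ⟨he, hne⟩ := hEQ.ne_of_counterexample_const hMQ h_one
  obtain ⟨N, a, b, hlearns, ha, hb⟩ :=
    OMTBDD.exists_learns_initialHypothesis_bind hD hMQ hEQ hm he' he hne
  obtain ⟨H, nE, nM, hrun, hiso, hE, hM⟩ := hlearns 2 2
  refine ⟨H, nE, nM, N, fun fuel hfuel => ?_, hiso, by omega, fun _ => by omega, ?_⟩
  · rw [OMTBDD.run_qLearn_of_eq_some_of_eq_some h_zero h_one, hrun fuel hfuel]
  · rintro ⟨l, -, hroot⟩
    exact absurd ((hMQ.eq_of_cell_root_eq_sink hroot he).trans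
      (hMQ.eq_of_cell_root_eq_sink hroot he').symm) hne

theorem theorem1 {K m : ℕ} [NeZero K] (hK : 2 ≤ K) (hm : 1 ≤ m) {V : Type*}
    (D : OMTBDD.Diagram V (Fin K)) (hD : D.IsReduced m)
    (MQ : OMTBDD.Str → Fin K) (hMQ : OMTBDD.CorrectMQ D m MQ)
    (EQ : ℕ → OMTBDD.Diagram OMTBDD.Str (Fin K) → Option OMTBDD.Str)
    (hEQ : OMTBDD.CorrectEQ D m EQ) :
    ∃ (H : OMTBDD.Diagram OMTBDD.Str (Fin K)) (nE nM N : ℕ),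
      (∀ fuel ≥ N, (OMTBDD.qLearn m fuel).run MQ EQ 0 0 = (some H, nE, nM)) ∧
      D.Iso H ∧
      nM ≤ 2 * D.nodes.card * (⌈Real.logb 2 m⌉₊ + 3 * D.nodes.card) ∧
      ((¬ ∃ l : Fin K, l ≠ 0 ∧ D.cell D.root = .sink l) → nE ≤ D.nodes.card) ∧
      ((∃ l : Fin K, l ≠ 0 ∧ D.cell D.root = .sink l) → nE = 2) :=
  theorem1_general hm D hD MQ hMQ EQ hEQ
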